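/- Let $n\ge 1$, $I=\{1,\dots,2n+1\}$ and let $W=\mathfrak S_{2n+2}$ be the Weyl group of type $A_{2n+1}$ with simple reflections $s_i$, longest element $w_0$, positive roots $\Phi^+$, and $i^*=i^\vee=2n+2-i$. Words in $I$ are taken up to commutation ($ij\sim ji$ if $|i-j|\ge 2$); $[\boldsymbol i]$ denotes the commutation class. For a class $C$ of reduced words of $w_0$, the reflection functors are $[i\,i_2\cdots i_N]\,r_i=[i_2\cdots i_N\,i^*]$ and $r_i\,[i_1\cdots i_{N-1}\,i]=[i^*\,i_1\cdots i_{N-1}]$ (and $C r_i=C$, resp. $r_iC=C$, if no word of $C$ starts, resp. ends, with $i$). The twisted adapted cluster point $[\![Q^\diamondsuit]\!]$ is the set of classes obtained by sequences of reflection functors from the class of $\prod_{k=0}^{2n}(1\,2\cdots n{+}1)^{k\vee}$; its elements are called twisted adapted classes. For a word $\boldsymbol i=i_1\cdots i_N\in C$ put $\beta_k^{\boldsymbol i}=s_{i_1}\cdots s_{i_{k-1}}(\alpha_{i_k})$ and $\beta^{\boldsymbol i}_k<_{\boldsymbol i}\beta^{\boldsymbol i}_l$ iff $k<l$; the root $\beta_k^{\boldsymbol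 i}$ has residue $i_k$. Write $\alpha\prec_C\beta$ if $\alpha<_{\boldsymbol i}\beta$ for all $\boldsymbol i\in C$. For $m,m':\Phi^+\to\mathbb Z_{\ge0}$ write $m'\prec^{\mathtt b}_C m$ if, for every $\boldsymbol i\in C$, there are $\kappa\le_{\boldsymbol i}\sigma$ such that $m'$ and $m$ agree before $\kappa$ and after $\sigma$, while $m'_\kappa<m_\kappa$ and $m'_\sigma<m_\sigma$. The weight of $m$ is $\sum_\beta m_\beta\beta$. A pair of distinct roots, regarded as a sequence $m$, is $C$-simple if there is no $m'\prec^{\mathtt b}_C m$ of the same weight; a sequence is $C$-simple if all pairs of distinct roots in its support are. The generalized distance $\mathrm{gdist}_C(m)$ is $0$ if $m$ is $C$-simple, and otherwise the largest $k$ for which there is a chain $m^{(1)}\prec^{\mathtt b}_C\cdots\prec^{\mathtt b}_C m^{(k)}=m$ of non-$C$-simple sequences of the weight of $m$. Folded coordinates. The quiver $\Upsilon_C$ has vertex set $\Phi^+$ and an arrow $\beta_k^{\boldsymbol i}\to\beta_j^{\boldsymbol i}$ whenever $i_k,i_j$ are adjacent in the Dynkin diagram, $j=\max\{j'<k: i_{j'}=i_j\}$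 and $k=\min\{k'>j: i_{k'}=i_k\}$. Let $C$ be a twisted adapted class. Deleting the letters $n+1$ from a word of $C$ and replacing $i\ge n+2$ by $i-1$ gives a reduced word of the longest element of type $A_{2n}$, adapted to a Dynkin quiver $Q$ of type $A_{2n}$. Let $\xi$ be a height function of $Q$ ($\xi(j)=\xi(i)+1$ for each arrow $i\to j$), and let $\Omega_Q$ be the coordinate map of the Auslander–Reiten quiver of $Q$: if $\phi_Q=s_{i_1}\cdots s_{i_{2n}}$ is the Coxeter element adapted to $Q$, then $s_{i_1}\cdots s_{i_{k-1}}(\alpha_{i_k})$ has coordinate $(i_k,\xi(i_k))$, and if $\beta$ has coordinate $(i,p)$ and $\phi_Q(\beta)$ is positive, then $\phi_Q(\beta)$ has coordinate $(i,p-2)$. Assign to each vertex of $\Upsilon_C$ of residue $i\ne n+1$ the coordinate $(i,p)$, where $p$ is the second coordinate of the corresponding root of type $A_{2n}$. To a vertex $v$ of residue $n+1$ assign: $(n+1,p+\frac12)$ if $v$ is a sink with an arrow $u\to v$; $(n+1,p-\frac12)$ if $v$ is a source with an arrow $v\to u$; and $(n+1,p+\frac12)$ if there are arrows $u\to v\to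 u'$, where $u'$ has second coordinate $p+1$; here $p$ is the second coordinate of $u$. If $\beta$ has coordinate $(i,p/2)$, its folded coordinate is $\widehat\Omega_C(\beta)=(\bar i,p)\in\bar I\times\mathbb Z$, where $\bar i=\min(i,2n+2-i)$ and $\bar I=\{1,\dots,n+1\}$. For $\bar k,\bar l\in\bar I$ and $t\in\mathbb Z_{\ge0}$ let $\Phi_C(\bar k,\bar l)[t]$ be the set of pairs $(\alpha,\beta)$ with $\alpha\prec_C\beta$ or $\beta\prec_C\alpha$, and $\{\widehat\Omega_C(\alpha),\widehat\Omega_C(\beta)\}=\{(\bar k,a),(\bar l,b)\}$ for some $a,b$ with $|a-b|=t$. Let $o^C_t(\bar k,\bar l)$ be the common value of $\mathrm{gdist}_C(\alpha,\beta)$ on $\Phi_C(\bar k,\bar l)[t]$ ($0$ if this set is empty). Let $\mathbf k$ be an algebraic closure of $\mathbb C(q)$, and let $q_s\in\mathbf k$ with $q_s^2=q$. The folded distance polynomial is $$\widehat D^{C}_{\bar k,\bar l}(z)=\prod_{t\ge 0}\bigl(z-(-1)^{\bar k+\bar l}q_s^{\,t}\bigr)^{\lceil o^C_t(\bar k,\bar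 l)/2\rceil}\in\mathbf k[z].$$ Proposition. Coordinates as above exist for every twisted adapted class $C$; $\mathrm{gdist}_C$ is constant on each $\Phi_C(\bar k,\bar l)[t]$, so that $o^C_t(\bar k,\bar l)$ is well defined; and for all $\bar k,\bar l\in\bar I$ and any two twisted adapted classes $C,C'\in[\![Q^\diamondsuit]\!]$ (and any choice of height functions), $$\widehat D^{C}_{\bar k,\bar l}(z)=\widehat D^{C'}_{\bar k,\bar l}(z).$$ Hence $\widehat D_{\bar k,\bar l}(z)$ is an invariant of the cluster point $[\![Q^\diamondsuit]\!]$. -/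

import Mathlib

namespace TwistedAR

/-! ### Type `A_m`: Weyl group, positive roots, words

The index set `{1, …, m}` of simple roots is `Fin m`, so `i : Fin m` stands for the index `i + 1`.
The Weyl group is the symmetric group on the indices of `ε_1, …, ε_{m+1}`, and
`α_i = ε_i - ε_{i+1}`. -/

/-- The simple reflection `s_i`. -/
def simpleRefl {m : ℕ} (i : Fin m) : Equiv.Perm (Fin (m + 1)) :=
  Equiv.swap i.castSucc i.succ

/-- The positive roots of type `A_m`: the pair `(a, b)` with `a < b` stands for `ε_a - ε_b`. -/
abbrev PosRoot (m : ℕ) : Type := {p : Fin (m + 1) × Fin (m + 1) // p.1 < p.2}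

/-- Coefficients of `ε_a - ε_b = ∑_{a ≤ i < b} α_i` in the basis of simple roots. -/
def PosRoot.coeff {m : ℕ} (β : PosRoot m) : Fin m → ℕ :=
  fun i => if β.1.1 ≤ i.castSucc ∧ i.castSucc < β.1.2 then 1 else 0

/-- Words in the simple reflections. -/
abbrev Word (m : ℕ) : Type := List (Fin m)

/-- The element `s_{i_1} ⋯ s_{i_l}` of the Weyl group represented by a word. -/
def Word.toPerm {m : ℕ} (w : Word m) : Equiv.Perm (Fin (m + 1)) :=
  (w.map simpleRefl).prod

/-- A word is reduced if no shorter word represents the same element. -/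
def Word.IsReduced {m : ℕ} (w : Word m) : Prop :=
  ∀ v : Word m, Word.toPerm v = Word.toPerm w → w.length ≤ v.length

/-- Reduced words of the longest element `w_0 : a ↦ m + 2 - a`. -/
def Word.IsReducedLongest {m : ℕ} (w : Word m) : Prop :=
  Word.toPerm w = Fin.revPerm ∧ Word.IsReduced w

/-- `w.RootAt k i β`: the letter of `w` at position `k` (counted from `0`) is `i`, and
`β = s_{i_1} ⋯ s_{i_{k}} (α_i)` is the positive root attached to that position, where
`i_1, …, i_k` are the letters before it. -/
def Word.RootAt {m : ℕ} (w : Word m) (k : ℕ) (i : Fin m) (β : PosRoot m) : Prop :=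
  w[k]? = some i ∧
    β.1 = (Word.toPerm (w.take k) i.castSucc, Word.toPerm (w.take k) i.succ)

/-- The total order `α <_w β` on positive roots attached to a reduced word of `w_0`. -/
def Word.Lt {m : ℕ} (w : Word m) (α β : PosRoot m) : Prop :=
  ∃ k l i j, k < l ∧ Word.RootAt w k i α ∧ Word.RootAt w l j β

/-! ### Commutation classes, reflection functors, cluster points -/

/-- One application of a commutation relation `s_i s_j = s_j s_i`, with `i`, `j` distinct and not
adjacent in the Dynkin diagram. -/
def CommStep {m : ℕ} (v w : Word m) : Prop :=
  ∃ (x y : Word m) (i j : Fin m), ((i : ℕ) + 1 < j ∨ (j : ℕ) + 1 < i) ∧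
    v = x ++ i :: j :: y ∧ w = x ++ j :: i :: y

/-- The commutation class `[w]` of a word. -/
def commClass {m : ℕ} (w : Word m) : Set (Word m) :=
  {v | Relation.ReflTransGen CommStep w v}

/-- `i` is a sink of the class `C`: some word of `C` starts with `i`. -/
def IsSinkIndex {m : ℕ} (C : Set (Word m)) (i : Fin m) : Prop := ∃ w, i :: w ∈ C

/-- `i` is a source of the class `C`: some word of `C` ends with `i`. -/
def IsSourceIndex {m : ℕ} (C : Set (Word m)) (i : Fin m) : Prop := ∃ w, w ++ [i] ∈ C

open Classical in
/-- The right action `C r_i` of a reflection functor: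
`[i i_2 ⋯ i_N] r_i = [i_2 ⋯ i_N i^*]`, with `i^* = Fin.rev i`. -/
noncomputable def reflRight {m : ℕ} (C : Set (Word m)) (i : Fin m) : Set (Word m) :=
  if IsSinkIndex C i then {v | ∃ w, i :: w ∈ C ∧ v ∈ commClass (w ++ [i.rev])} else C

open Classical in
/-- The left action `r_i C` of a reflection functor:
`r_i [i_1 ⋯ i_{N-1} i] = [i^* i_1 ⋯ i_{N-1}]`. -/
noncomputable def reflLeft {m : ℕ} (C : Set (Word m)) (i : Fin m) : Set (Word m) :=
  if IsSourceIndex C i then {v | ∃ w, w ++ [i] ∈ C ∧ v ∈ commClass (i.rev :: w)} else C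

/-- Reflection equivalence: `C'` is obtained from `C` by a sequence of reflection functors. -/
def ReflEquiv {m : ℕ} : Set (Word m) → Set (Word m) → Prop :=
  Relation.ReflTransGen fun C C' => ∃ i, C' = reflRight C i ∨ C' = reflLeft C i

/-- The word `∏_{k=0}^{2n} (1 2 ⋯ n+1)^{k∨}` of type `A_{2n+1}`, where `i^∨ = 2n+2-i`. -/
def baseWord (n : ℕ) : Word (2 * n + 1) :=
  (List.range (2 * n + 1)).flatMap fun k =>
    (List.finRange (n + 1)).map fun i => Fin.rev^[k] (i.castLE (by omega))

/-- The twisted adapted cluster point of type `A_{2n+1}`; its elements are the twisted adapted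
classes. -/
def twistedCluster (n : ℕ) : Set (Set (Word (2 * n + 1))) :=
  {C | ReflEquiv (commClass (baseWord n)) C}

/-! ### The partial order of a class, and the quiver of a class -/

/-- The partial order `α ≺_C β`. -/
def Prec {m : ℕ} (C : Set (Word m)) (α β : PosRoot m) : Prop :=
  ∀ w ∈ C, Word.Lt w α β

/-- The root `β` has residue `i` in the combinatorial Auslander–Reiten quiver of `C`. -/
def HasResidue {m : ℕ} (C : Set (Word m)) (β : PosRoot m) (i : Fin m) : Prop :=
  ∃ w ∈ C, ∃ k, Word.RootAt w k i β

/-- There is an arrow `β → γ` in the combinatorial Auslander–Reiten quiver of `C`: `β` and `γ` are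
attached to positions `k` and `j` whose letters are adjacent in the Dynkin diagram, where `j` is the
last position before `k` with its letter and `k` is the first position after `j` with its letter. -/
def Arrow {m : ℕ} (C : Set (Word m)) (β γ : PosRoot m) : Prop :=
  ∃ w ∈ C, ∃ (k j : ℕ) (a b : Fin m), Word.RootAt w k a β ∧ Word.RootAt w j b γ ∧
    ((a : ℕ) + 1 = b ∨ (b : ℕ) + 1 = a) ∧
    IsGreatest {j' | j' < k ∧ w[j']? = some b} j ∧
    IsLeast {k' | j < k' ∧ w[k']? = some a} k

/-- `β` is a sink of the quiver of `C`. -/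
def IsSinkVertex {m : ℕ} (C : Set (Word m)) (β : PosRoot m) : Prop := ∀ γ, ¬ Arrow C β γ

/-- `β` is a source of the quiver of `C`. -/
def IsSourceVertex {m : ℕ} (C : Set (Word m)) (β : PosRoot m) : Prop := ∀ γ, ¬ Arrow C γ β

/-! ### Dynkin quivers of type `A_m` and coordinates of their Auslander–Reiten quivers -/

/-- A Dynkin quiver of type `A_m`: an orientation of every edge of the Dynkin diagram. -/
structure DynkinQuiver (m : ℕ) where
  /-- `arrow i j`: there is an arrow `i → j`. -/
  arrow : Fin m → Fin m → Prop
  adj_of_arrow : ∀ i j : Fin m, arrow i j → (i : ℕ) + 1 = j ∨ (j : ℕ) + 1 = i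
  oriented : ∀ i j : Fin m, (i : ℕ) + 1 = j ∨ (j : ℕ) + 1 = i → Xor (arrow i j) (arrow j i)

/-- `i` is a sink of `Q`: no arrow leaves `i`. -/
def DynkinQuiver.IsSink {m : ℕ} (Q : DynkinQuiver m) (i : Fin m) : Prop := ∀ j, ¬ Q.arrow i j

/-- The quiver `i Q`: reverse all arrows incident with `i`. -/
def DynkinQuiver.reverseAt {m : ℕ} (Q : DynkinQuiver m) (i : Fin m) : DynkinQuiver m where
  arrow a b := if a = i ∨ b = i then Q.arrow b a else Q.arrow a b
  adj_of_arrow a b h := by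
    split_ifs at h
    · exact (Q.adj_of_arrow b a h).symm
    · exact Q.adj_of_arrow a b h
  oriented a b h := by
    by_cases h' : a = i ∨ b = i
    · simpa only [if_pos h', if_pos h'.symm] using Q.oriented b a h.symm
    · simpa only [if_neg h', if_neg (fun h'' => h' (Or.symm h''))] using Q.oriented a b h

/-- `i_1 ⋯ i_l` is adapted to `Q`: each `i_k` is a sink of `i_{k-1} ⋯ i_1 Q`. -/
def IsAdapted {m : ℕ} : DynkinQuiver m → Word m → Prop
  | _, [] => True
  | Q, i :: w => Q.IsSink i ∧ IsAdapted (Q.reverseAt i) w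

/-- The commutation class `[Q]`: the reduced words of `w_0` adapted to `Q`. -/
def adaptedClass {m : ℕ} (Q : DynkinQuiver m) : Set (Word m) :=
  {w | Word.IsReducedLongest w ∧ IsAdapted Q w}

/-- `c` is a word of the Coxeter element `φ_Q`: it is adapted to `Q` and contains every letter
exactly once. -/
def IsCoxeterWord {m : ℕ} (Q : DynkinQuiver m) (c : Word m) : Prop :=
  c.Nodup ∧ (∀ i, i ∈ c) ∧ IsAdapted Q c

/-- Height functions on `Q`: `ξ j = ξ i + 1` for every arrow `i → j`. -/
def IsHeight {m : ℕ} (Q : DynkinQuiver m) (ξ : Fin m → ℤ) : Prop :=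
  ∀ i j, Q.arrow i j → ξ j = ξ i + 1

/-- `ω` is the coordinate map `Ω_Q : Φ⁺ → I × ℤ` of the Auslander–Reiten quiver of `Q` for the
height function `ξ`: for `φ_Q = s_{i_1} ⋯ s_{i_m}` the root `s_{i_1} ⋯ s_{i_{k-1}}(α_{i_k})` has
coordinate `(i_k, ξ(i_k))`, and if `β` has coordinate `(i, p)` and `φ_Q(β)` is positive, then
`φ_Q(β)` has coordinate `(i, p - 2)`. -/
def IsARCoordinate {m : ℕ} (Q : DynkinQuiver m) (ξ : Fin m → ℤ)
    (ω : PosRoot m → Fin m × ℤ) : Prop :=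
  ∀ c, IsCoxeterWord Q c →
    (∀ k i β, Word.RootAt c k i β → ω β = (i, ξ i)) ∧
    ∀ β γ : PosRoot m, γ.1 = (Word.toPerm c β.1.1, Word.toPerm c β.1.2) →
      ω γ = ((ω β).1, (ω β).2 - 2)

/-! ### Coordinates of twisted and folded Auslander–Reiten quivers -/

/-- The middle index `n + 1` of type `A_{2n+1}`. -/
def mid (n : ℕ) : Fin (2 * n + 1) := ⟨n, by omega⟩

/-- The map on letters `{1, …, 2n+1} → {1, …, 2n} ∪ {∅}`: `i ↦ i` for `i ≤ n`, `n + 1 ↦ ∅`, and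
`i ↦ i - 1` for `i ≥ n + 2`. -/
def projLetter (n : ℕ) (i : Fin (2 * n + 1)) : Option (Fin (2 * n)) :=
  if h : (i : ℕ) < n then some ⟨i, by omega⟩
  else if h' : n < (i : ℕ) then some ⟨(i : ℕ) - 1, by omega⟩ else none

/-- The monoid homomorphism from words of type `A_{2n+1}` to words of type `A_{2n}` extending
`projLetter`. -/
def projWord (n : ℕ) (w : Word (2 * n + 1)) : Word (2 * n) := w.filterMap (projLetter n)

/-- `Ω` is a coordinate map of the twisted Auslander–Reiten quiver of the class `C` of type
`A_{2n+1}`. Coordinates lie in `I × ½ℤ`; the coordinate `(i, p)` is recorded as `(i, 2p)`, an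
element of `I × ℤ`.

The class `C` projects to the class `[Q]` of a Dynkin quiver `Q` of type `A_{2n}`, and `ω` is the
coordinate map of the Auslander–Reiten quiver of `Q`. Deleting the letters `n + 1` from a word
`w ∈ C` identifies the vertices of residue `i ≠ n + 1` with the vertices of the quiver of `Q`; these
keep the second coordinate of the corresponding vertex. A vertex of residue `n + 1` lies half a unit
to the right of a neighbour from which it receives an arrow, respectively, if it is a source, half a
unit to the left of a neighbour to which it sends an arrow. -/
def IsTwistedCoordinate {n : ℕ} (C : Set (Word (2 * n + 1)))
    (Ω : PosRoot (2 * n + 1) → Fin (2 * n + 1) × ℤ) : Prop :=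
  ∃ (Q : DynkinQuiver (2 * n)) (ξ : Fin (2 * n) → ℤ) (ω : PosRoot (2 * n) → Fin (2 * n) × ℤ),
    (∀ w ∈ C, projWord n w ∈ adaptedClass Q) ∧ IsHeight Q ξ ∧ IsARCoordinate Q ξ ω ∧
    (∀ w ∈ C, ∀ k i j β γ, i ≠ mid n → Word.RootAt w k i β →
      Word.RootAt (projWord n w) (projWord n (w.take k)).length j γ →
        Ω β = (i, 2 * (ω γ).2)) ∧
    (∀ β γ, HasResidue C β (mid n) → IsSinkVertex C β → Arrow C γ β →
      Ω β = (mid n, (Ω γ).2 + 1)) ∧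
    (∀ β γ, HasResidue C β (mid n) → IsSourceVertex C β → Arrow C β γ →
      Ω β = (mid n, (Ω γ).2 - 1)) ∧
    (∀ β γ δ, HasResidue C β (mid n) → Arrow C γ β → Arrow C β δ →
      (Ω δ).2 = (Ω γ).2 + 2 ∧ Ω β = (mid n, (Ω γ).2 + 1))

/-- The orbit of `i` under `i ↦ 2n+2-i`, as an element of `{1, …, n+1}` (here `Fin (n + 1)`):
the smaller element of the orbit. -/
def orbit (n : ℕ) (i : Fin (2 * n + 1)) : Fin (n + 1) :=
  ⟨min (i : ℕ) (i.rev : ℕ), by have := Fin.val_rev i; omega⟩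

/-- The folded coordinate `(ī, p)` of a root with twisted coordinate `(i, p/2)`. -/
def folded {n : ℕ} (Ω : PosRoot (2 * n + 1) → Fin (2 * n + 1) × ℤ) (β : PosRoot (2 * n + 1)) :
    Fin (n + 1) × ℤ :=
  (orbit n (Ω β).1, (Ω β).2)

/-! ### Sequences of positive roots and generalized distance -/

/-- Sequences `(m_β)` of nonnegative integers indexed by positive roots. A reduced word of `w_0`
orders the positive roots, and thereby the entries of the sequence. -/
abbrev RootSeq (m : ℕ) : Type := PosRoot m → ℕ

/-- The weight `∑ m_β β`, in the basis of simple roots. -/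
def weight {m : ℕ} (s : RootSeq m) : Fin m → ℕ := ∑ β, s β • β.coeff

/-- The bi-lexicographic order `s' <^b_w s` attached to a word: there are `κ ≤_w σ` such that `s'`
and `s` agree before `κ` and after `σ`, and `s' < s` at `κ` and at `σ`. -/
def BiLexLt {m : ℕ} (w : Word m) (s' s : RootSeq m) : Prop :=
  ∃ κ σ : PosRoot m, (κ = σ ∨ Word.Lt w κ σ) ∧
    (∀ τ, Word.Lt w τ κ ∨ Word.Lt w σ τ → s' τ = s τ) ∧ s' κ < s κ ∧ s' σ < s σ

/-- The order `s' ≺^b_C s` attached to a commutation class. -/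
def SeqPrec {m : ℕ} (C : Set (Word m)) (s' s : RootSeq m) : Prop :=
  ∀ w ∈ C, BiLexLt w s' s

/-- The pair `(α, β)` as a sequence. -/
def pairSeq {m : ℕ} (α β : PosRoot m) : RootSeq m := Pi.single α 1 + Pi.single β 1

/-- The pair `(α, β)` is `C`-simple: no sequence of the same weight is smaller. -/
def IsSimplePair {m : ℕ} (C : Set (Word m)) (α β : PosRoot m) : Prop :=
  ¬ ∃ s : RootSeq m, SeqPrec C s (pairSeq α β) ∧ weight s = weight (pairSeq α β)

/-- A sequence is `C`-simple if any two distinct roots in its support form a `C`-simple pair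
(in particular if it is a multiple of one root). -/
def IsSimpleSeq {m : ℕ} (C : Set (Word m)) (s : RootSeq m) : Prop :=
  ∀ α β, α ≠ β → 0 < s α → 0 < s β → IsSimplePair C α β

open Classical in
/-- The generalized `C`-distance of `s`: `0` if `s` is `C`-simple, and otherwise the largest `k` for
which there is a chain `c 1 ≺^b ⋯ ≺^b c k = s` of non-simple sequences of the weight of `s`. -/
noncomputable def gdist {m : ℕ} (C : Set (Word m)) (s : RootSeq m) : ℕ :=
  if IsSimpleSeq C s then 0
  else sSup {k | 1 ≤ k ∧ ∃ c : ℕ → RootSeq m, c k = s ∧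
    (∀ i, 1 ≤ i → i ≤ k → ¬ IsSimpleSeq C (c i) ∧ weight (c i) = weight s) ∧
    ∀ i, 1 ≤ i → i < k → SeqPrec C (c i) (c (i + 1))}

/-! ### Folded distance polynomials -/

/-- The pairs of comparable roots with folded residues `k`, `l` at folded distance `t`. -/
def pairsAt {n : ℕ} (C : Set (Word (2 * n + 1)))
    (Ω : PosRoot (2 * n + 1) → Fin (2 * n + 1) × ℤ) (k l : Fin (n + 1)) (t : ℕ) :
    Set (PosRoot (2 * n + 1) × PosRoot (2 * n + 1)) :=
  {p | (Prec C p.1 p.2 ∨ Prec C p.2 p.1) ∧ ∃ a b : ℤ,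
    ({folded Ω p.1, folded Ω p.2} : Set (Fin (n + 1) × ℤ)) = {(k, a), (l, b)} ∧ |a - b| = t}

/-- The common value `o_t(k, l)` of the generalized distance on the pairs in `pairsAt C Ω k l t`
(`0` if there is no such pair). It is written as a supremum, for want of a chosen pair. -/
noncomputable def commonDist {n : ℕ} (C : Set (Word (2 * n + 1)))
    (Ω : PosRoot (2 * n + 1) → Fin (2 * n + 1) × ℤ) (k l : Fin (n + 1)) (t : ℕ) : ℕ :=
  sSup ((fun p => gdist C (pairSeq p.1 p.2)) '' pairsAt C Ω k l t)

open Polynomial in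
/-- The folded distance polynomial
`∏_{t ≥ 0} (z - (-1)^{k+l} q_s^t)^{⌈o_t(k,l)/2⌉}`; the indices `k l : Fin (n + 1)` stand for
`k + 1` and `l + 1`, and only finitely many factors are different from `1`. -/
noncomputable def foldedDistPoly {n : ℕ} {𝕜 : Type*} [Field 𝕜] (qs : 𝕜)
    (C : Set (Word (2 * n + 1))) (Ω : PosRoot (2 * n + 1) → Fin (2 * n + 1) × ℤ)
    (k l : Fin (n + 1)) : 𝕜[X] :=
  ∏ᶠ t : ℕ, (X - Polynomial.C ((-1) ^ (((k : ℕ) + 1) + ((l : ℕ) + 1)) * qs ^ t)) ^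
    ⌈(commonDist C Ω k l t : ℚ) / 2⌉₊

end TwistedAR

namespace TwistedAR

/-! ### Cuts of the periodic heap of a clock -/

/-! All twisted adapted classes are pieces of one infinite periodic heap. Side letters tick every 4
units of time and the middle letter every 2, a unit of time being half a unit of coordinates. A
class is the set of legal words from a cut `h` of the heap to the image of `h` under `i ↦ i^*` and a
shift by `4n+2`; this set is the window of `h`. Legal words with the same ends are commutation
equivalent (`Legal.comm`), and a reflection functor removes a tick at one end of a window and adds
its mirror image at the other end. So the functors only move the cut, and every class of the cluster
is a window (`exists_window_of_mem_twistedCluster`).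

Roots are read off from the heap as a wiring diagram. A `Labelling` names the strands so that a
window reverses their order and the two strands crossing at a tick depend on the tick alone. Every
word of a window is then a word of `w_0` with as many letters as there are positive roots, and each
tick of a window carries one root. In type `A_m` the strands are lines of slope `±1` reflected at
the boundary, labelled modulo `2m+2` (`arLabelling`). In type `A_{2n+1}` they are the strands of
type `A_{2n}` together with one strand oscillating around the middle (`twLabelling`).

Generalized distance and comparability belong to pairs of ticks, not to windows. Passing one tick
`i` applies `s_i` to all roots except `α_i` and keeps their order. Since `α_i` is the first root in
some word of the old class and the last in some word of the new one, a sequence below one that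
vanishes at `α_i` vanishes there too, so nothing is lost (`Labelling.transport_raise`). Two windows
containing the same pair of ticks are compared through the meet of their cuts
(`Labelling.samePair`). The heap is also symmetric under `i ↦ i^*` with a shift congruent to 2
modulo 4, and under reversal of time. Hence the distance of a pair depends only on the orbits of the
letters and on the absolute difference of the times (`samePair_of_folded`).

It remains to see which differences occur. Those below `4n+2` that occur in the heap occur in every
window (`exists_inSpan_pair`). For larger ones the two ticks can be made the first and the last of a
window; their roots are then non-adjacent simple roots and the distance is 0
(`Labelling.gdist_eq_zero_of_far`). So exponents agree even where a set of pairs is empty for one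
class only.

Coordinates are times with reversed sign, up to a constant. Deleting the middle letter projects
windows to those of type `A_{2n}`, where the Coxeter element moves a root to the next tick of the
same letter; this fixes the coordinates of side vertices. Every middle vertex has an arrow to or
from a side vertex, which fixes the rest (`exists_twistedCoordinate`, `twistedCoordinate_rigid`). -/

/-- Adjacency in the Dynkin diagram. -/
def Adj {m : ℕ} (i j : Fin m) : Prop := (i : ℕ) + 1 = j ∨ (j : ℕ) + 1 = i

theorem Adj.symm {m : ℕ} {i j : Fin m} (h : Adj i j) : Adj j i := Or.symm h

theorem Adj.ne {m : ℕ} {i j : Fin m} (h : Adj i j) : i ≠ j := by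
  rintro rfl; rcases h with h | h <;> omega

theorem Adj.rev {m : ℕ} {i j : Fin m} (h : Adj i j) : Adj i.rev j.rev := by
  have := Fin.val_rev i
  have := Fin.val_rev j
  have := i.2
  have := j.2
  unfold Adj at *
  omega

/-- A clock lets the letter `i` tick at the times `off i + step i * a`; adjacent letters never tick
simultaneously. The ticks, ordered by time along adjacent letters, form a periodic heap. -/
structure Clock (m : ℕ) where
  /-- the period of a letter -/
  step : Fin m → ℤ
  /-- one tick of a letter -/
  off : Fin m → ℤ
  step_pos : ∀ i, 0 < step i
  no_tie : ∀ i j, Adj i j → ∀ a b : ℤ, off i + step i * a ≠ off j + step j * b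

namespace Clock

variable {m : ℕ} (K : Clock m)

/-- `t` is a tick of the letter `i`. -/
def OnTime (i : Fin m) (t : ℤ) : Prop := K.step i ∣ t - K.off i

/-- A cut of the heap, given by the first tick of each letter which is not in the past. -/
structure IsCut (h : Fin m → ℤ) : Prop where
  onTime : ∀ i, K.OnTime i (h i)
  lt : ∀ i j, Adj i j → h i - K.step i < h j

/-- The next tick of `i` is minimal among the ticks which are not in the past. -/
def Sink (h : Fin m → ℤ) (i : Fin m) : Prop := ∀ j, Adj i j → h i < h j

/-- Move the next tick of `i` to the past. -/
def raise (h : Fin m → ℤ) (i : Fin m) : Fin m → ℤ := Function.update h i (h i + K.step i)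

/-- Move the ticks of a word to the past. -/
def run (h : Fin m → ℤ) (w : Word m) : Fin m → ℤ := fun i => h i + K.step i * (w.count i : ℤ)

/-- The letters of the word are successively sinks. -/
def Legal : (Fin m → ℤ) → Word m → Prop
  | _, [] => True
  | h, i :: w => Sink h i ∧ Legal (K.raise h i) w

variable {K}

theorem OnTime.ne {i j : Fin m} (hij : Adj i j) {a b : ℤ} (ha : K.OnTime i a)
    (hb : K.OnTime j b) : a ≠ b := by
  obtain ⟨x, hx⟩ := ha
  obtain ⟨y, hy⟩ := hb
  have := K.no_tie i j hij x y
  omega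

theorem OnTime.add_step {i : Fin m} {a : ℤ} (ha : K.OnTime i a) :
    K.OnTime i (a + K.step i) := by
  obtain ⟨x, hx⟩ := ha
  exact ⟨x + 1, by linear_combination hx⟩

theorem OnTime.sub_step {i : Fin m} {a : ℤ} (ha : K.OnTime i a) :
    K.OnTime i (a - K.step i) := by
  obtain ⟨x, hx⟩ := ha
  exact ⟨x - 1, by linear_combination hx⟩

theorem OnTime.le_sub_step {i : Fin m} {a b : ℤ} (ha : K.OnTime i a) (hb : K.OnTime i b)
    (hab : a < b) : a ≤ b - K.step i := by
  obtain ⟨x, hx⟩ := ha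
  obtain ⟨y, hy⟩ := hb
  have hs := K.step_pos i
  have hxy : x < y := by
    by_contra hc
    have := mul_le_mul_of_nonneg_left (not_lt.mp hc) hs.le
    omega
  have := mul_le_mul_of_nonneg_left (Int.add_one_le_iff.mpr hxy) hs.le
  linarith

theorem OnTime.exists_count {i : Fin m} {a b : ℤ} (ha : K.OnTime i a) (hb : K.OnTime i b)
    (hab : a ≤ b) : ∃ c : ℕ, b = a + K.step i * c := by
  obtain ⟨x, hx⟩ := ha
  obtain ⟨y, hy⟩ := hb
  have hs := K.step_pos i
  have hxy : x ≤ y := by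
    by_contra hc
    have := mul_lt_mul_of_pos_left (not_le.mp hc) hs
    omega
  refine ⟨(y - x).toNat, ?_⟩
  rw [Int.toNat_of_nonneg (by omega)]
  linear_combination hy - hx

@[simp] theorem raise_self (h : Fin m → ℤ) (i : Fin m) : K.raise h i i = h i + K.step i := by
  simp [raise]

theorem raise_of_ne (h : Fin m → ℤ) {i j : Fin m} (hj : j ≠ i) : K.raise h i j = h j := by
  simp [raise, hj]

theorem le_raise (h : Fin m → ℤ) (i j : Fin m) : h j ≤ K.raise h i j := by
  by_cases hj : j = i
  · subst hj; have := K.step_pos j; simp; omega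
  · rw [raise_of_ne h hj]

@[simp] theorem run_nil (h : Fin m → ℤ) : K.run h [] = h := by
  funext i; simp [run]

theorem run_cons (h : Fin m → ℤ) (i : Fin m) (w : Word m) :
    K.run h (i :: w) = K.run (K.raise h i) w := by
  funext j
  by_cases hj : j = i
  · subst hj; simp [run]; ring
  · simp [run, raise_of_ne h hj, List.count_cons_of_ne (Ne.symm hj)]

theorem run_append (h : Fin m → ℤ) (u v : Word m) :
    K.run h (u ++ v) = K.run (K.run h u) v := by
  funext j; simp [run]; ring

theorem run_singleton (h : Fin m → ℤ) (i : Fin m) : K.run h [i] = K.raise h i := by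
  rw [run_cons, run_nil]

theorem run_concat (h : Fin m → ℤ) (u : Word m) (i : Fin m) :
    K.run h (u ++ [i]) = K.raise (K.run h u) i := by
  rw [run_append, run_singleton]

theorem run_perm (h : Fin m → ℤ) {u v : Word m} (huv : u.Perm v) : K.run h u = K.run h v := by
  funext j; simp [run, huv.count_eq]

theorem le_run (h : Fin m → ℤ) (w : Word m) (i : Fin m) : h i ≤ K.run h w i := by
  have := mul_nonneg (K.step_pos i).le (Int.natCast_nonneg (w.count i))
  unfold run
  linarith

theorem run_of_notMem (h : Fin m → ℤ) {w : Word m} {i : Fin m} (hi : i ∉ w) :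
    K.run h w i = h i := by
  simp [run, List.count_eq_zero_of_not_mem hi]

theorem count_eq_of_run_eq {h : Fin m → ℤ} {u v : Word m} {i : Fin m}
    (e : K.run h u i = K.run h v i) : u.count i = v.count i := by
  unfold run at e
  have := mul_left_cancel₀ (K.step_pos i).ne' (add_left_cancel e)
  exact_mod_cast this

theorem legal_append (h : Fin m → ℤ) (u v : Word m) :
    K.Legal h (u ++ v) ↔ K.Legal h u ∧ K.Legal (K.run h u) v := by
  induction u generalizing h with
  | nil => simp [Legal]
  | cons i u ih => simp only [List.cons_append, Legal, ih, run_cons, and_assoc]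

theorem legal_singleton (h : Fin m → ℤ) (i : Fin m) : K.Legal h [i] ↔ Sink h i := by
  simp [Legal]

theorem legal_concat (h : Fin m → ℤ) (u : Word m) (i : Fin m) :
    K.Legal h (u ++ [i]) ↔ K.Legal h u ∧ Sink (K.run h u) i := by
  rw [legal_append, legal_singleton]

theorem split_at {w : Word m} {k : ℕ} {i : Fin m} (hk : w[k]? = some i) :
    w = w.take k ++ i :: w.drop (k + 1) := by
  obtain ⟨hlt, hi⟩ := List.getElem?_eq_some_iff.mp hk
  rw [← hi, ← List.drop_eq_getElem_cons hlt, List.take_append_drop]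

theorem Legal.take {h : Fin m → ℤ} {w : Word m} (hw : K.Legal h w) (k : ℕ) :
    K.Legal h (w.take k) := by
  rw [← List.take_append_drop k w, legal_append] at hw
  exact hw.1

theorem Legal.sink {h : Fin m → ℤ} {w : Word m} (hw : K.Legal h w) {k : ℕ} {i : Fin m}
    (hk : w[k]? = some i) : Sink (K.run h (w.take k)) i := by
  rw [split_at hk, legal_append] at hw
  exact hw.2.1

theorem IsCut.raise {h : Fin m → ℤ} (hc : K.IsCut h) {i : Fin m} (hi : Sink h i) :
    K.IsCut (K.raise h i) where
  onTime j := by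
    by_cases hj : j = i
    · subst hj; rw [raise_self]; exact (hc.onTime j).add_step
    · rw [raise_of_ne h hj]; exact hc.onTime j
  lt a b hab := by
    by_cases ha : a = i
    · subst ha
      rw [raise_self, raise_of_ne h hab.ne.symm]
      have := hi b hab
      omega
    · have := hc.lt a b hab
      rw [raise_of_ne h ha]
      exact lt_of_lt_of_le this (le_raise h i b)

theorem IsCut.run {h : Fin m → ℤ} (hc : K.IsCut h) {w : Word m} (hw : K.Legal h w) :
    K.IsCut (K.run h w) := by
  induction w generalizing h with
  | nil => simpa using hc
  | cons i w ih => rw [run_cons]; exact ih (hc.raise hw.1) hw.2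

/-- A cut below another one is connected to it by a legal word. -/
theorem exists_legal {g h : Fin m → ℤ} (hg : K.IsCut g) (hh : K.IsCut h) (hle : ∀ i, g i ≤ h i) :
    ∃ w, K.Legal g w ∧ K.run g w = h := by
  induction hN : (∑ i, (h i - g i)).toNat using Nat.strong_induction_on generalizing g with
  | _ N ih =>
  by_cases heq : g = h
  · exact ⟨[], trivial, by simpa using heq⟩
  obtain ⟨i₀, hi₀⟩ : ∃ i, g i < h i := by
    by_contra hc
    push Not at hc
    exact heq (funext fun i => le_antisymm (hle i) (hc i))
  -- Among the letters still behind `h`, one with the earliest next tick is a sink: minimality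
  -- handles the letters behind `h`, and the cut condition on `h` handles those that have already
  -- arrived.
  obtain ⟨i, hi, hmin⟩ := Finset.exists_min_image (Finset.univ.filter fun i => g i < h i) g
    ⟨i₀, by simpa using hi₀⟩
  simp only [Finset.mem_filter, Finset.mem_univ, true_and] at hi hmin
  have hstep := (hg.onTime i).le_sub_step (hh.onTime i) hi
  have hs : Sink g i := by
    intro j hij
    rcases (hle j).lt_or_eq with hj | hj
    · exact lt_of_le_of_ne (hmin j hj) ((hg.onTime i).ne hij (hg.onTime j))
    · rw [hj]; exact lt_of_le_of_lt hstep (hh.lt i j hij)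
  have hle' : ∀ j, K.raise g i j ≤ h j := by
    intro j
    by_cases hj : j = i
    · subst hj; rw [raise_self]; omega
    · rw [raise_of_ne g hj]; exact hle j
  have hlt : ∑ j, (h j - K.raise g i j) < ∑ j, (h j - g j) := by
    refine Finset.sum_lt_sum (fun j _ => by have := le_raise (K := K) g i j; omega)
      ⟨i, Finset.mem_univ _, ?_⟩
    have := K.step_pos i
    rw [raise_self]; omega
  have h0 : 0 ≤ ∑ j, (h j - K.raise g i j) :=
    Finset.sum_nonneg fun j _ => by have := hle' j; omega
  obtain ⟨w, hw, hr⟩ := ih _ (by omega) (hg.raise hs) hle' rfl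
  exact ⟨i :: w, ⟨hs, hw⟩, by rw [run_cons, hr]⟩

/-- Cuts form a lattice. Meets make any two windows comparable with a common earlier one, and meets
and joins together clip a cut between two others. -/
theorem IsCut.min {g h : Fin m → ℤ} (hg : K.IsCut g) (hh : K.IsCut h) :
    K.IsCut fun i => min (g i) (h i) where
  onTime i := by
    rcases min_choice (g i) (h i) with e | e <;> rw [e]
    exacts [hg.onTime i, hh.onTime i]
  lt i j hij := by
    have := hg.lt i j hij
    have := hh.lt i j hij
    omega

theorem IsCut.max {g h : Fin m → ℤ} (hg : K.IsCut g) (hh : K.IsCut h) :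
    K.IsCut fun i => max (g i) (h i) where
  onTime i := by
    rcases max_choice (g i) (h i) with e | e <;> rw [e]
    exacts [hg.onTime i, hh.onTime i]
  lt i j hij := by
    have := hg.lt i j hij
    have := hh.lt i j hij
    omega

/-! ### Cuts at a given time -/

variable (K) in
/-- The first tick of the letter `i` which is not before `a`. -/
def slice (a : ℤ) : Fin m → ℤ := fun i => a + (K.off i - a) % K.step i

theorem le_slice (a : ℤ) (i : Fin m) : a ≤ K.slice a i := by
  have := Int.emod_nonneg (K.off i - a) (K.step_pos i).ne'
  unfold slice; omega

theorem slice_lt (a : ℤ) (i : Fin m) : K.slice a i < a + K.step i := by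
  have := Int.emod_lt_of_pos (K.off i - a) (K.step_pos i)
  unfold slice; omega

theorem slice_onTime (a : ℤ) (i : Fin m) : K.OnTime i (K.slice a i) := by
  have := Int.emod_add_mul_ediv (K.off i - a) (K.step i)
  exact ⟨-((K.off i - a) / K.step i), by unfold slice; linear_combination this⟩

theorem slice_isCut (a : ℤ) : K.IsCut (K.slice a) where
  onTime := slice_onTime a
  lt i j _ := by
    have := slice_lt (K := K) a i
    have := le_slice (K := K) a j
    omega

theorem slice_le {a b : ℤ} {i : Fin m} (hb : K.OnTime i b) (hab : a ≤ b) : K.slice a i ≤ b := by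
  by_contra hc
  have := hb.le_sub_step (slice_onTime a i) (not_le.mp hc)
  have := slice_lt (K := K) a i
  omega

theorem slice_eq {a : ℤ} {i : Fin m} (ha : K.OnTime i a) : K.slice a i = a :=
  le_antisymm (slice_le ha le_rfl) (le_slice a i)

/-! ### Commutation classes of legal words -/

/-- A sink occurring in a legal word commutes with the letters before its first occurrence. -/
theorem Legal.not_adj_of_sink {h : Fin m → ℤ} {u v : Word m} {i : Fin m}
    (hw : K.Legal h (u ++ i :: v)) (hi : Sink h i) (hu : i ∉ u) : ∀ j ∈ u, ¬ Adj i j := by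
  intro j hj hij
  obtain ⟨k, hk⟩ := List.mem_iff_getElem?.mp hj
  have hs := (((legal_append h u _).mp hw).1).sink hk i hij.symm
  rw [run_of_notMem h (fun hm => hu (List.mem_of_mem_take hm))] at hs
  have := hi j hij
  have := le_run (K := K) h (u.take k) j
  omega

/-- The last occurrence of a letter `i` commutes with the letters after it if `i` is a source. -/
theorem Legal.not_adj_of_source {h : Fin m → ℤ} (hc : K.IsCut h) {u v : Word m} {i : Fin m}
    (hw : K.Legal h (u ++ i :: v)) (hv : i ∉ v)
    (hi : ∀ j, Adj i j → K.run h (u ++ i :: v) j - K.step j <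
      K.run h (u ++ i :: v) i - K.step i) : ∀ j ∈ v, ¬ Adj i j := by
  intro j hj hij
  obtain ⟨k, hk⟩ := List.mem_iff_getElem?.mp hj
  have e : u ++ i :: v = (u ++ [i]) ++ v := by simp
  rw [e, legal_append] at hw
  have hs := hw.2.sink hk
  have hcut := (hc.run hw.1).run (hw.2.take k)
  have h1 := hcut.lt i j hij
  rw [run_of_notMem _ (fun hm => hv (List.mem_of_mem_take hm))] at h1
  have h2 := hi j hij
  rw [e, run_append, run_of_notMem _ hv] at h2
  have h3 : K.run (K.run h (u ++ [i])) (v.take k) j + K.step j ≤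
      K.run (K.run h (u ++ [i])) v j := by
    conv_rhs => rw [split_at hk, run_append, run_cons]
    refine le_trans ?_ (le_run _ _ _)
    rw [raise_self]
  omega

end Clock

open Clock

variable {m : ℕ} {K : Clock m}

theorem CommStep.symm {v w : Word m} (h : CommStep v w) : CommStep w v := by
  obtain ⟨x, y, i, j, hij, rfl, rfl⟩ := h
  exact ⟨x, y, j, i, hij.symm, rfl, rfl⟩

theorem CommStep.append_left {v w : Word m} (h : CommStep v w) (u : Word m) :
    CommStep (u ++ v) (u ++ w) := by
  obtain ⟨x, y, i, j, hij, rfl, rfl⟩ := h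
  exact ⟨u ++ x, y, i, j, hij, by simp, by simp⟩

theorem CommStep.perm {v w : Word m} (h : CommStep v w) : v.Perm w := by
  obtain ⟨x, y, i, j, -, rfl, rfl⟩ := h
  exact (List.Perm.swap j i y).append_left x

theorem commSymm {v w : Word m} (h : Relation.ReflTransGen CommStep v w) :
    Relation.ReflTransGen CommStep w v := by
  induction h with
  | refl => exact .refl
  | tail _ h ih => exact .head h.symm ih

theorem commAppend {v w : Word m} (u : Word m) (h : Relation.ReflTransGen CommStep v w) :
    Relation.ReflTransGen CommStep (u ++ v) (u ++ w) := by
  induction h with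
  | refl => exact .refl
  | tail _ h ih => exact .tail ih (h.append_left u)

theorem comm_front {u v : Word m} {i : Fin m} (hu : ∀ j ∈ u, j ≠ i ∧ ¬ Adj i j) :
    Relation.ReflTransGen CommStep (u ++ i :: v) (i :: (u ++ v)) := by
  induction u with
  | nil => exact .refl
  | cons j u ih =>
    have h1 := commAppend [j] (ih fun k hk => hu k (List.mem_cons_of_mem _ hk))
    refine h1.tail ⟨[], u ++ v, j, i, ?_, rfl, rfl⟩
    have ⟨h2, h3⟩ := hu j List.mem_cons_self
    have : (j : ℕ) ≠ i := fun h => h2 (Fin.ext h)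
    unfold Adj at h3
    omega

theorem comm_back {u v : Word m} {i : Fin m} (hv : ∀ j ∈ v, j ≠ i ∧ ¬ Adj i j) :
    Relation.ReflTransGen CommStep (u ++ i :: v) (u ++ v ++ [i]) := by
  have h := comm_front (v := []) hv
  simpa using commAppend u (commSymm h)

theorem Sink.raise_of_comm {h : Fin m → ℤ} {i j : Fin m} (hne : i ≠ j)
    (hj : Sink h j) : Sink (K.raise h i) j := by
  intro k hk
  rw [raise_of_ne h hne.symm]
  exact lt_of_lt_of_le (hj k hk) (le_raise h i k)

/-- Being a sink only involves the neighbours of a letter, so neither of two non-adjacent letters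
notices whether the other has already ticked. -/
theorem CommStep.legal {v w : Word m} (hs : CommStep v w) {h : Fin m → ℤ}
    (hv : K.Legal h v) : K.Legal h w := by
  obtain ⟨x, y, i, j, hij, rfl, rfl⟩ := hs
  rw [legal_append] at hv ⊢
  refine ⟨hv.1, ?_⟩
  obtain ⟨-, hi, hj, hy⟩ := hv
  have hne : i ≠ j := by rintro rfl; omega
  refine ⟨fun k hk => ?_, Sink.raise_of_comm hne.symm hi, ?_⟩
  · have := hj k hk
    rw [raise_of_ne _ hne.symm, raise_of_ne] at this
    · exact this
    · rintro rfl; unfold Adj at hk; omega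
  · convert hy using 1
    simp only [Clock.raise, Function.update_of_ne hne, Function.update_of_ne hne.symm]
    exact Function.update_comm hne.symm _ _ _

theorem comm_legal {v w : Word m} (hs : Relation.ReflTransGen CommStep v w) {h : Fin m → ℤ}
    (hv : K.Legal h v) : K.Legal h w := by
  induction hs with
  | refl => exact hv
  | tail _ h ih => exact h.legal ih

theorem comm_perm {v w : Word m} (hs : Relation.ReflTransGen CommStep v w) : v.Perm w := by
  induction hs with
  | refl => exact .refl _
  | tail _ h ih => exact ih.trans h.perm

theorem split_first {w : Word m} {i : Fin m} (h : i ∈ w) : ∃ u v, w = u ++ i :: v ∧ i ∉ u := by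
  obtain ⟨u, v, e, hu⟩ := List.eq_append_cons_of_mem h
  exact ⟨u, v, e, hu⟩

theorem split_last {w : Word m} {i : Fin m} (h : i ∈ w) : ∃ u v, w = u ++ i :: v ∧ i ∉ v := by
  obtain ⟨u, v, e, hu⟩ := split_first (List.mem_reverse.mpr h)
  exact ⟨v.reverse, u.reverse, by simpa using congrArg List.reverse e, by simpa using hu⟩

theorem Legal.comm_front {h : Fin m → ℤ} {u v : Word m} {i : Fin m}
    (hw : K.Legal h (u ++ i :: v)) (hi : Sink h i) (hu : i ∉ u) :
    Relation.ReflTransGen CommStep (u ++ i :: v) (i :: (u ++ v)) :=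
  TwistedAR.comm_front fun j hj =>
    ⟨fun e => hu (e ▸ hj), Clock.Legal.not_adj_of_sink hw hi hu j hj⟩

/-- Legal words between the same cuts are commutation equivalent. -/
theorem Legal.comm {h : Fin m → ℤ} {v w : Word m} (hv : K.Legal h v) (hw : K.Legal h w)
    (e : K.run h v = K.run h w) : Relation.ReflTransGen CommStep v w := by
  induction w generalizing h v with
  | nil =>
    cases v with
    | nil => exact .refl
    | cons i v => have := count_eq_of_run_eq (congrFun e i); simp at this
  | cons i w ih =>
    -- Equal end points force equal multiplicities, so the first letter of `w` occurs in `v`; being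
    -- a sink, it commutes to the front.
    have hmem : i ∈ v := by
      rw [← List.count_pos_iff, count_eq_of_run_eq (congrFun e i)]
      simp
    obtain ⟨a, b, rfl, ha⟩ := split_first hmem
    have h1 := Legal.comm_front hv hw.1 ha
    have h2 := comm_legal h1 hv
    refine h1.trans (commAppend [i] (ih h2.2 hw.2 ?_))
    rw [← run_cons, ← run_cons, ← e]
    exact (run_perm h (comm_perm h1)).symm

end TwistedAR

namespace TwistedAR

/-! ### Words of the longest element and their roots -/

variable {m : ℕ}

@[simp] theorem toPerm_nil : Word.toPerm ([] : Word m) = 1 := rfl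

theorem toPerm_cons (i : Fin m) (w : Word m) :
    Word.toPerm (i :: w) = simpleRefl i * Word.toPerm w := by
  simp [Word.toPerm]

theorem toPerm_append (u v : Word m) :
    Word.toPerm (u ++ v) = Word.toPerm u * Word.toPerm v := by
  simp [Word.toPerm]

theorem toPerm_concat (u : Word m) (i : Fin m) :
    Word.toPerm (u ++ [i]) = Word.toPerm u * simpleRefl i := by
  simp [Word.toPerm]

/-- The only inversion of `s_i` is `α_i`. This locates a root in a word, and it makes `s_i` preserve
signs away from `α_i`. -/
theorem simpleRefl_lt {i : Fin m} {x y : Fin (m + 1)} (hxy : x < y)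
    (h : ¬ (x = i.castSucc ∧ y = i.succ)) : simpleRefl i x < simpleRefl i y := by
  unfold simpleRefl
  rw [Equiv.swap_apply_def, Equiv.swap_apply_def]
  simp only [Fin.lt_def, Fin.ext_iff, Fin.val_castSucc, Fin.val_succ] at *
  split_ifs <;> simp_all <;> omega

@[simp] theorem simpleRefl_castSucc (i : Fin m) : simpleRefl i i.castSucc = i.succ :=
  Equiv.swap_apply_left _ _

@[simp] theorem simpleRefl_succ (i : Fin m) : simpleRefl i i.succ = i.castSucc :=
  Equiv.swap_apply_right _ _

@[simp] theorem simpleRefl_inv (i : Fin m) : (simpleRefl i)⁻¹ = simpleRefl i :=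
  Equiv.swap_inv _ _

@[simp] theorem simpleRefl_simpleRefl (i : Fin m) (x : Fin (m + 1)) :
    simpleRefl i (simpleRefl i x) = x := by
  simp [simpleRefl]

theorem take_succ_eq {w : Word m} {k : ℕ} {i : Fin m} (hk : w[k]? = some i) :
    w.take (k + 1) = w.take k ++ [i] := by
  rw [List.take_add_one, hk]; rfl

/-- Every positive root is attached to some position of a word of the longest element. -/
theorem exists_rootAt {w : Word m} (hw : Word.toPerm w = Fin.revPerm) (β : PosRoot m) :
    ∃ k i, Word.RootAt w k i β := by
  classical
  -- `P k` says that the prefix of length `k` has not yet inverted `β`. The letter at which it first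
  -- fails must send its simple root to `β`.
  let P : ℕ → Prop := fun k =>
    (Word.toPerm (w.take k))⁻¹ β.1.1 < (Word.toPerm (w.take k))⁻¹ β.1.2
  have h0 : P 0 := by
    simp only [P, List.take_zero, toPerm_nil, inv_one, Equiv.Perm.one_apply]
    exact β.2
  have hN : ∃ k, ¬ P k := by
    refine ⟨w.length, ?_⟩
    have := β.2
    simp only [P, List.take_length, hw, Equiv.Perm.inv_def, Fin.revPerm_symm, Fin.revPerm_apply,
      Fin.rev_lt_rev, not_lt]
    exact this.le
  obtain ⟨k, hk⟩ : ∃ k, Nat.find hN = k + 1 := by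
    refine ⟨Nat.find hN - 1, ?_⟩
    have : Nat.find hN ≠ 0 := fun h => (h ▸ Nat.find_spec hN) h0
    omega
  have hk1 : ¬ P (k + 1) := hk ▸ Nat.find_spec hN
  have hk0 : P k := by
    by_contra h
    have := Nat.find_min' hN h
    omega
  have hlt : k < w.length := by
    by_contra h
    apply hk1
    simp only [P] at hk0 ⊢
    rwa [List.take_of_length_le (by omega), ← List.take_of_length_le (not_lt.mp h)]
  have hi : w[k]? = some w[k] := List.getElem?_eq_getElem hlt
  refine ⟨k, w[k], hi, ?_⟩
  simp only [P, take_succ_eq hi, toPerm_concat, mul_inv_rev, Equiv.Perm.mul_apply,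
    simpleRefl_inv] at hk1
  by_contra hne
  refine hk1 (simpleRefl_lt hk0 fun ⟨h1, h2⟩ => hne ?_)
  rw [← h1, ← h2]
  simp

theorem two_mul_card_posRoot (m : ℕ) : 2 * Fintype.card (PosRoot m) = m * (m + 1) := by
  have h1 : Fintype.card (PosRoot m) =
      ((Finset.univ : Finset (Fin (m + 1) × Fin (m + 1))).filter fun p => p.1 < p.2).card :=
    Fintype.card_subtype _
  have h2 : ((Finset.univ : Finset (Fin (m + 1) × Fin (m + 1))).filter fun p => p.1 < p.2).card =
      ((Finset.univ : Finset (Fin (m + 1) × Fin (m + 1))).filter fun p => p.2 < p.1).card :=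
    Finset.card_bij (fun p _ => p.swap) (by simp) (by simp) fun p hp =>
      ⟨p.swap, by simpa using hp, by simp⟩
  have h4 : ((Finset.univ : Finset (Fin (m + 1))).offDiag) =
      ((Finset.univ : Finset (Fin (m + 1) × Fin (m + 1))).filter fun p => p.1 < p.2) ∪
      ((Finset.univ : Finset (Fin (m + 1) × Fin (m + 1))).filter fun p => p.2 < p.1) := by
    ext p
    simp [Finset.mem_offDiag, lt_or_lt_iff_ne]
  have h5 := Finset.offDiag_card (Finset.univ : Finset (Fin (m + 1)))
  rw [h4, Finset.card_union_of_disjoint, ← h2, ← h1, Finset.card_univ, Fintype.card_fin] at h5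
  · have : (m + 1) * (m + 1) - (m + 1) = m * (m + 1) := by
      rw [← Nat.sub_one_mul]; rfl
    omega
  · rw [Finset.disjoint_filter]
    intro p _ h h'
    exact lt_asymm h h'

/-- A word of the longest element with as many letters as there are positive roots. -/
structure Word.IsFull (w : Word m) : Prop where
  toPerm_eq : Word.toPerm w = Fin.revPerm
  length_eq : w.length = Fintype.card (PosRoot m)

theorem RootAt.lt_length {w : Word m} {k : ℕ} {i : Fin m} {β : PosRoot m}
    (h : Word.RootAt w k i β) : k < w.length :=
  (List.getElem?_eq_some_iff.mp h.1).1

theorem RootAt.root_unique {w : Word m} {k : ℕ} {i j : Fin m} {α β : PosRoot m}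
    (h : Word.RootAt w k i α) (h' : Word.RootAt w k j β) : i = j ∧ α = β := by
  obtain rfl : i = j := Option.some.inj (h.1.symm.trans h'.1)
  exact ⟨rfl, Subtype.ext (h.2.trans h'.2.symm)⟩

/-- Every root has a position and a position carries at most one root; equality of the two
cardinalities turns this injection into a bijection. -/
theorem IsFull.bijective {w : Word m} (hw : Word.IsFull w) :
    ∃ f : PosRoot m ≃ Fin w.length, ∀ β, ∃ i, Word.RootAt w (f β) i β := by
  choose k i hk using exists_rootAt hw.toPerm_eq
  let f : PosRoot m → Fin w.length := fun β => ⟨k β, RootAt.lt_length (hk β)⟩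
  have hf : Function.Injective f := fun α β h => by
    have e : k α = k β := congrArg Fin.val h
    have := hk α
    rw [e] at this
    exact (RootAt.root_unique this (hk β)).2
  have hb : Function.Bijective f := (Fintype.bijective_iff_injective_and_card f).mpr
    ⟨hf, by rw [Fintype.card_fin, hw.length_eq]⟩
  exact ⟨Equiv.ofBijective f hb, fun β => ⟨i β, hk β⟩⟩

theorem IsFull.rootAt {w : Word m} (hw : Word.IsFull w) {k : ℕ} {i : Fin m}
    (hk : w[k]? = some i) : ∃ β, Word.RootAt w k i β := by
  obtain ⟨f, hf⟩ := IsFull.bijective hw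
  have hlt := (List.getElem?_eq_some_iff.mp hk).1
  obtain ⟨j, hj⟩ := hf (f.symm ⟨k, hlt⟩)
  rw [Equiv.apply_symm_apply] at hj
  obtain rfl : i = j := Option.some.inj (hk.symm.trans hj.1)
  exact ⟨_, hj⟩

theorem IsFull.pos_unique {w : Word m} (hw : Word.IsFull w) {k l : ℕ} {i j : Fin m}
    {β : PosRoot m} (hk : Word.RootAt w k i β) (hl : Word.RootAt w l j β) : k = l := by
  obtain ⟨f, hf⟩ := IsFull.bijective hw
  have key : ∀ {k i}, Word.RootAt w k i β → k = f β := by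
    intro k i hk
    obtain ⟨j, hj⟩ := hf (f.symm ⟨k, RootAt.lt_length hk⟩)
    rw [Equiv.apply_symm_apply] at hj
    rw [(RootAt.root_unique hk hj).2, Equiv.apply_symm_apply]
  rw [key hk, key hl]

theorem IsFull.lt_iff {w : Word m} (hw : Word.IsFull w) {k l : ℕ} {i j : Fin m}
    {α β : PosRoot m} (hk : Word.RootAt w k i α) (hl : Word.RootAt w l j β) :
    Word.Lt w α β ↔ k < l := by
  constructor
  · rintro ⟨k', l', i', j', h, hk', hl'⟩
    rwa [IsFull.pos_unique hw hk hk', IsFull.pos_unique hw hl hl']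
  · exact fun h => ⟨k, l, i, j, h, hk, hl⟩

/-- Any word of `w_0` has a separate position for each positive root, so none is shorter than their
number. -/
theorem IsFull.isReducedLongest {w : Word m} (hw : Word.IsFull w) : Word.IsReducedLongest w := by
  refine ⟨hw.toPerm_eq, fun v hv => ?_⟩
  choose k i hk using exists_rootAt (hv.trans hw.toPerm_eq)
  rw [hw.length_eq, ← Fintype.card_fin v.length]
  refine Fintype.card_le_of_injective
    (fun β => (⟨k β, RootAt.lt_length (hk β)⟩ : Fin v.length)) fun α β h => ?_
  have e : k α = k β := congrArg Fin.val h
  have := hk α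
  rw [e] at this
  exact (RootAt.root_unique this (hk β)).2

theorem RootAt.append {u v : Word m} {k : ℕ} {i : Fin m} {β : PosRoot m}
    (h : Word.RootAt u k i β) : Word.RootAt (u ++ v) k i β := by
  have hlt := RootAt.lt_length h
  refine ⟨by rw [List.getElem?_append_left hlt]; exact h.1, ?_⟩
  rw [List.take_append_of_le_length hlt.le]
  exact h.2

/-- The simple root `α_i`. -/
def simpleRoot (i : Fin m) : PosRoot m := ⟨(i.castSucc, i.succ), Fin.castSucc_lt_succ⟩

theorem rootAt_zero (i : Fin m) (w : Word m) : Word.RootAt (i :: w) 0 i (simpleRoot i) :=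
  ⟨rfl, rfl⟩

/-- The prefix is `w_0 s_j`, and `w_0 s_j(α_j) = -w_0(α_j) = α_{j^*}`. -/
theorem rootAt_last {w : Word m} {j : Fin m} (hw : Word.toPerm (w ++ [j]) = Fin.revPerm) :
    Word.RootAt (w ++ [j]) w.length j (simpleRoot j.rev) := by
  have h : Word.toPerm w = Fin.revPerm * simpleRefl j := by
    rw [← hw, toPerm_concat, mul_assoc]
    ext x
    simp
  refine ⟨by simp, ?_⟩
  simp only [List.take_left, h, Equiv.Perm.mul_apply, simpleRefl_castSucc, simpleRefl_succ,
    Fin.revPerm_apply, simpleRoot, Prod.mk.injEq]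
  constructor <;> ext <;> simp [Fin.val_rev]
  have := j.2
  omega

/-! ### Windows -/

open Clock

/-- The cut `h` shifted in time by `c` and reflected by `i ↦ i^*`. -/
def mir (c : ℤ) (h : Fin m → ℤ) : Fin m → ℤ := fun i => h i.rev + c

namespace Clock

/-- The legal words from the cut `h` to its reflected translate. -/
def window (K : Clock m) (c : ℤ) (h : Fin m → ℤ) : Set (Word m) :=
  {w | K.Legal h w ∧ K.run h w = mir c h}

/-- The reflection `i ↦ i^*` with a translation by `c` preserves the clock. -/
def IsMirror (K : Clock m) (c : ℤ) : Prop :=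
  ∀ i, K.step i.rev = K.step i ∧ K.step i ∣ K.off i.rev + c - K.off i

variable {K : Clock m} {c : ℤ}

theorem IsMirror.onTime (hK : K.IsMirror c) {i : Fin m} {t : ℤ} (ht : K.OnTime i t) :
    K.OnTime i.rev (t + c) := by
  obtain ⟨h1, h2⟩ := hK i.rev
  rw [Fin.rev_rev] at h1 h2
  obtain ⟨x, hx⟩ := ht
  obtain ⟨y, hy⟩ := h2
  refine ⟨x + y, ?_⟩
  rw [h1] at hx
  linear_combination hx + hy

theorem IsMirror.isCut (hK : K.IsMirror c) {h : Fin m → ℤ} (hc : K.IsCut h) :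
    K.IsCut (mir c h) where
  onTime i := by simpa [mir] using hK.onTime (hc.onTime i.rev)
  lt i j hij := by
    have := hc.lt i.rev j.rev hij.rev
    rw [(hK i).1] at this
    simp only [mir]
    omega

theorem sink_mir (c : ℤ) (h : Fin m → ℤ) (i : Fin m) :
    Sink (mir c h) i.rev ↔ Sink h i := by
  simp only [Sink, mir, Fin.rev_rev, add_lt_add_iff_right]
  constructor
  · intro H j hj
    simpa using H j.rev hj.rev
  · intro H j hj
    exact H j.rev (by simpa using hj.rev)

theorem raise_mir (hK : K.IsMirror c) (h : Fin m → ℤ) (i : Fin m) :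
    K.raise (mir c h) i.rev = mir c (K.raise h i) := by
  funext j
  by_cases hj : j = i.rev
  · subst hj; simp [mir, (hK i).1]; ring
  · rw [raise_of_ne _ hj]
    have : j.rev ≠ i := fun e => hj (by rw [← e, Fin.rev_rev])
    simp [mir, raise_of_ne _ this]

theorem run_mir (hK : K.IsMirror c) (h : Fin m → ℤ) (w : Word m) :
    K.run (mir c h) (w.map Fin.rev) = mir c (K.run h w) := by
  induction w generalizing h with
  | nil => simp
  | cons i w ih => rw [List.map_cons, run_cons, run_cons, raise_mir hK, ih]

theorem legal_mir (hK : K.IsMirror c) (h : Fin m → ℤ) (w : Word m) :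
    K.Legal (mir c h) (w.map Fin.rev) ↔ K.Legal h w := by
  induction w generalizing h with
  | nil => simp [Legal]
  | cons i w ih => rw [List.map_cons, Legal, Legal, sink_mir, raise_mir hK, ih]

theorem window_comm {h : Fin m → ℤ} {v w : Word m} (hv : v ∈ K.window c h)
    (hvw : Relation.ReflTransGen CommStep v w) : w ∈ K.window c h :=
  ⟨comm_legal hvw hv.1, by rw [← run_perm h (comm_perm hvw), hv.2]⟩

/-- Commutations preserve legality and the end point; conversely `Legal.comm` connects any two legal
words with the same ends. -/
theorem commClass_eq_window {h : Fin m → ℤ} {w : Word m} (hw : w ∈ K.window c h) :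
    commClass w = K.window c h := by
  ext v
  exact ⟨fun hv => window_comm hw hv, fun hv => Legal.comm hw.1 hv.1 (hw.2.trans hv.2.symm)⟩

/-! ### The list of ticks of a word -/

/-- The ticks, with their letters, moved to the past by a word. -/
def trace (K : Clock m) : (Fin m → ℤ) → Word m → List (Fin m × ℤ)
  | _, [] => []
  | h, i :: w => (i, h i) :: K.trace (K.raise h i) w

theorem trace_append (h : Fin m → ℤ) (u v : Word m) :
    K.trace h (u ++ v) = K.trace h u ++ K.trace (K.run h u) v := by
  induction u generalizing h with
  | nil => simp [trace]
  | cons i u ih => simp [trace, ih, run_cons]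

theorem trace_getElem? (h : Fin m → ℤ) (w : Word m) (k : ℕ) :
    (K.trace h w)[k]? = w[k]?.map fun i => (i, K.run h (w.take k) i) := by
  induction w generalizing h k with
  | nil => simp [trace]
  | cons i w ih =>
    cases k with
    | zero => simp [trace]
    | succ k => simp [trace, ih, run_cons]

theorem trace_congr {g h : Fin m → ℤ} {w : Word m} (hgh : ∀ i ∈ w, g i = h i) :
    K.trace g w = K.trace h w := by
  induction w generalizing g h with
  | nil => rfl
  | cons i w ih =>
    simp only [trace]
    rw [hgh i List.mem_cons_self]
    congr 1
    refine ih fun j hj => ?_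
    by_cases hji : j = i
    · subst hji; simp [hgh j List.mem_cons_self]
    · rw [raise_of_ne _ hji, raise_of_ne _ hji, hgh j (List.mem_cons_of_mem _ hj)]

theorem mem_trace {h : Fin m → ℤ} {w : Word m} {x : Fin m × ℤ} :
    x ∈ K.trace h w ↔ ∃ k, w[k]? = some x.1 ∧ K.run h (w.take k) x.1 = x.2 := by
  rw [List.mem_iff_getElem?]
  refine exists_congr fun k => ?_
  rw [trace_getElem?]
  constructor
  · intro e
    obtain ⟨i, hi, rfl⟩ := Option.map_eq_some_iff.mp e
    exact ⟨hi, rfl⟩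
  · rintro ⟨e1, e2⟩
    rw [e1, Option.map_some, e2]

theorem exists_position {w : Word m} {i : Fin m} {a : ℕ} (ha : a < w.count i) :
    ∃ k, w[k]? = some i ∧ (w.take k).count i = a := by
  induction w generalizing a with
  | nil => simp at ha
  | cons j w ih =>
    by_cases hj : j = i
    · subst hj
      cases a with
      | zero => exact ⟨0, by simp⟩
      | succ a =>
        obtain ⟨k, h1, h2⟩ := ih (a := a) (by simpa using ha)
        exact ⟨k + 1, by simpa using h1, by simpa using h2⟩
    · rw [List.count_cons_of_ne hj] at ha
      obtain ⟨k, h1, h2⟩ := ih ha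
      exact ⟨k + 1, by simpa using h1, by simpa [List.count_cons_of_ne hj] using h2⟩

/-- The ticks of a legal word are those between the initial and the final cut. -/
theorem mem_trace_iff {h : Fin m → ℤ} (hc : K.IsCut h) {w : Word m} {i : Fin m} {t : ℤ} :
    (i, t) ∈ K.trace h w ↔ K.OnTime i t ∧ h i ≤ t ∧ t < K.run h w i := by
  rw [mem_trace]
  constructor
  · rintro ⟨k, hk, hr⟩
    simp only at hk hr
    rw [← hr]
    refine ⟨?_, le_run _ _ _, ?_⟩
    · obtain ⟨x, hx⟩ := hc.onTime i
      exact ⟨x + (w.take k).count i, by unfold run; linear_combination hx⟩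
    · conv_rhs => rw [split_at hk, run_append, run_cons]
      refine lt_of_lt_of_le ?_ (le_run _ _ _)
      have := K.step_pos i
      rw [raise_self]; omega
  · rintro ⟨h1, h2, h3⟩
    obtain ⟨a, rfl⟩ := (hc.onTime i).exists_count h1 h2
    unfold run at h3
    have := lt_of_mul_lt_mul_left (add_lt_add_iff_left _ |>.mp h3) (K.step_pos i).le
    obtain ⟨k, hk, hk'⟩ := exists_position (w := w) (i := i) (a := a) (by exact_mod_cast this)
    exact ⟨k, hk, by simp [run, hk']⟩

/-- Bringing the first `i` to the front does not reorder the other ticks. This gives access to all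
words of a class, not only to those beginning with `i`. -/
theorem trace_filter_front {h : Fin m → ℤ} {u v : Word m} {i : Fin m} (hu : i ∉ u) :
    (K.trace h (u ++ i :: v)).filter (· ≠ (i, h i)) =
      (K.trace (K.raise h i) (u ++ v)).filter (· ≠ (i, h i)) := by
  have h1 : K.trace (K.raise h i) u = K.trace h u :=
    trace_congr fun j hj => raise_of_ne h (fun e => hu (e ▸ hj))
  have h2 : K.raise (K.run h u) i = K.run (K.raise h i) u := by
    rw [← run_concat, ← run_cons]
    exact run_perm h (List.perm_append_singleton i u)
  rw [trace_append, trace_append, h1, trace, run_of_notMem h hu, h2]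
  simp

theorem trace_filter_back {h : Fin m → ℤ} {u v : Word m} {i : Fin m} (hv : i ∉ v) (z : Fin m × ℤ)
    (hz : z = (i, K.run h u i)) :
    (K.trace h (u ++ i :: v)).filter (· ≠ z) =
      (K.trace h (u ++ v)).filter (· ≠ z) := by
  have h1 : K.trace (K.raise (K.run h u) i) v = K.trace (K.run h u) v :=
    trace_congr fun j hj => raise_of_ne _ (fun e => hv (e ▸ hj))
  subst hz
  rw [trace_append, trace_append, trace, h1]
  simp

/-- The order of two ticks, encoded as a sublist of length two, is insensitive to the removal of a
third tick; windows differing in one tick can thus be compared. -/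
theorem pair_sublist_iff_filter {X : Type*} [DecidableEq X] {l : List X} {x y z : X}
    (hx : x ≠ z) (hy : y ≠ z) :
    [x, y].Sublist l ↔ [x, y].Sublist (l.filter (· ≠ z)) := by
  constructor
  · intro h
    have := h.filter (fun a => decide (a ≠ z))
    simpa [hx, hy] using this
  · exact fun h => h.trans List.filter_sublist

theorem pair_sublist_iff {X : Type*} {l : List X} {x y : X} :
    [x, y].Sublist l ↔ ∃ k k' : ℕ, k < k' ∧ l[k]? = some x ∧ l[k']? = some y := by
  induction l with
  | nil => simp
  | cons a l ih =>
    constructor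
    · intro h
      cases h with
      | cons _ h =>
        obtain ⟨k, k', h1, h2, h3⟩ := ih.mp h
        exact ⟨k + 1, k' + 1, by omega, by simpa using h2, by simpa using h3⟩
      | cons_cons _ h =>
        obtain ⟨k', hk'⟩ := List.mem_iff_getElem?.mp (List.singleton_sublist.mp h)
        exact ⟨0, k' + 1, by omega, by simp, by simpa using hk'⟩
    · rintro ⟨k, k', h1, h2, h3⟩
      obtain ⟨k', rfl⟩ : ∃ a, k' = a + 1 := ⟨k' - 1, by omega⟩
      cases k with
      | zero =>
        simp only [List.getElem?_cons_zero, Option.some.injEq] at h2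
        subst h2
        exact (List.singleton_sublist.mpr (List.mem_of_getElem? (by simpa using h3))).cons_cons _
      | succ k =>
        exact (ih.mpr ⟨k, k', by omega, by simpa using h2, by simpa using h3⟩).cons _

end Clock
end TwistedAR

namespace TwistedAR

variable {m : ℕ}

/-! ### Transport of generalized distances -/

/-- The action of a permutation on roots up to sign. -/
def permRootFun (σ : Equiv.Perm (Fin (m + 1))) (β : PosRoot m) : PosRoot m :=
  if h : σ β.1.1 < σ β.1.2 then ⟨(σ β.1.1, σ β.1.2), h⟩
  else ⟨(σ β.1.2, σ β.1.1), lt_of_le_of_ne (not_lt.mp h) (fun e => β.2.ne' (σ.injective e))⟩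

theorem permRootFun_permRootFun (σ τ : Equiv.Perm (Fin (m + 1))) (h : ∀ a, τ (σ a) = a)
    (β : PosRoot m) : permRootFun τ (permRootFun σ β) = β := by
  have hβ := β.2
  apply Subtype.ext
  by_cases h1 : σ β.1.1 < σ β.1.2
  · simp [permRootFun, h1, h, hβ]
  · simp [permRootFun, h1, h, hβ.not_gt]

/-- The action of a permutation on roots up to sign, as an equivalence. -/
def permRoot (σ : Equiv.Perm (Fin (m + 1))) : PosRoot m ≃ PosRoot m where
  toFun := permRootFun σ
  invFun := permRootFun σ⁻¹
  left_inv := permRootFun_permRootFun _ _ (by simp)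
  right_inv := permRootFun_permRootFun _ _ (by simp)

theorem permRoot_of_lt {σ : Equiv.Perm (Fin (m + 1))} {β : PosRoot m}
    (h : σ β.1.1 < σ β.1.2) : (permRoot σ β).1 = (σ β.1.1, σ β.1.2) := by
  simp [permRoot, permRootFun, h]

theorem permRoot_of_gt {σ : Equiv.Perm (Fin (m + 1))} {β : PosRoot m}
    (h : σ β.1.2 < σ β.1.1) : (permRoot σ β).1 = (σ β.1.2, σ β.1.1) := by
  simp [permRoot, permRootFun, h.not_gt]

theorem permRoot_eq {σ : Equiv.Perm (Fin (m + 1))} {α β : PosRoot m}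
    (h : β.1 = (σ α.1.1, σ α.1.2)) : permRoot σ α = β := by
  apply Subtype.ext
  rw [h]
  refine permRoot_of_lt ?_
  have := β.2
  rwa [h] at this

theorem permRoot_eq_swap {σ : Equiv.Perm (Fin (m + 1))} {α β : PosRoot m}
    (h : β.1 = (σ α.1.2, σ α.1.1)) : permRoot σ α = β := by
  apply Subtype.ext
  rw [h]
  refine permRoot_of_gt ?_
  have := β.2
  rwa [h] at this

/-- A telescoping sum; `F` extends `f` by zero to all natural numbers so that interval sums apply.
-/
theorem sub_eq_sum_coeff (f : Fin (m + 1) → ℤ) (β : PosRoot m) :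
    f β.1.1 - f β.1.2 = ∑ i : Fin m, (β.coeff i : ℤ) * (f i.castSucc - f i.succ) := by
  obtain ⟨⟨a, b⟩, hab⟩ := β
  let F : ℕ → ℤ := fun j => if h : j < m + 1 then f ⟨j, h⟩ else 0
  have hF : ∀ j : Fin (m + 1), f j = F j := fun j => by
    simp only [F, dif_pos j.2]
  simp only [PosRoot.coeff]
  have h1 : ∀ i : Fin m, ((if a ≤ i.castSucc ∧ i.castSucc < b then 1 else 0 : ℕ) : ℤ) *
      (f i.castSucc - f i.succ) =
      (fun j : ℕ => if (a : ℕ) ≤ j ∧ j < b then F j - F (j + 1) else 0) i := by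
    intro i
    simp only [hF, Fin.val_castSucc, Fin.val_succ, Fin.le_def, Fin.lt_def]
    split_ifs <;> simp
  rw [Finset.sum_congr rfl fun i _ => h1 i,
    Fin.sum_univ_eq_sum_range (fun j : ℕ => if (a : ℕ) ≤ j ∧ j < b then F j - F (j + 1) else 0) m,
    ← Finset.sum_filter]
  have h2 : (Finset.range m).filter (fun j => (a : ℕ) ≤ j ∧ j < b) = Finset.Ico (a : ℕ) b := by
    ext j
    have := b.2
    simp only [Finset.mem_filter, Finset.mem_range, Finset.mem_Ico]
    omega
  have h3 := Finset.sum_Ico_sub F (m := (a : ℕ)) (n := b) (le_of_lt hab)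
  rw [h2, hF, hF]
  have h4 : ∑ j ∈ Finset.Ico (a : ℕ) b, (F j - F (j + 1)) =
      - ∑ j ∈ Finset.Ico (a : ℕ) b, (F (j + 1) - F j) := by
    rw [← Finset.sum_neg_distrib]
    exact Finset.sum_congr rfl fun j _ => by ring
  rw [h4, h3]
  ring

theorem weight_apply (s : RootSeq m) (i : Fin m) : weight s i = ∑ β, s β * β.coeff i := by
  simp [weight, Finset.sum_apply]

/-- Testing weights against all functions `f` on the indices of the `ε_a` turns the action of a
permutation into a substitution in `f`, so its matrix on simple roots is never needed. -/
theorem weight_eq_iff {s s' : RootSeq m} : weight s = weight s' ↔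
    ∀ f : Fin (m + 1) → ℤ, ∑ β, (s β : ℤ) * (f β.1.1 - f β.1.2) =
      ∑ β, (s' β : ℤ) * (f β.1.1 - f β.1.2) := by
  have key : ∀ (s : RootSeq m) (f : Fin (m + 1) → ℤ), ∑ β, (s β : ℤ) * (f β.1.1 - f β.1.2) =
      ∑ i : Fin m, (weight s i : ℤ) * (f i.castSucc - f i.succ) := by
    intro s f
    simp_rw [sub_eq_sum_coeff f, weight_apply, Finset.mul_sum, Nat.cast_sum, Finset.sum_mul]
    rw [Finset.sum_comm]
    refine Finset.sum_congr rfl fun i _ => Finset.sum_congr rfl fun β _ => ?_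
    push_cast
    ring
  constructor
  · intro h f
    rw [key, key, h]
  · intro h
    funext i
    -- The indicator of an initial segment pairs to 1 with `α_i` and to 0 with the other simple
    -- roots.
    have := h fun j => if j ≤ i.castSucc then 1 else 0
    erw [key s fun j => if j ≤ i.castSucc then 1 else 0,
      key s' fun j => if j ≤ i.castSucc then 1 else 0] at this
    have hsum : ∀ s : RootSeq m, ∑ k : Fin m, (weight s k : ℤ) *
        ((if k.castSucc ≤ i.castSucc then 1 else 0) - (if k.succ ≤ i.castSucc then 1 else 0)) =
        weight s i := by
      intro s
      rw [Finset.sum_eq_single i]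
      · simp [Fin.le_def]
      · intro k _ hk
        have : (k : ℕ) ≠ i := fun e => hk (Fin.ext e)
        simp only [Fin.le_def, Fin.val_castSucc, Fin.val_succ]
        split_ifs <;> omega
      · simp
    rw [hsum, hsum] at this
    exact_mod_cast this

/-- A permutation acting on the roots in `Z` with a constant sign respects equality of weights of
sequences supported in `Z`. -/
theorem weight_permRoot (σ : Equiv.Perm (Fin (m + 1))) {Z : Set (PosRoot m)}
    (hZ : (∀ β ∈ Z, σ β.1.1 < σ β.1.2) ∨ ∀ β ∈ Z, σ β.1.2 < σ β.1.1) {s s' : RootSeq m}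
    (hs : ∀ β, s β ≠ 0 → β ∈ Z) (hs' : ∀ β, s' β ≠ 0 → β ∈ Z) :
    weight s = weight s' ↔
      weight (s ∘ (permRoot σ).symm) = weight (s' ∘ (permRoot σ).symm) := by
  have key : ∀ s : RootSeq m, ∀ f : Fin (m + 1) → ℤ,
      ∑ β, ((s ∘ (permRoot σ).symm) β : ℤ) * (f β.1.1 - f β.1.2) =
      ∑ β, (s β : ℤ) * (f (permRoot σ β).1.1 - f (permRoot σ β).1.2) := by
    intro s f
    rw [← Equiv.sum_comp (permRoot σ)]
    simp
  rw [weight_eq_iff, weight_eq_iff]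
  simp_rw [key]
  rcases hZ with hZ | hZ
  · have h1 : ∀ s : RootSeq m, (∀ β, s β ≠ 0 → β ∈ Z) → ∀ f : Fin (m + 1) → ℤ,
        ∑ β, (s β : ℤ) * (f (permRoot σ β).1.1 - f (permRoot σ β).1.2) =
        ∑ β, (s β : ℤ) * ((f ∘ σ) β.1.1 - (f ∘ σ) β.1.2) := by
      intro s hs f
      refine Finset.sum_congr rfl fun β _ => ?_
      by_cases h0 : s β = 0
      · simp [h0]
      · rw [permRoot_of_lt (hZ β (hs β h0))]; rfl
    constructor
    · intro h f
      rw [h1 s hs, h1 s' hs', h]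
    · intro h f
      have := h (f ∘ σ.symm)
      rw [h1 s hs, h1 s' hs'] at this
      simpa [Function.comp_assoc] using this
  · have h1 : ∀ s : RootSeq m, (∀ β, s β ≠ 0 → β ∈ Z) → ∀ f : Fin (m + 1) → ℤ,
        ∑ β, (s β : ℤ) * (f (permRoot σ β).1.1 - f (permRoot σ β).1.2) =
        ∑ β, (s β : ℤ) * (((-f) ∘ σ) β.1.1 - ((-f) ∘ σ) β.1.2) := by
      intro s hs f
      refine Finset.sum_congr rfl fun β _ => ?_
      by_cases h0 : s β = 0
      · simp [h0]
      · rw [permRoot_of_gt (hZ β (hs β h0))]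
        simp only [Function.comp, Pi.neg_apply]
        ring
    constructor
    · intro h f
      rw [h1 s hs, h1 s' hs', h]
    · intro h f
      have := h ((-f) ∘ σ.symm)
      rw [h1 s hs, h1 s' hs'] at this
      have e : (-((-f) ∘ σ.symm)) ∘ σ = f := by funext x; simp
      simpa only [e] using this

/-! ### Comparing two classes along a bijection of roots -/

/-- The order attached to a word or its opposite. -/
def LtDir (b : Bool) (w : Word m) (α β : PosRoot m) : Prop :=
  if b then Word.Lt w α β else Word.Lt w β α

/-- Outside `Z` both sequences vanish, so only the order on `Z` matters. The bi-lexicographic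
condition is symmetric in its two ends, hence an order-reversing bijection serves as well, with `κ`
and `σ` exchanged. -/
theorem BiLexLt.transport {w w' : Word m} {e : PosRoot m ≃ PosRoot m} {Z : Set (PosRoot m)}
    {b : Bool} (h : ∀ α ∈ Z, ∀ β ∈ Z, Word.Lt w α β ↔ LtDir b w' (e α) (e β))
    {s s' : RootSeq m} (hs : ∀ β, s β ≠ 0 → β ∈ Z) (hs' : ∀ β, s' β ≠ 0 → β ∈ Z)
    (hlt : BiLexLt w s' s) : BiLexLt w' (s' ∘ e.symm) (s ∘ e.symm) := by
  obtain ⟨κ, σ, hκσ, hag, hκ, hσ⟩ := hlt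
  have hκZ := hs κ (by omega)
  have hσZ := hs σ (by omega)
  have hout : ∀ τ, e.symm τ ∉ Z → (s' ∘ e.symm) τ = (s ∘ e.symm) τ := by
    intro τ hτ
    have h1 : s (e.symm τ) = 0 := by_contra fun hc => hτ (hs _ hc)
    have h2 : s' (e.symm τ) = 0 := by_contra fun hc => hτ (hs' _ hc)
    simp [h1, h2]
  cases b with
  | true =>
    refine ⟨e κ, e σ, ?_, fun τ hτ => ?_, by simpa using hκ, by simpa using hσ⟩
    · exact hκσ.imp (congrArg e) fun H => by simpa [LtDir] using (h _ hκZ _ hσZ).mp H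
    · by_cases hZ : e.symm τ ∈ Z
      · refine hag _ (hτ.imp (fun H => ?_) fun H => ?_)
        · exact (h _ hZ _ hκZ).mpr (by simpa [LtDir] using H)
        · exact (h _ hσZ _ hZ).mpr (by simpa [LtDir] using H)
      · exact hout τ hZ
  | false =>
    refine ⟨e σ, e κ, ?_, fun τ hτ => ?_, by simpa using hσ, by simpa using hκ⟩
    · exact hκσ.imp (fun H => congrArg e H.symm)
        fun H => by simpa [LtDir] using (h _ hκZ _ hσZ).mp H
    · by_cases hZ : e.symm τ ∈ Z
      · refine hag _ (hτ.symm.imp (fun H => ?_) fun H => ?_)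
        · exact (h _ hZ _ hκZ).mpr (by simpa [LtDir] using H)
        · exact (h _ hσZ _ hZ).mpr (by simpa [LtDir] using H)
      · exact hout τ hZ

/-- `e` maps the order structure of the class `C` on the roots in `Z` to that of `C'`, or to its
opposite, compatibly with weights, and `Z` is closed under passing to smaller sequences. -/
structure Transport (C C' : Set (Word m)) (e : PosRoot m ≃ PosRoot m) (Z : Set (PosRoot m))
    (b : Bool) : Prop where
  fwd : ∀ w ∈ C, ∃ w' ∈ C', ∀ α ∈ Z, ∀ β ∈ Z, Word.Lt w α β ↔ LtDir b w' (e α) (e β)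
  bwd : ∀ w' ∈ C', ∃ w ∈ C, ∀ α ∈ Z, ∀ β ∈ Z, Word.Lt w α β ↔ LtDir b w' (e α) (e β)
  weight_iff : ∀ s s' : RootSeq m, (∀ β, s β ≠ 0 → β ∈ Z) → (∀ β, s' β ≠ 0 → β ∈ Z) →
    (weight s = weight s' ↔ weight (s ∘ e.symm) = weight (s' ∘ e.symm))
  down : ∀ s s' : RootSeq m, (∀ β, s β ≠ 0 → β ∈ Z) → SeqPrec C s' s → ∀ β, s' β ≠ 0 → β ∈ Z
  down' : ∀ s s' : RootSeq m, (∀ β, s β ≠ 0 → e.symm β ∈ Z) → SeqPrec C' s' s →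
    ∀ β, s' β ≠ 0 → e.symm β ∈ Z

namespace Transport

variable {C C' : Set (Word m)} {e : PosRoot m ≃ PosRoot m} {Z : Set (PosRoot m)} {b : Bool}

theorem symm (H : Transport C C' e Z b) : Transport C' C e.symm {β | e.symm β ∈ Z} b where
  fwd w' hw' := by
    obtain ⟨w, hw, h⟩ := H.bwd w' hw'
    refine ⟨w, hw, fun α hα β hβ => ?_⟩
    have h1 := h _ hα _ hβ
    have h2 := h _ hβ _ hα
    simp only [Equiv.apply_symm_apply] at h1 h2
    cases b <;> simp_all [LtDir]
  bwd w hw := by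
    obtain ⟨w', hw', h⟩ := H.fwd w hw
    refine ⟨w', hw', fun α hα β hβ => ?_⟩
    have h1 := h _ hα _ hβ
    have h2 := h _ hβ _ hα
    simp only [Equiv.apply_symm_apply] at h1 h2
    cases b <;> simp_all [LtDir]
  weight_iff s s' hs hs' := by
    have := H.weight_iff (s ∘ e) (s' ∘ e) (fun β h => by simpa using hs (e β) h)
      (fun β h => by simpa using hs' (e β) h)
    simpa [Function.comp_assoc] using this.symm
  down := H.down'
  down' s s' hs hlt β hβ := by
    simp only [Set.mem_ofPred_eq, Equiv.symm_symm, Equiv.symm_apply_apply] at *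
    exact H.down s s' hs hlt β hβ

theorem seqPrec (H : Transport C C' e Z b) {s s' : RootSeq m} (hs : ∀ β, s β ≠ 0 → β ∈ Z)
    (hlt : SeqPrec C s' s) : SeqPrec C' (s' ∘ e.symm) (s ∘ e.symm) := by
  intro w' hw'
  obtain ⟨w, hw, h⟩ := H.bwd w' hw'
  exact BiLexLt.transport h hs (H.down s s' hs hlt) (hlt w hw)

theorem pairSeq_comp (e : PosRoot m ≃ PosRoot m) (α β : PosRoot m) :
    pairSeq α β ∘ e.symm = pairSeq (e α) (e β) := by
  funext γ
  simp only [pairSeq, Function.comp, Pi.add_apply, Pi.single_apply, Equiv.symm_apply_eq]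

theorem pairSeq_supp {α β : PosRoot m} (hα : α ∈ Z) (hβ : β ∈ Z) :
    ∀ γ, pairSeq α β γ ≠ 0 → γ ∈ Z := by
  intro γ h
  by_contra hc
  have h1 : γ ≠ α := fun e => hc (e ▸ hα)
  have h2 : γ ≠ β := fun e => hc (e ▸ hβ)
  simp [pairSeq, h1, h2] at h

theorem isSimplePair_of (H : Transport C C' e Z b) {α β : PosRoot m} (hα : α ∈ Z) (hβ : β ∈ Z)
    (h : IsSimplePair C' (e α) (e β)) : IsSimplePair C α β := by
  rintro ⟨s, hs, hw⟩
  have hsupp := pairSeq_supp hα hβ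
  refine h ⟨s ∘ e.symm, ?_, ?_⟩
  · rw [← pairSeq_comp]; exact H.seqPrec hsupp hs
  · rw [← pairSeq_comp]; exact (H.weight_iff _ _ (H.down _ _ hsupp hs) hsupp).mp hw

theorem isSimplePair_iff (H : Transport C C' e Z b) {α β : PosRoot m} (hα : α ∈ Z)
    (hβ : β ∈ Z) : IsSimplePair C α β ↔ IsSimplePair C' (e α) (e β) := by
  refine ⟨fun h => H.symm.isSimplePair_of (by simpa) (by simpa) (by simpa), H.isSimplePair_of hα hβ⟩

theorem isSimpleSeq_iff (H : Transport C C' e Z b) {s : RootSeq m} (hs : ∀ β, s β ≠ 0 → β ∈ Z) :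
    IsSimpleSeq C s ↔ IsSimpleSeq C' (s ∘ e.symm) := by
  constructor
  · intro h α β hne hα hβ
    have := (H.isSimplePair_iff (hs _ hα.ne') (hs _ hβ.ne')).mp
      (h (e.symm α) (e.symm β) (by simpa using hne) hα hβ)
    simpa using this
  · intro h α β hne hα hβ
    exact (H.isSimplePair_iff (hs _ hα.ne') (hs _ hβ.ne')).mpr
      (h (e α) (e β) (by simpa using hne) (by simpa using hα) (by simpa using hβ))

theorem chain (H : Transport C C' e Z b) {s : RootSeq m} (hs : ∀ β, s β ≠ 0 → β ∈ Z) {k : ℕ}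
    (hk : ∃ c : ℕ → RootSeq m, c k = s ∧
      (∀ i, 1 ≤ i → i ≤ k → ¬ IsSimpleSeq C (c i) ∧ weight (c i) = weight s) ∧
      ∀ i, 1 ≤ i → i < k → SeqPrec C (c i) (c (i + 1))) :
    ∃ c : ℕ → RootSeq m, c k = s ∘ e.symm ∧
      (∀ i, 1 ≤ i → i ≤ k → ¬ IsSimpleSeq C' (c i) ∧ weight (c i) = weight (s ∘ e.symm)) ∧
      ∀ i, 1 ≤ i → i < k → SeqPrec C' (c i) (c (i + 1)) := by
  obtain ⟨c, hck, hc1, hc2⟩ := hk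
  -- Support in `Z` is inherited downwards along the chain, starting from its top term `s`; hence
  -- the induction on `k - i`.
  have hsupp : ∀ j i, 1 ≤ i → i + j = k → ∀ β, c i β ≠ 0 → β ∈ Z := by
    intro j
    induction j with
    | zero => rintro i hi rfl; rw [Nat.add_zero] at hck; rwa [hck]
    | succ j ih =>
      exact fun i hi hij => H.down _ _ (ih (i + 1) (by omega) (by omega)) (hc2 i hi (by omega))
  have hsupp' : ∀ i, 1 ≤ i → i ≤ k → ∀ β, c i β ≠ 0 → β ∈ Z := fun i hi hik =>
    hsupp (k - i) i hi (by omega)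
  refine ⟨fun i => c i ∘ e.symm, by simp only [hck], fun i hi hik => ⟨?_, ?_⟩, fun i hi hik => ?_⟩
  · rw [← H.isSimpleSeq_iff (hsupp' i hi hik)]; exact (hc1 i hi hik).1
  · exact (H.weight_iff _ _ (hsupp' i hi hik) hs).mp (hc1 i hi hik).2
  · exact H.seqPrec (hsupp' (i + 1) (by omega) (by omega)) (hc2 i hi hik)

theorem gdist_eq (H : Transport C C' e Z b) {α β : PosRoot m} (hα : α ∈ Z) (hβ : β ∈ Z) :
    gdist C (pairSeq α β) = gdist C' (pairSeq (e α) (e β)) := by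
  have hs := pairSeq_supp hα hβ
  rw [← pairSeq_comp]
  unfold gdist
  rw [H.isSimpleSeq_iff hs]
  congr 2
  ext k
  refine and_congr_right fun _ => ⟨H.chain hs, fun h => ?_⟩
  have := H.symm.chain (s := pairSeq α β ∘ e.symm) (fun β hβ => hs _ hβ) h
  simpa [Function.comp_assoc] using this

theorem prec_iff (H : Transport C C' e Z b) {α β : PosRoot m} (hα : α ∈ Z) (hβ : β ∈ Z) :
    Prec C α β ∨ Prec C β α ↔ Prec C' (e α) (e β) ∨ Prec C' (e β) (e α) := by
  have key : ∀ {C C' : Set (Word m)} {e : PosRoot m ≃ PosRoot m} {Z : Set (PosRoot m)},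
      Transport C C' e Z b → ∀ {α β}, α ∈ Z → β ∈ Z → Prec C α β →
      Prec C' (e α) (e β) ∨ Prec C' (e β) (e α) := by
    intro C C' e Z H α β hα hβ h
    cases b with
    | true =>
      left
      intro w' hw'
      obtain ⟨w, hw, hlt⟩ := H.bwd w' hw'
      simpa [LtDir] using (hlt _ hα _ hβ).mp (h w hw)
    | false =>
      right
      intro w' hw'
      obtain ⟨w, hw, hlt⟩ := H.bwd w' hw'
      simpa [LtDir] using (hlt _ hα _ hβ).mp (h w hw)
  constructor
  · rintro (h | h)
    exacts [key H hα hβ h, (key H hβ hα h).symm]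
  · rintro (h | h)
    · simpa using key H.symm (α := e α) (β := e β) (by simpa) (by simpa) h
    · simpa using (key H.symm (α := e β) (β := e α) (by simpa) (by simpa) h).symm

end Transport

theorem pairSeq_comm (α β : PosRoot m) : pairSeq α β = pairSeq β α := add_comm _ _

end TwistedAR

namespace TwistedAR

open Clock

variable {m : ℕ} {K : Clock m} {c : ℤ}

theorem Clock.IsMirror.neg (hK : K.IsMirror c) : K.IsMirror (-c) := fun i => by
  obtain ⟨h1, y, hy⟩ := hK i.rev
  rw [Fin.rev_rev] at h1 hy
  refine ⟨h1.symm, -y, ?_⟩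
  rw [h1]
  linear_combination -hy

/-! ### Labelled strands -/

/-- Labels of the strands of the wiring diagram of a periodic heap: `lab h j` is the strand at
height `j` at the cut `h`. The strands cross at the ticks, and all windows reverse their order. -/
structure Labelling (K : Clock m) (c : ℤ) where
  /-- the set of labels -/
  L : Type
  /-- the label of the strand at a height at a cut -/
  lab : (Fin m → ℤ) → Fin (m + 1) → L
  inj : ∀ h, K.IsCut h → Function.Injective (lab h)
  raise : ∀ h i, K.IsCut h → Sink h i → ∀ j, lab (K.raise h i) j = lab h (simpleRefl i j)
  mirror : ∀ h, K.IsCut h → ∀ j, lab (mir c h) j = lab h j.rev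
  congr : ∀ g h i, K.IsCut g → K.IsCut h → Sink g i → Sink h i → g i = h i →
    lab g i.castSucc = lab h i.castSucc ∧ lab g i.succ = lab h i.succ
  isMirror : K.IsMirror c
  lt_mir : ∀ h, K.IsCut h → ∀ i, h i < mir c h i
  length : ∀ h w, K.IsCut h → K.run h w = mir c h → w.length = Fintype.card (PosRoot m)

/-- The root `β` is attached to the tick `x` in the window starting at the cut `h`. -/
def InWin (K : Clock m) (c : ℤ) (h : Fin m → ℤ) (x : Fin m × ℤ) (β : PosRoot m) : Prop :=
  ∃ w ∈ K.window c h, ∃ k, Word.RootAt w k x.1 β ∧ K.run h (w.take k) x.1 = x.2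

/-- `x` is a tick in the window starting at the cut `h`. -/
def InSpan (K : Clock m) (c : ℤ) (h : Fin m → ℤ) (x : Fin m × ℤ) : Prop :=
  K.OnTime x.1 x.2 ∧ h x.1 ≤ x.2 ∧ x.2 < mir c h x.1

/-! ### Roots attached to the ticks of a window -/

namespace Labelling

theorem lab_run (ℒ : Labelling K c) {h : Fin m → ℤ} (hc : K.IsCut h) {w : Word m}
    (hw : K.Legal h w) (j : Fin (m + 1)) : ℒ.lab (K.run h w) j = ℒ.lab h (Word.toPerm w j) := by
  induction w generalizing h with
  | nil => simp
  | cons i w ih =>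
    rw [run_cons, ih (hc.raise hw.1) hw.2, ℒ.raise h i hc hw.1, toPerm_cons]
    rfl

/-- The label at height `j` at the end of the window is that at height `toPerm w j` at its start by
following strands, and that at `j.rev` by the mirror axiom. Injectivity of labels identifies the
permutation as `w_0`. -/
theorem isFull (ℒ : Labelling K c) {h : Fin m → ℤ} (hc : K.IsCut h) {w : Word m}
    (hw : w ∈ K.window c h) : Word.IsFull w where
  toPerm_eq := by
    ext1 j
    apply ℒ.inj h hc
    rw [← ℒ.lab_run hc hw.1, hw.2, ℒ.mirror h hc]
    rfl
  length_eq := ℒ.length h w hc hw.2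

theorem isCut_mir (ℒ : Labelling K c) {h : Fin m → ℤ} (hc : K.IsCut h) : K.IsCut (mir c h) :=
  ℒ.isMirror.isCut hc

theorem window_nonempty (ℒ : Labelling K c) {h : Fin m → ℤ} (hc : K.IsCut h) :
    ∃ w, w ∈ K.window c h :=
  exists_legal hc (ℒ.isCut_mir hc) fun i => (ℒ.lt_mir h hc i).le

/-- A root records where the two strands crossing at its tick sat at the initial cut, and by the
axiom `congr` these strands depend on the tick only. -/
theorem root_unique (ℒ : Labelling K c) {h : Fin m → ℤ} (hc : K.IsCut h) {v w : Word m}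
    (hv : K.Legal h v) (hw : K.Legal h w) {k l : ℕ} {i : Fin m} {α β : PosRoot m}
    (hk : Word.RootAt v k i α) (hl : Word.RootAt w l i β)
    (e : K.run h (v.take k) i = K.run h (w.take l) i) : α = β := by
  have h1 := ℒ.congr _ _ i (hc.run (hv.take k)) (hc.run (hw.take l)) (hv.sink hk.1) (hw.sink hl.1) e
  rw [ℒ.lab_run hc (hv.take k), ℒ.lab_run hc (hw.take l), ℒ.lab_run hc (hv.take k),
    ℒ.lab_run hc (hw.take l)] at h1
  apply Subtype.ext
  rw [hk.2, hl.2, ℒ.inj h hc h1.1, ℒ.inj h hc h1.2]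

theorem mem_trace_window {h : Fin m → ℤ} (hc : K.IsCut h) {w : Word m} (hw : w ∈ K.window c h)
    {x : Fin m × ℤ} : x ∈ K.trace h w ↔ InSpan K c h x := by
  obtain ⟨i, t⟩ := x
  rw [mem_trace_iff hc, hw.2]
  rfl

theorem inSpan {h : Fin m → ℤ} (hc : K.IsCut h) {x : Fin m × ℤ}
    {β : PosRoot m} (hx : InWin K c h x β) : InSpan K c h x := by
  obtain ⟨w, hw, k, hk, hr⟩ := hx
  exact (mem_trace_window hc hw).mp (mem_trace.mpr ⟨k, hk.1, hr⟩)

theorem rootAt_of_inSpan (ℒ : Labelling K c) {h : Fin m → ℤ} (hc : K.IsCut h) {w : Word m}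
    (hw : w ∈ K.window c h) {x : Fin m × ℤ} (hx : InSpan K c h x) :
    ∃ β k, Word.RootAt w k x.1 β ∧ K.run h (w.take k) x.1 = x.2 := by
  obtain ⟨k, hk, hr⟩ := mem_trace.mp ((mem_trace_window hc hw).mpr hx)
  obtain ⟨β, hβ⟩ := IsFull.rootAt (ℒ.isFull hc hw) hk
  exact ⟨β, k, hβ, hr⟩

theorem exists_inWin (ℒ : Labelling K c) {h : Fin m → ℤ} (hc : K.IsCut h) {x : Fin m × ℤ}
    (hx : InSpan K c h x) : ∃ β, InWin K c h x β := by
  obtain ⟨w, hw⟩ := ℒ.window_nonempty hc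
  obtain ⟨β, k, hk⟩ := ℒ.rootAt_of_inSpan hc hw hx
  exact ⟨β, w, hw, k, hk⟩

theorem inWin_root_unique (ℒ : Labelling K c) {h : Fin m → ℤ} (hc : K.IsCut h) {x : Fin m × ℤ}
    {α β : PosRoot m} (hα : InWin K c h x α) (hβ : InWin K c h x β) : α = β := by
  obtain ⟨v, hv, k, hk, e⟩ := hα
  obtain ⟨w, hw, l, hl, e'⟩ := hβ
  exact ℒ.root_unique hc hv.1 hw.1 hk hl (e.trans e'.symm)

theorem inWin_rootAt (ℒ : Labelling K c) {h : Fin m → ℤ} (hc : K.IsCut h) {x : Fin m × ℤ}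
    {β : PosRoot m} (hβ : InWin K c h x β) {w : Word m} (hw : w ∈ K.window c h) :
    ∃ k, Word.RootAt w k x.1 β ∧ K.run h (w.take k) x.1 = x.2 := by
  obtain ⟨γ, k, hk, hr⟩ := ℒ.rootAt_of_inSpan hc hw (inSpan hc hβ)
  obtain rfl := ℒ.inWin_root_unique hc hβ ⟨w, hw, k, hk, hr⟩
  exact ⟨k, hk, hr⟩

theorem inWin_tick_unique (ℒ : Labelling K c) {h : Fin m → ℤ} (hc : K.IsCut h) {x y : Fin m × ℤ}
    {β : PosRoot m} (hx : InWin K c h x β) (hy : InWin K c h y β) : x = y := by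
  obtain ⟨w, hw, k, hk, e⟩ := hx
  obtain ⟨l, hl, e'⟩ := ℒ.inWin_rootAt hc hy hw
  obtain rfl := IsFull.pos_unique (ℒ.isFull hc hw) hk hl
  have h1 := (RootAt.root_unique hk hl).1
  refine Prod.ext h1 ?_
  rw [← e, ← e', h1]

theorem exists_tick (ℒ : Labelling K c) {h : Fin m → ℤ} (hc : K.IsCut h) (β : PosRoot m) :
    ∃ x, InWin K c h x β := by
  obtain ⟨w, hw⟩ := ℒ.window_nonempty hc
  obtain ⟨k, i, hk⟩ := exists_rootAt (ℒ.isFull hc hw).toPerm_eq β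
  exact ⟨(i, K.run h (w.take k) i), w, hw, k, hk, rfl⟩

theorem rootAt_tick (ℒ : Labelling K c) {h : Fin m → ℤ} (hc : K.IsCut h) {w : Word m}
    (hw : w ∈ K.window c h) {k : ℕ} {i : Fin m} {β : PosRoot m} (hk : Word.RootAt w k i β)
    {x : Fin m × ℤ} (hx : InWin K c h x β) : x = (i, K.run h (w.take k) i) :=
  ℒ.inWin_tick_unique hc hx ⟨w, hw, k, hk, rfl⟩

theorem lt_iff_trace (ℒ : Labelling K c) {h : Fin m → ℤ} (hc : K.IsCut h) {w : Word m}
    (hw : w ∈ K.window c h) {x y : Fin m × ℤ} {α β : PosRoot m} (hα : InWin K c h x α)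
    (hβ : InWin K c h y β) : Word.Lt w α β ↔ [x, y].Sublist (K.trace h w) := by
  rw [pair_sublist_iff]
  constructor
  · rintro ⟨k, l, i, j, hkl, hk, hl⟩
    refine ⟨k, l, hkl, ?_, ?_⟩
    · rw [trace_getElem?, hk.1, ℒ.rootAt_tick hc hw hk hα]; rfl
    · rw [trace_getElem?, hl.1, ℒ.rootAt_tick hc hw hl hβ]; rfl
  · rintro ⟨k, l, hkl, hk, hl⟩
    rw [trace_getElem?] at hk hl
    obtain ⟨i, hi, rfl⟩ := Option.map_eq_some_iff.mp hk
    obtain ⟨j, hj, rfl⟩ := Option.map_eq_some_iff.mp hl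
    obtain ⟨α', hα'⟩ := IsFull.rootAt (ℒ.isFull hc hw) hi
    obtain ⟨β', hβ'⟩ := IsFull.rootAt (ℒ.isFull hc hw) hj
    obtain rfl := ℒ.inWin_root_unique hc hα ⟨w, hw, k, hα', rfl⟩
    obtain rfl := ℒ.inWin_root_unique hc hβ ⟨w, hw, l, hβ', rfl⟩
    exact ⟨k, l, i, j, hkl, hα', hβ'⟩

/-! ### Reflection functors act on windows -/

/-- Passing the first tick also moves the end of the window past its mirror image, which is a tick
of `i^*`. -/
theorem append_mem_window (hK : K.IsMirror c) {h : Fin m → ℤ} {w : Word m} {i : Fin m} :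
    i :: w ∈ K.window c h ↔ Sink h i ∧ w ++ [i.rev] ∈ K.window c (K.raise h i) := by
  constructor
  · rintro ⟨⟨h1, h2⟩, h3⟩
    rw [run_cons] at h3
    refine ⟨h1, ?_, ?_⟩
    · rw [legal_concat, h3, sink_mir]; exact ⟨h2, h1⟩
    · rw [run_concat, h3, raise_mir hK]
  · rintro ⟨h1, h2, h3⟩
    rw [legal_concat] at h2
    refine ⟨⟨h1, h2.1⟩, ?_⟩
    rw [run_cons]
    rw [run_concat, ← raise_mir hK] at h3
    funext j
    have := congrFun h3 j
    by_cases hj : j = i.rev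
    · subst hj; rw [raise_self, raise_self] at this; omega
    · rwa [raise_of_ne _ hj, raise_of_ne _ hj] at this

theorem exists_window_cons (ℒ : Labelling K c) {h : Fin m → ℤ} (hc : K.IsCut h) {i : Fin m}
    (hi : Sink h i) : ∃ w, i :: w ∈ K.window c h := by
  obtain ⟨w, hw⟩ := ℒ.window_nonempty hc
  have hmem : i ∈ w := by
    by_contra hmem
    have := ℒ.lt_mir h hc i
    rw [← hw.2, run_of_notMem h hmem] at this
    exact this.ne rfl
  obtain ⟨u, v, rfl, hu⟩ := split_first hmem
  exact ⟨u ++ v, window_comm hw (Legal.comm_front hw.1 hi hu)⟩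

theorem reflRight_window (ℒ : Labelling K c) {h : Fin m → ℤ} (i : Fin m) :
    reflRight (K.window c h) i = K.window c h ∨
      (Sink h i ∧ reflRight (K.window c h) i = K.window c (K.raise h i)) := by
  unfold reflRight
  split_ifs with hs
  · right
    obtain ⟨w, hw⟩ := hs
    have hw' := (append_mem_window ℒ.isMirror).mp hw
    refine ⟨hw'.1, ?_⟩
    ext v
    constructor
    · rintro ⟨w', h1, h2⟩
      exact window_comm ((append_mem_window ℒ.isMirror).mp h1).2 h2
    · intro hv
      exact ⟨w, hw, by rwa [commClass_eq_window hw'.2]⟩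
  · exact Or.inl rfl

theorem reflLeft_window (ℒ : Labelling K c) {h : Fin m → ℤ} (hc : K.IsCut h) (i : Fin m) :
    reflLeft (K.window c h) i = K.window c h ∨
      ∃ g, K.IsCut g ∧ reflLeft (K.window c h) i = K.window c g := by
  unfold reflLeft
  split_ifs with hs
  · right
    obtain ⟨w, hw⟩ := hs
    have hwl := (legal_concat h w i).mp hw.1
    -- The final tick removed from the window is the mirror image of a tick of `i^*` just before
    -- `h`. The cut `g` puts that tick back, so `r_i` on the left undoes passing `i^*` from `g`.
    set g := mir (-c) (K.run h w) with hgdef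
    have hmg : mir c g = K.run h w := by funext j; simp [g, mir]
    have hg : K.IsCut g := ℒ.isMirror.neg.isCut (hc.run hwl.1)
    have hsg : Sink g i.rev := by
      rw [hgdef, sink_mir]; exact hwl.2
    have hraise : K.raise g i.rev = h := by
      have h1 : mir c (K.raise g i.rev) = mir c h := by
        rw [← raise_mir ℒ.isMirror, Fin.rev_rev, hmg, ← hw.2, run_concat]
      funext j
      have := congrFun h1 j.rev
      simpa [mir] using this
    have hw' : i.rev :: w ∈ K.window c g := by
      rw [append_mem_window ℒ.isMirror, Fin.rev_rev, hraise]
      exact ⟨hsg, hw⟩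
    refine ⟨g, hg, ?_⟩
    ext v
    constructor
    · rintro ⟨w', h1, h2⟩
      have h3 : i.rev :: w' ∈ K.window c g := by
        rw [append_mem_window ℒ.isMirror, Fin.rev_rev, hraise]
        exact ⟨hsg, h1⟩
      exact window_comm h3 h2
    · intro hv
      exact ⟨w, hw, by rwa [commClass_eq_window hw']⟩
  · exact Or.inl rfl

end Labelling
end TwistedAR

namespace TwistedAR

open Clock

variable {m : ℕ} {K : Clock m} {c : ℤ}

/-! ### Transport along a reflection functor -/

/-- A smaller sequence agrees with `s` before `κ`, and `κ` lies in the support of `s`. If `s`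
vanishes at the first root, this root precedes `κ`. -/
theorem BiLexLt.first_eq_zero {w : Word m} (hw : Word.IsFull w) {i : Fin m} {α : PosRoot m}
    (hα : Word.RootAt w 0 i α) {s s' : RootSeq m} (hlt : BiLexLt w s' s) (h0 : s α = 0) :
    s' α = 0 := by
  obtain ⟨κ, σ, -, hag, hκ, -⟩ := hlt
  obtain ⟨k, j, hk⟩ := exists_rootAt hw.toPerm_eq κ
  have hk0 : k ≠ 0 := by
    rintro rfl
    rw [(RootAt.root_unique hα hk).2] at h0
    omega
  rw [hag α (Or.inl ((IsFull.lt_iff hw hα hk).mpr (by omega))), h0]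

theorem BiLexLt.last_eq_zero {w : Word m} (hw : Word.IsFull w) {k : ℕ} (hk : k + 1 = w.length)
    {i : Fin m} {α : PosRoot m} (hα : Word.RootAt w k i α) {s s' : RootSeq m}
    (hlt : BiLexLt w s' s) (h0 : s α = 0) : s' α = 0 := by
  obtain ⟨κ, σ, -, hag, -, hσ⟩ := hlt
  obtain ⟨l, j, hl⟩ := exists_rootAt hw.toPerm_eq σ
  have hlk : l ≠ k := by
    rintro rfl
    rw [(RootAt.root_unique hα hl).2] at h0
    omega
  have := RootAt.lt_length hl
  rw [hag α (Or.inr ((IsFull.lt_iff hw hl hα).mpr (by omega))), h0]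

theorem permRoot_simpleRoot (i : Fin m) :
    permRoot (simpleRefl i) (simpleRoot i) = simpleRoot i :=
  permRoot_eq_swap (by simp [simpleRoot])

namespace Labelling

theorem inWin_first (ℒ : Labelling K c) {h : Fin m → ℤ} (hc : K.IsCut h) {i : Fin m}
    (hi : Sink h i) : InWin K c h (i, h i) (simpleRoot i) := by
  obtain ⟨w, hw⟩ := ℒ.exists_window_cons hc hi
  exact ⟨_, hw, 0, rootAt_zero i w, by simp⟩

theorem run_of_cons_mem_window {h : Fin m → ℤ} {i : Fin m} {w : Word m}
    (hw : i :: w ∈ K.window c h) : K.run (K.raise h i) w = mir c h := by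
  rw [← run_cons]; exact hw.2

theorem inWin_last (ℒ : Labelling K c) {h : Fin m → ℤ} (hc : K.IsCut h) {i : Fin m}
    (hi : Sink h i) : InWin K c (K.raise h i) (i.rev, h i + c) (simpleRoot i) := by
  obtain ⟨w, hw⟩ := ℒ.exists_window_cons hc hi
  have hw' := ((append_mem_window ℒ.isMirror).mp hw).2
  refine ⟨_, hw', w.length, ?_, ?_⟩
  · have := rootAt_last (ℒ.isFull (hc.raise hi) hw').toPerm_eq
    rwa [Fin.rev_rev] at this
  · simp [run_of_cons_mem_window hw, mir]

theorem inWin_raise (ℒ : Labelling K c) {h : Fin m → ℤ} (hc : K.IsCut h) {i : Fin m}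
    (hi : Sink h i) {x : Fin m × ℤ} {α : PosRoot m} (hx : InWin K c h x α)
    (hne : α ≠ simpleRoot i) : InWin K c (K.raise h i) x (permRoot (simpleRefl i) α) := by
  obtain ⟨w, hw⟩ := ℒ.exists_window_cons hc hi
  have hw' := ((append_mem_window ℒ.isMirror).mp hw).2
  obtain ⟨k, hk, hr⟩ := ℒ.inWin_rootAt hc hx hw
  cases k with
  | zero => exact absurd (RootAt.root_unique hk (rootAt_zero i w)).2 hne
  | succ k =>
    have hlt : k < w.length := by simpa using RootAt.lt_length hk
    have hk' : (w ++ [i.rev])[k]? = some x.1 := by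
      rw [List.getElem?_append_left hlt]; simpa using hk.1
    obtain ⟨β, hβ⟩ := IsFull.rootAt (ℒ.isFull (hc.raise hi) hw') hk'
    have e : permRoot (simpleRefl i) α = β := by
      apply permRoot_eq
      rw [hβ.2, hk.2, List.take_succ_cons, toPerm_cons, List.take_append_of_le_length hlt.le]
      simp
    rw [e]
    refine ⟨_, hw', k, hβ, ?_⟩
    rw [List.take_append_of_le_length hlt.le, ← run_cons, ← hr, List.take_succ_cons]

theorem trace_concat_window {h : Fin m → ℤ} {i : Fin m} {w : Word m}
    (hw : i :: w ∈ K.window c h) : K.trace (K.raise h i) (w ++ [i.rev]) =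
      K.trace (K.raise h i) w ++ [(i.rev, h i + c)] := by
  rw [trace_append, run_of_cons_mem_window hw]
  simp [trace, mir]

/-- The words `i v` and `v i^*` have the same ticks in between, and `s_i` maps the roots of the
former other than `α_i` to those of the latter without changing signs. The excluded root is first on
one side and last on the other, which makes the complement closed downwards. -/
theorem transport_raise (ℒ : Labelling K c) {h : Fin m → ℤ} (hc : K.IsCut h) {i : Fin m}
    (hi : Sink h i) : Transport (K.window c h) (K.window c (K.raise h i))
      (permRoot (simpleRefl i)) {β | β ≠ simpleRoot i} true := by
  have hc1 := hc.raise hi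
  -- the order of two ticks which are in both windows
  have key : ∀ w ∈ K.window c h, ∀ w1 ∈ K.window c (K.raise h i), ∀ v, i :: v ∈ K.window c h →
      (K.trace h w).filter (· ≠ (i, h i)) =
        (K.trace (K.raise h i) v).filter (· ≠ (i, h i)) →
      (K.trace (K.raise h i) w1).filter (· ≠ (i.rev, h i + c)) =
        (K.trace (K.raise h i) v).filter (· ≠ (i.rev, h i + c)) →
      ∀ α ∈ {β | β ≠ simpleRoot i}, ∀ β ∈ {β | β ≠ simpleRoot i}, Word.Lt w α β ↔
        LtDir true w1 (permRoot (simpleRefl i) α) (permRoot (simpleRefl i) β) := by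
    intro w hw w1 hw1 v hv e e1 α hα β hβ
    obtain ⟨x, hx⟩ := ℒ.exists_tick hc α
    obtain ⟨y, hy⟩ := ℒ.exists_tick hc β
    have hne : ∀ {x : Fin m × ℤ} {α}, InWin K c h x α → α ≠ simpleRoot i → x ≠ (i, h i) := by
      rintro x α hx hα rfl
      exact hα (ℒ.inWin_root_unique hc hx (ℒ.inWin_first hc hi))
    have hne' : ∀ {x : Fin m × ℤ} {α}, InWin K c h x α → x ≠ (i.rev, h i + c) := by
      rintro x α hx rfl
      have := (inSpan hc hx).2.2
      simp [mir] at this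
    rw [ℒ.lt_iff_trace hc hw hx hy, pair_sublist_iff_filter (hne hx hα) (hne hy hβ), e,
      ← pair_sublist_iff_filter (hne hx hα) (hne hy hβ)]
    simp only [LtDir, if_true]
    rw [ℒ.lt_iff_trace hc1 hw1 (ℒ.inWin_raise hc hi hx hα) (ℒ.inWin_raise hc hi hy hβ),
      pair_sublist_iff_filter (l := K.trace (K.raise h i) w1) (hne' hx) (hne' hy), e1,
      ← pair_sublist_iff_filter (hne' hx) (hne' hy)]
  have hz : ∀ v, i :: v ∈ K.window c h →
      (K.trace (K.raise h i) (v ++ [i.rev])).filter (· ≠ (i.rev, h i + c)) =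
        (K.trace (K.raise h i) v).filter (· ≠ (i.rev, h i + c)) := by
    intro v hv
    rw [trace_concat_window hv]
    simp
  refine ⟨fun w hw => ?_, fun w1 hw1 => ?_, fun s s' hs hs' => ?_, fun s s' hs hlt β hβ e => ?_,
    fun s s' hs hlt β hβ e => ?_⟩
  · have hmem : i ∈ w := by
      by_contra hmem
      have := ℒ.lt_mir h hc i
      rw [← hw.2, run_of_notMem h hmem] at this
      exact this.ne rfl
    obtain ⟨u, v, rfl, hu⟩ := split_first hmem
    have hw' := window_comm hw (Legal.comm_front hw.1 hi hu)
    have hw1 := ((append_mem_window ℒ.isMirror).mp hw').2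
    exact ⟨_, hw1, key _ hw _ hw1 _ hw' (trace_filter_front hu) (hz _ hw')⟩
  · have hmem : i.rev ∈ w1 := by
      by_contra hmem
      have := ℒ.lt_mir _ hc1 i.rev
      rw [← hw1.2, run_of_notMem _ hmem] at this
      exact this.ne rfl
    obtain ⟨u, v, rfl, hv⟩ := split_last hmem
    have hend : K.run (K.raise h i) (u ++ i.rev :: v) = K.raise (mir c h) i.rev := by
      rw [hw1.2, raise_mir ℒ.isMirror]
    -- The last `i.rev` is the image of the tick passed at `h`. No neighbour of `i.rev` can tick
    -- after it, since `mir c h` is a cut, so it commutes to the end.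
    have hadj := Legal.not_adj_of_source hc1 hw1.1 hv fun j hj => by
      have := (ℒ.isCut_mir hc).lt j i.rev hj.symm
      rw [hend, raise_self, raise_of_ne _ hj.ne.symm]
      omega
    have hw1' := window_comm hw1
      (comm_back (u := u) fun j hj => ⟨fun e => hv (e ▸ hj), hadj j hj⟩)
    have hw := (append_mem_window ℒ.isMirror).mpr ⟨hi, hw1'⟩
    refine ⟨_, hw, key _ hw _ hw1 _ hw (by simp [trace]) (trace_filter_back hv _ ?_)⟩
    have h1 := congrFun (run_of_cons_mem_window hw) i.rev
    rw [run_append, run_of_notMem _ hv] at h1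
    rw [h1]
    simp [mir]
  · refine weight_permRoot _ (Z := {β | β ≠ simpleRoot i}) (Or.inl fun β hβ => ?_) hs hs'
    exact simpleRefl_lt β.2 fun e => hβ (Subtype.ext (Prod.ext e.1 e.2))
  · obtain ⟨w, hw⟩ := ℒ.exists_window_cons hc hi
    subst e
    exact hβ (BiLexLt.first_eq_zero (ℒ.isFull hc hw) (rootAt_zero i w) (hlt _ hw)
      (by_contra fun h0 => hs _ h0 rfl))
  · obtain ⟨w, hw⟩ := ℒ.exists_window_cons hc hi
    have hw1 := ((append_mem_window ℒ.isMirror).mp hw).2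
    have hfull := ℒ.isFull hc1 hw1
    have hlast := rootAt_last hfull.toPerm_eq
    rw [Fin.rev_rev] at hlast
    obtain rfl : β = simpleRoot i := by
      rw [← permRoot_simpleRoot i, ← e, Equiv.apply_symm_apply]
    refine hβ (BiLexLt.last_eq_zero hfull (by simp) hlast (hlt _ hw1)
      (by_contra fun h0 => hs _ h0 e))

/-! ### Independence of the window -/

/-- The data of a pair of ticks in a window which do not depend on the window. -/
def SamePair (C : Set (Word m)) (α β : PosRoot m) (C' : Set (Word m)) (α' β' : PosRoot m) : Prop :=
  gdist C (pairSeq α β) = gdist C' (pairSeq α' β') ∧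
    (Prec C α β ∨ Prec C β α ↔ Prec C' α' β' ∨ Prec C' β' α')

theorem SamePair.trans {C C' C'' : Set (Word m)} {α β α' β' α'' β'' : PosRoot m}
    (h : SamePair C α β C' α' β') (h' : SamePair C' α' β' C'' α'' β'') :
    SamePair C α β C'' α'' β'' :=
  ⟨h.1.trans h'.1, h.2.trans h'.2⟩

theorem SamePair.symm {C C' : Set (Word m)} {α β α' β' : PosRoot m}
    (h : SamePair C α β C' α' β') : SamePair C' α' β' C α β :=
  ⟨h.1.symm, h.2.symm⟩

theorem _root_.TwistedAR.Transport.samePair {C C' : Set (Word m)} {e : PosRoot m ≃ PosRoot m}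
    {Z : Set (PosRoot m)} {b : Bool} (H : Transport C C' e Z b) {α β : PosRoot m} (hα : α ∈ Z)
    (hβ : β ∈ Z) : SamePair C α β C' (e α) (e β) :=
  ⟨H.gdist_eq hα hβ, H.prec_iff hα hβ⟩

theorem samePair_of_le (ℒ : Labelling K c) {g h : Fin m → ℤ} (hg : K.IsCut g) (hh : K.IsCut h)
    (hle : ∀ i, g i ≤ h i) {x y : Fin m × ℤ} {α β α' β' : PosRoot m}
    (hx : InWin K c g x α) (hy : InWin K c g y β) (hx' : InWin K c h x α')
    (hy' : InWin K c h y β') : SamePair (K.window c g) α β (K.window c h) α' β' := by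
  obtain ⟨w, hw, rfl⟩ := exists_legal hg hh hle
  clear hle
  induction w generalizing g α β with
  | nil =>
    rw [run_nil] at hx' hy' ⊢
    rw [ℒ.inWin_root_unique hg hx hx', ℒ.inWin_root_unique hg hy hy']
    exact ⟨rfl, Iff.rfl⟩
  | cons i w ih =>
    have hi := hw.1
    -- The tick passed first lies strictly before the final cut, so a tick present in both windows
    -- is a different one and its root is not `α_i`.
    have hne : ∀ {x : Fin m × ℤ} {α α' : PosRoot m}, InWin K c g x α →
        InWin K c (K.run g (i :: w)) x α' → α ≠ simpleRoot i := by
      rintro x α α' hx hx' rfl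
      have e := ℒ.inWin_tick_unique hg hx (ℒ.inWin_first hg hi)
      subst e
      have h1 := (inSpan hh hx').2.1
      rw [run_cons] at h1
      have h2 := le_run (K := K) (K.raise g i) w i
      rw [raise_self] at h2
      have := K.step_pos i
      simp only at h1
      omega
    have h1 := hne hx hx'
    have h2 := hne hy hy'
    have hs := (ℒ.transport_raise hg hi).samePair (α := α) (β := β) h1 h2
    rw [run_cons] at hh hx' hy' ⊢
    exact hs.trans (ih (hg.raise hi) (ℒ.inWin_raise hg hi hx h1) (ℒ.inWin_raise hg hi hy h2) hw.2
      hh hx' hy')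

/-- The end of a window is a shift of its start, so a tick before both ends is before the end of the
meet. -/
theorem inSpan_min {g h : Fin m → ℤ} {x : Fin m × ℤ}
    (hx : InSpan K c g x) (hx' : InSpan K c h x) : InSpan K c (fun i => min (g i) (h i)) x := by
  obtain ⟨h1, h2, h3⟩ := hx
  obtain ⟨-, h2', h3'⟩ := hx'
  simp only [mir] at h3 h3'
  refine ⟨h1, ?_, ?_⟩ <;> simp only [mir] <;> omega

/-- The generalized distance and the comparability of two ticks do not depend on the window. -/
theorem samePair (ℒ : Labelling K c) {g h : Fin m → ℤ} (hg : K.IsCut g) (hh : K.IsCut h)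
    {x y : Fin m × ℤ} {α β α' β' : PosRoot m}
    (hx : InWin K c g x α) (hy : InWin K c g y β) (hx' : InWin K c h x α')
    (hy' : InWin K c h y β') : SamePair (K.window c g) α β (K.window c h) α' β' := by
  have hm := hg.min hh
  obtain ⟨α₀, hα⟩ := ℒ.exists_inWin hm (inSpan_min (inSpan hg hx) (inSpan hh hx'))
  obtain ⟨β₀, hβ⟩ := ℒ.exists_inWin hm (inSpan_min (inSpan hg hy) (inSpan hh hy'))
  exact (ℒ.samePair_of_le hm hg (fun i => min_le_left _ _) hα hβ hx hy).symm.trans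
    (ℒ.samePair_of_le hm hh (fun i => min_le_right _ _) hα hβ hx' hy')

end Labelling
end TwistedAR

namespace TwistedAR

open Clock

variable {m : ℕ} {K : Clock m} {c d : ℤ}

/-! ### Transport along the reflection of letters and along the reversal of words -/

/-- The root `-w_0(β)`. -/
def starRoot (β : PosRoot m) : PosRoot m := permRoot Fin.revPerm β

theorem starRoot_val (β : PosRoot m) : (starRoot β).1 = (β.1.2.rev, β.1.1.rev) :=
  permRoot_of_gt (by simpa using β.2)

theorem simpleRefl_rev (i : Fin m) (x : Fin (m + 1)) :
    simpleRefl i.rev x = (simpleRefl i x.rev).rev := by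
  have h1 : i.rev.castSucc = i.succ.rev := (Fin.rev_succ i).symm
  have h2 : i.rev.succ = i.castSucc.rev := (Fin.rev_castSucc i).symm
  unfold simpleRefl
  rw [h1, h2, Equiv.swap_apply_def, Equiv.swap_apply_def]
  simp only [Fin.rev_eq_iff, eq_comm (a := x)]
  split_ifs <;> simp_all

theorem toPerm_map_rev (w : Word m) (x : Fin (m + 1)) :
    Word.toPerm (w.map Fin.rev) x = (Word.toPerm w x.rev).rev := by
  induction w with
  | nil => simp
  | cons i w ih =>
    rw [List.map_cons, toPerm_cons, toPerm_cons, Equiv.Perm.mul_apply, Equiv.Perm.mul_apply, ih,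
      simpleRefl_rev, Fin.rev_rev]

theorem RootAt.map_rev {w : Word m} {k : ℕ} {i : Fin m} {β : PosRoot m}
    (h : Word.RootAt w k i β) : Word.RootAt (w.map Fin.rev) k i.rev (starRoot β) := by
  refine ⟨by simp [h.1], ?_⟩
  rw [starRoot_val, h.2, ← List.map_take, toPerm_map_rev, toPerm_map_rev]
  simp [← Fin.rev_succ, ← Fin.rev_castSucc]

theorem mir_mir (c d : ℤ) (h : Fin m → ℤ) : mir c (mir d h) = mir d (mir c h) := by
  funext i; simp [mir]; ring

theorem map_rev_map_rev (w : Word m) : (w.map Fin.rev).map Fin.rev = w := by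
  rw [List.map_map, Fin.rev_involutive.comp_self, List.map_id]

theorem mem_window_mir (hd : K.IsMirror d) {h : Fin m → ℤ} {w : Word m} :
    w.map Fin.rev ∈ K.window c (mir d h) ↔ w ∈ K.window c h := by
  have hinj : ∀ a b : Fin m → ℤ, mir d a = mir d b ↔ a = b := by
    refine fun a b => ⟨fun e => funext fun i => ?_, fun e => e ▸ rfl⟩
    simpa [mir] using congrFun e i.rev
  unfold window
  rw [Set.mem_ofPred_eq, Set.mem_ofPred_eq, legal_mir hd, run_mir hd, mir_mir, hinj]

namespace Labelling

theorem inWin_mir (hd : K.IsMirror d) {h : Fin m → ℤ} {x : Fin m × ℤ}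
    {β : PosRoot m} (hx : InWin K c h x β) :
    InWin K c (mir d h) (x.1.rev, x.2 + d) (starRoot β) := by
  obtain ⟨w, hw, k, hk, hr⟩ := hx
  refine ⟨_, (mem_window_mir hd).mpr hw, k, RootAt.map_rev hk, ?_⟩
  rw [← List.map_take, run_mir hd]
  simp [mir, hr]

/-- Reflecting all letters acts on roots by `-w_0`, which keeps positivity, order and equality of
weights, so no root has to be excluded. -/
theorem transport_mir (ℒ : Labelling K c) (hd : K.IsMirror d) {h : Fin m → ℤ} (hc : K.IsCut h) :
    Transport (K.window c h) (K.window c (mir d h)) (permRoot Fin.revPerm) Set.univ true := by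
  have key : ∀ w ∈ K.window c h, ∀ α β, Word.Lt w α β ↔
      LtDir true (w.map Fin.rev) (permRoot Fin.revPerm α) (permRoot Fin.revPerm β) := by
    intro w hw α β
    have hw' := (mem_window_mir (c := c) hd).mpr hw
    obtain ⟨k, i, hk⟩ := exists_rootAt (ℒ.isFull hc hw).toPerm_eq α
    obtain ⟨l, j, hl⟩ := exists_rootAt (ℒ.isFull hc hw).toPerm_eq β
    simp only [LtDir, if_true]
    rw [IsFull.lt_iff (ℒ.isFull hc hw) hk hl]
    exact (IsFull.lt_iff (ℒ.isFull (hd.isCut hc) hw') (RootAt.map_rev hk)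
      (RootAt.map_rev hl)).symm
  refine ⟨fun w hw => ⟨_, (mem_window_mir hd).mpr hw, fun α _ β _ => key w hw α β⟩,
    fun w hw => ?_, fun s s' hs hs' => ?_, fun _ _ _ _ _ _ => trivial, fun _ _ _ _ _ _ => trivial⟩
  · have hw' : w.map Fin.rev ∈ K.window c h := by
      rw [← mem_window_mir hd, map_rev_map_rev]; exact hw
    refine ⟨_, hw', fun α _ β _ => ?_⟩
    rw [key _ hw', map_rev_map_rev]
  · exact weight_permRoot _ (Or.inr fun β _ => by simpa using β.2) hs hs'

theorem samePair_mir (ℒ : Labelling K c) (hd : K.IsMirror d) {h : Fin m → ℤ} (hc : K.IsCut h)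
    (α β : PosRoot m) : SamePair (K.window c h) α β (K.window c (mir d h)) (starRoot α)
      (starRoot β) :=
  (ℒ.transport_mir hd hc).samePair (α := α) (β := β) trivial trivial

end Labelling

/-! ### Reversal of time -/

/-- The ticks of each letter are symmetric about the time `0`. -/
def Clock.IsSymm (K : Clock m) : Prop := ∀ i t, K.OnTime i t → K.OnTime i (-t)

/-- The cut which starts the time reversal of the window of the cut `h`. -/
def revCut (K : Clock m) (c : ℤ) (h : Fin m → ℤ) : Fin m → ℤ := fun i => K.step i - mir c h i

theorem revCut_isCut (hs : K.IsSymm) (hd : K.IsMirror c) {h : Fin m → ℤ} (hc : K.IsCut h) :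
    K.IsCut (revCut K c h) where
  onTime i := by
    have := hs i _ ((hd.isCut hc).onTime i).sub_step
    simpa [revCut] using this
  lt i j hij := by
    have := (hd.isCut hc).lt j i hij.symm
    simp only [revCut]
    omega

theorem mir_revCut (hd : K.IsMirror c) (h : Fin m → ℤ) (i : Fin m) :
    mir c (revCut K c h) i = K.step i - h i := by
  simp [mir, revCut, (hd i).1]
  ring

theorem revCut_revCut (hd : K.IsMirror c) (h : Fin m → ℤ) :
    revCut K c (revCut K c h) = h := by
  funext i
  rw [revCut, mir_revCut hd]
  ring

/-- The last tick of `i` before the final cut is `K.run h w i - K.step i`; after reversal of time it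
becomes the first one, whence the shape of the new cut. -/
theorem legal_reverse {h : Fin m → ℤ} (hc : K.IsCut h) {w : Word m}
    (hw : K.Legal h w) : K.Legal (fun i => K.step i - K.run h w i) w.reverse := by
  induction w using List.reverseRecOn with
  | nil => trivial
  | append_singleton u i ih =>
    rw [legal_concat] at hw
    have hg := hc.run hw.1
    rw [List.reverse_append, List.reverse_singleton, List.singleton_append, run_concat]
    refine ⟨fun j hj => ?_, ?_⟩
    · have := hg.lt j i hj.symm
      simp only [raise_self, raise_of_ne _ hj.ne.symm]
      omega
    · convert ih hw.1 using 1
      funext j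
      by_cases hj : j = i
      · subst hj; simp; ring
      · rw [raise_of_ne _ hj, raise_of_ne _ hj]

theorem reverse_mem_window (hd : K.IsMirror c) {h : Fin m → ℤ} (hc : K.IsCut h) {w : Word m}
    (hw : w ∈ K.window c h) : w.reverse ∈ K.window c (revCut K c h) := by
  constructor
  · have := legal_reverse hc hw.1
    rwa [hw.2] at this
  · funext i
    rw [mir_revCut hd]
    have := congrFun hw.2 i
    simp only [run, List.count_reverse, revCut] at this ⊢
    omega

theorem toPerm_reverse (w : Word m) : Word.toPerm w.reverse = (Word.toPerm w)⁻¹ := by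
  induction w with
  | nil => simp
  | cons i w ih => rw [List.reverse_cons, toPerm_concat, ih, toPerm_cons, mul_inv_rev,
      simpleRefl_inv]

theorem RootAt.reverse {u v : Word m} {i : Fin m} {β : PosRoot m}
    (h : Word.RootAt (u ++ i :: v) u.length i β)
    (hw : Word.toPerm (u ++ i :: v) = Fin.revPerm) :
    Word.RootAt (v.reverse ++ i :: u.reverse) v.length i (starRoot β) := by
  have hv : (Word.toPerm v)⁻¹ = Fin.revPerm * Word.toPerm u * simpleRefl i := by
    rw [toPerm_append, toPerm_cons, ← mul_assoc] at hw
    have hr : (Fin.revPerm : Equiv.Perm (Fin (m + 1))) * Fin.revPerm = 1 := by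
      ext x; simp
    rw [inv_eq_iff_mul_eq_one, ← hr]
    nth_rewrite 2 [← hw]
    have hr' : Word.toPerm v * Fin.revPerm * (Word.toPerm u * simpleRefl i * Word.toPerm v) =
        Word.toPerm v * Fin.revPerm * Fin.revPerm := by rw [hw]
    have : Word.toPerm v * Fin.revPerm * (Word.toPerm u * simpleRefl i) = 1 := by
      rw [← mul_assoc, mul_assoc _ Fin.revPerm Fin.revPerm, hr, mul_one] at hr'
      exact mul_eq_right.mp hr'
    rw [← mul_assoc] at this
    rw [hw, hr, ← this]
    simp only [mul_assoc]
  refine ⟨by simp, ?_⟩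
  have e : (v.reverse ++ i :: u.reverse).take v.length = v.reverse := by
    rw [List.take_append_of_le_length (by simp), List.take_of_length_le (by simp)]
  have h2 := h.2
  rw [List.take_left] at h2
  rw [e, toPerm_reverse, hv, starRoot_val, h2]
  simp

namespace Labelling

theorem rootAt_reverse {w : Word m} (hw : Word.IsFull w) {k : ℕ} {i : Fin m}
    {β : PosRoot m} (hk : Word.RootAt w k i β) :
    Word.RootAt w.reverse (w.length - 1 - k) i (starRoot β) := by
  have hlt := RootAt.lt_length hk
  have e := split_at hk.1
  have hu : (w.take k).length = k := by simp; omega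
  have h1 := hk
  have h2 := hw.toPerm_eq
  rw [e] at h1 h2
  have h3 := RootAt.reverse (u := w.take k) (by rwa [hu]) h2
  have e' : w.reverse = (w.drop (k + 1)).reverse ++ i :: (w.take k).reverse := by
    conv_lhs => rw [e]
    simp
  have hv : (w.drop (k + 1)).length = w.length - 1 - k := by simp; omega
  rw [e', ← hv]
  exact h3

theorem inWin_revCut (ℒ : Labelling K c) {h : Fin m → ℤ} (hc : K.IsCut h) {x : Fin m × ℤ}
    {β : PosRoot m} (hx : InWin K c h x β) :
    InWin K c (revCut K c h) (x.1, -x.2) (starRoot β) := by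
  obtain ⟨w, hw, k, hk, hr⟩ := hx
  refine ⟨_, reverse_mem_window ℒ.isMirror hc hw, _, rootAt_reverse (ℒ.isFull hc hw) hk, ?_⟩
  have hlt := RootAt.lt_length hk
  have e := split_at hk.1
  have e1 : w.reverse.take (w.length - 1 - k) = (w.drop (k + 1)).reverse := by
    conv_lhs => rw [e]
    have hv : (w.drop (k + 1)).reverse.length = w.length - 1 - k := by simp; omega
    have hl : (w.take k ++ x.1 :: w.drop (k + 1)).length = w.length := by rw [← e]
    rw [hl, List.reverse_append, List.reverse_cons, List.append_assoc, ← hv, List.take_left]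
  rw [e1, ← hr]
  have h1 := congrFun hw.2 x.1
  rw [e] at h1
  simp only [run, List.count_reverse, revCut, List.count_append, List.count_cons_self] at h1 ⊢
  rw [← h1]
  push_cast
  ring

/-- Reversing a word of `w_0` reverses the order of roots and applies `-w_0` to them; generalized
distances do not see the reversal of the order. -/
theorem transport_revCut (ℒ : Labelling K c) (hs : K.IsSymm) {h : Fin m → ℤ} (hc : K.IsCut h) :
    Transport (K.window c h) (K.window c (revCut K c h)) (permRoot Fin.revPerm) Set.univ
      false := by
  have hc' := revCut_isCut hs ℒ.isMirror hc
  have key : ∀ w ∈ K.window c h, ∀ α β, Word.Lt w α β ↔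
      LtDir false w.reverse (permRoot Fin.revPerm α) (permRoot Fin.revPerm β) := by
    intro w hw α β
    have hf := ℒ.isFull hc hw
    have hf' := ℒ.isFull hc' (reverse_mem_window ℒ.isMirror hc hw)
    obtain ⟨k, i, hk⟩ := exists_rootAt hf.toPerm_eq α
    obtain ⟨l, j, hl⟩ := exists_rootAt hf.toPerm_eq β
    have := RootAt.lt_length hk
    have := RootAt.lt_length hl
    simp only [LtDir, Bool.false_eq_true, if_false]
    rw [IsFull.lt_iff hf hk hl]
    refine Iff.trans ?_ (IsFull.lt_iff hf' (rootAt_reverse hf hl) (rootAt_reverse hf hk)).symm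
    omega
  refine ⟨fun w hw => ⟨_, reverse_mem_window ℒ.isMirror hc hw, fun α _ β _ => key w hw α β⟩,
    fun w hw => ?_, fun s s' hs hs' => ?_, fun _ _ _ _ _ _ => trivial, fun _ _ _ _ _ _ => trivial⟩
  · have hw' := reverse_mem_window ℒ.isMirror hc' hw
    rw [revCut_revCut ℒ.isMirror] at hw'
    refine ⟨_, hw', fun α _ β _ => ?_⟩
    rw [key _ hw', List.reverse_reverse]
  · exact weight_permRoot _ (Or.inr fun β _ => by simpa using β.2) hs hs'

theorem samePair_revCut (ℒ : Labelling K c) (hs : K.IsSymm) {h : Fin m → ℤ} (hc : K.IsCut h)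
    (α β : PosRoot m) : SamePair (K.window c h) α β (K.window c (revCut K c h)) (starRoot α)
      (starRoot β) :=
  (ℒ.transport_revCut hs hc).samePair (α := α) (β := β) trivial trivial

end Labelling

/-! ### Distant ticks -/

/-- A root in the support of a sequence of weight `α_i + α_j` is supported on two non-adjacent
letters, hence is `α_i` or `α_j`. So the multiplicity of neither can drop to 0, whereas the order
requires a drop at `κ`. -/
theorem isSimplePair_simpleRoot {C : Set (Word m)} {w : Word m} (hw : w ∈ C)
    {i j : Fin m} (hne : i ≠ j) (hadj : ¬ Adj i j) :
    IsSimplePair C (simpleRoot i) (simpleRoot j) := by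
  rintro ⟨s, hs, hwt⟩
  obtain ⟨κ, -, -, -, hκ, -⟩ := hs w hw
  -- the weight of the pair vanishes at the other letters
  have hwt0 : ∀ (i j k : Fin m), k ≠ i → k ≠ j →
      weight (pairSeq (simpleRoot i) (simpleRoot j)) k = 0 := by
    intro i j k hki hkj
    rw [weight_apply]
    refine Finset.sum_eq_zero fun β _ => ?_
    have hco : ∀ l : Fin m, k ≠ l → (simpleRoot l).coeff k = 0 := by
      intro l hl
      have : (k : ℕ) ≠ l := fun e => hl (Fin.ext e)
      simp only [PosRoot.coeff, simpleRoot, Fin.le_def, Fin.lt_def, Fin.val_castSucc, Fin.val_succ]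
      split_ifs <;> omega
    by_cases h1 : β = simpleRoot i
    · rw [h1, hco i hki, mul_zero]
    · by_cases h2 : β = simpleRoot j
      · rw [h2, hco j hkj, mul_zero]
      · simp [pairSeq, h1, h2]
  have hpos : ∀ (i j : Fin m), 0 < weight (pairSeq (simpleRoot i) (simpleRoot j)) i := by
    intro i j
    rw [weight_apply]
    refine Finset.sum_pos' (fun _ _ => Nat.zero_le _) ⟨simpleRoot i, Finset.mem_univ _, ?_⟩
    simp [pairSeq, PosRoot.coeff, simpleRoot]
  have key : ∀ (i j : Fin m), ¬ Adj i j →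
      weight s = weight (pairSeq (simpleRoot i) (simpleRoot j)) →
      s (simpleRoot i) = 0 → False := by
    intro i j hadj hwt h0
    have h1 := hpos i j
    rw [← hwt, weight_apply] at h1
    obtain ⟨β, -, hβ⟩ := Finset.exists_ne_zero_of_sum_ne_zero h1.ne'
    obtain ⟨hβ1, hβ2⟩ := mul_ne_zero_iff.mp hβ
    have hvan : ∀ k, k ≠ i → k ≠ j → β.coeff k = 0 := by
      intro k hki hkj
      have h2 := hwt0 i j k hki hkj
      rw [← hwt, weight_apply, Finset.sum_eq_zero_iff] at h2
      exact (mul_eq_zero.mp (h2 β (Finset.mem_univ _))).resolve_left hβ1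
    have hb : β.1.1 ≤ i.castSucc ∧ i.castSucc < β.1.2 := by
      by_contra hc
      exact hβ2 (if_neg hc)
    have hlast := β.1.2.2
    simp only [Fin.le_def, Fin.lt_def, Fin.val_castSucc] at hb
    have hout : ∀ k : Fin m, Adj i k → ¬ ((β.1.1 : ℕ) ≤ k ∧ (k : ℕ) < β.1.2) := by
      intro k hk hc
      have := hvan k hk.ne.symm (fun e => hadj (e ▸ hk))
      simp only [PosRoot.coeff, Fin.le_def, Fin.lt_def, Fin.val_castSucc] at this
      rw [if_pos hc] at this
      omega
    have e1 : (β.1.1 : ℕ) = i := by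
      by_contra hc
      have hi := i.2
      exact hout ⟨(i : ℕ) - 1, by omega⟩ (Or.inr (by simp; omega)) (by simp; omega)
    have e2 : (β.1.2 : ℕ) = i + 1 := by
      by_contra hc
      exact hout ⟨(i : ℕ) + 1, by omega⟩ (Or.inl rfl) (by simp; omega)
    have : β = simpleRoot i :=
      Subtype.ext (Prod.ext (Fin.ext (by simp [simpleRoot, e1])) (Fin.ext (by simp [simpleRoot, e2])))
    rw [this] at hβ1
    exact hβ1 h0
  by_cases h1 : κ = simpleRoot i
  · subst h1
    have hne' : simpleRoot i ≠ simpleRoot j := fun e => hne (by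
      have := congrArg (fun β : PosRoot m => (β.1.1 : ℕ)) e
      simpa [simpleRoot, Fin.val_inj] using this)
    simp only [pairSeq, Pi.add_apply, Pi.single_eq_same, Pi.single_eq_of_ne hne'] at hκ
    exact key i j hadj hwt (by omega)
  · by_cases h2 : κ = simpleRoot j
    · subst h2
      simp only [pairSeq, Pi.add_apply, Pi.single_eq_same, Pi.single_eq_of_ne h1] at hκ
      exact key j i (fun h => hadj h.symm) (by rw [pairSeq_comm]; exact hwt) (by omega)
    · simp [pairSeq, h1, h2] at hκ

theorem isSimplePair_comm {C : Set (Word m)} {α β : PosRoot m} :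
    IsSimplePair C α β ↔ IsSimplePair C β α := by
  unfold IsSimplePair; rw [pairSeq_comm]

theorem gdist_eq_zero {C : Set (Word m)} {α β : PosRoot m} (h : IsSimplePair C α β) :
    gdist C (pairSeq α β) = 0 := by
  refine if_pos fun γ δ hne hγ hδ => ?_
  have key : ∀ γ, 0 < pairSeq α β γ → γ = α ∨ γ = β := by
    intro γ hγ
    by_contra hc
    push Not at hc
    simp [pairSeq, hc.1, hc.2] at hγ
  rcases key γ hγ with rfl | rfl <;> rcases key δ hδ with rfl | rfl
  · exact absurd rfl hne
  · exact h
  · exact isSimplePair_comm.mp h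
  · exact absurd rfl hne

namespace Labelling

/-- Move the last tick of a source back to the future. -/
theorem exists_lower {h : Fin m → ℤ} (hc : K.IsCut h) {i : Fin m}
    (hi : ∀ j, Adj i j → h j - K.step j < h i - K.step i) :
    ∃ g, K.IsCut g ∧ Sink g i ∧ K.raise g i = h ∧ g i = h i - K.step i := by
  refine ⟨Function.update h i (h i - K.step i), ⟨fun j => ?_, fun j k hjk => ?_⟩, fun j hj => ?_,
    ?_, by simp⟩
  · by_cases hj : j = i
    · subst hj; simpa using (hc.onTime j).sub_step
    · simpa [hj] using hc.onTime j
  · by_cases hj : j = i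
    · subst hj
      have := hc.lt j k hjk
      have := K.step_pos j
      simp only [Function.update_self, Function.update_of_ne hjk.ne.symm]
      omega
    · rw [Function.update_of_ne hj]
      by_cases hk : k = i
      · subst hk; simpa using hi j hjk.symm
      · rw [Function.update_of_ne hk]; exact hc.lt j k hjk
  · simpa [Function.update_of_ne hj.ne.symm] using hc.lt i j hj
  · funext j
    by_cases hj : j = i
    · subst hj; simp
    · simp [raise_of_ne _ hj, hj]

/-- Two ticks of a window whose times differ by at least the length of the window form a simple
pair. -/
theorem gdist_eq_zero_of_far (ℒ : Labelling K c) {h : Fin m → ℤ} (hc : K.IsCut h)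
    {x y : Fin m × ℤ} {α β : PosRoot m} (hx : InWin K c h x α) (hy : InWin K c h y β)
    (hfar : x.2 + c ≤ y.2) : gdist (K.window c h) (pairSeq α β) = 0 := by
  obtain ⟨i, a⟩ := x
  obtain ⟨j, b⟩ := y
  obtain ⟨hx1, hx2, hx3⟩ := inSpan hc hx
  obtain ⟨hy1, hy2, hy3⟩ := inSpan hc hy
  simp only [mir] at hx1 hx2 hx3 hy1 hy2 hy3 hfar
  have hb : K.OnTime j.rev (b - c) := ℒ.isMirror.neg.onTime hy1
  -- Clip `h` between the cuts at times `a` and `b - c + 1`. At `F` the tick `x` comes next, and the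
  -- mirror preimage of `y`, at time `b - c ≥ a`, has just been passed. Hence `x` can be taken first
  -- and `y` last in the window of `F`.
  set F : Fin m → ℤ := fun k => min (max (h k) (K.slice a k)) (K.slice (b - c + 1) k) with hFdef
  have hF : K.IsCut F := (hc.max (slice_isCut a)).min (slice_isCut _)
  have hFi : F i = a := by
    have := le_slice (K := K) (b - c + 1) i
    simp only [hFdef, slice_eq hx1]
    omega
  have hsi : Sink F i := by
    intro k hk
    have h1 := le_slice (K := K) (b - c + 1) k
    have h2 := le_slice (K := K) a k
    have h3 := hx1.ne hk (slice_onTime a k)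
    rw [hFi]
    simp only [hFdef]
    omega
  have hFj : F j.rev = b - c + K.step j.rev := by
    have h1 := hb.le_sub_step (hc.onTime j.rev) (by omega)
    have h2 := hb.le_sub_step (slice_onTime (b - c + 1) j.rev)
      (by have := le_slice (K := K) (b - c + 1) j.rev; omega)
    have h3 := slice_lt (K := K) (b - c + 1) j.rev
    simp only [hFdef]
    omega
  obtain ⟨G, hG, hsG, hGF, hGj⟩ := exists_lower hF (i := j.rev) fun k hk => by
    have h1 := slice_lt (K := K) (b - c + 1) k
    have h2 : F k ≤ K.slice (b - c + 1) k := min_le_right _ _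
    have h3 := (hF.onTime k).sub_step.ne hk.symm hb
    omega
  have hij : i ≠ j.rev := by
    rintro rfl
    have := K.step_pos j.rev
    omega
  have hadj : ¬ Adj i j.rev := fun hadj => by
    have := hsG i hadj.symm
    rw [← hGF, raise_of_ne _ hij] at hFi
    omega
  have hx' := ℒ.inWin_first hF hsi
  have hy' := ℒ.inWin_last hG hsG
  rw [hFi] at hx'
  rw [hGF, Fin.rev_rev, hGj, hFj] at hy'
  have e : b - c + K.step j.rev - K.step j.rev + c = b := by ring
  rw [e] at hy'
  rw [(ℒ.samePair hc hF hx hy hx' hy').1]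
  obtain ⟨w, hw⟩ := ℒ.window_nonempty hF
  exact gdist_eq_zero (isSimplePair_simpleRoot hw hij hadj)

end Labelling
end TwistedAR

namespace TwistedAR

open Clock

variable {m : ℕ}

/-! ### The Auslander–Reiten heap of type `A_m` -/

/-- The clock of the Auslander–Reiten quivers of type `A_m`. -/
def arClock (m : ℕ) : Clock m where
  step _ := 2
  off i := i
  step_pos _ := two_pos
  no_tie i j hij a b := by unfold Adj at hij; omega

theorem arClock_isMirror (m : ℕ) : (arClock m).IsMirror (m + 1) := fun i => by
  refine ⟨rfl, (m : ℤ) - i, ?_⟩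
  have := Fin.val_rev i
  simp only [arClock]
  omega

/-- Adjacent letters have ticks of opposite parity and step 2, so the cut inequalities leave only
`±1`: a cut is a lattice path. -/
theorem arClock_cut_adj {h : Fin m → ℤ} (hc : (arClock m).IsCut h) {i j : Fin m} (hij : Adj i j) :
    h j = h i + 1 ∨ h j = h i - 1 := by
  have h1 := hc.lt i j hij
  have h2 := hc.lt j i hij.symm
  have h3 := (hc.onTime i).ne hij (hc.onTime j)
  obtain ⟨x, hx⟩ := hc.onTime i
  obtain ⟨y, hy⟩ := hc.onTime j
  simp only [arClock] at *
  unfold Adj at hij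
  omega

/-- A cut of type `A_m` extended by a virtual letter above the last one. -/
def extCut (h : Fin m → ℤ) (k : ℕ) : ℤ :=
  if hk : k < m then h ⟨k, hk⟩ else if hm : m - 1 < m then h ⟨m - 1, hm⟩ + 1 else 0

theorem extCut_of_lt (h : Fin m → ℤ) {k : ℕ} (hk : k < m) : extCut h k = h ⟨k, hk⟩ := dif_pos hk

theorem extCut_coe (h : Fin m → ℤ) (i : Fin m) : extCut h i = h i := extCut_of_lt h i.2

theorem extCut_last (h : Fin m) (g : Fin m → ℤ) : extCut g m = extCut g (m - 1) + 1 := by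
  have := h.2
  have hm : m - 1 < m := by omega
  rw [extCut_of_lt g hm]
  simp [extCut, hm]

theorem extCut_top (g : Fin m → ℤ) {i : Fin m} (hi : (i : ℕ) + 1 = m) :
    extCut g (i + 1) = g i + 1 := by
  have e : (⟨m - 1, by omega⟩ : Fin m) = i := Fin.ext (by simp; omega)
  rw [extCut, dif_neg (by omega), dif_pos (by omega), e]

theorem extCut_succ {h : Fin m → ℤ} (hc : (arClock m).IsCut h) {k : ℕ} (hk : k < m) :
    extCut h (k + 1) = extCut h k + 1 ∨ extCut h (k + 1) = extCut h k - 1 := by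
  by_cases hk1 : k + 1 < m
  · rw [extCut_of_lt h hk, extCut_of_lt h hk1]
    exact arClock_cut_adj hc (Or.inl rfl)
  · obtain rfl : m = k + 1 := by omega
    left
    exact extCut_last ⟨k, hk⟩ h

theorem extCut_lipschitz {h : Fin m → ℤ} (hc : (arClock m).IsCut h) {k l : ℕ} (hkl : k ≤ l)
    (hl : l ≤ m) : extCut h l - extCut h k ≤ l - k ∧ extCut h k - extCut h l ≤ l - k := by
  induction l, hkl using Nat.le_induction with
  | base => simp
  | succ l hkl ih =>
    have := ih (by omega)
    have := extCut_succ hc (k := l) (by omega)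
    push_cast
    omega

theorem arCut_lipschitz {h : Fin m → ℤ} (hc : (arClock m).IsCut h) (i j : Fin m) :
    h i - h j ≤ |(i : ℤ) - j| := by
  have hi := i.2
  have hj := j.2
  rw [← extCut_coe h i, ← extCut_coe h j]
  rcases le_total (i : ℕ) j with hij | hij
  · have := extCut_lipschitz hc hij hj.le
    rw [abs_of_nonpos (by omega)]
    omega
  · have := extCut_lipschitz hc hij hi.le
    rw [abs_of_nonneg (by omega)]
    omega

/-! ### Strand labels in type `A_m` -/

/-- The label of the strand at height `k`: a strand moves along lines of slope `±1`. -/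
def arLabel (h : Fin m → ℤ) (k : ℕ) : ℤ :=
  extCut h k + (extCut h k - extCut h (k - 1)) * k

theorem arLabel_zero (h : Fin m → ℤ) : arLabel h 0 = extCut h 0 := by simp [arLabel]

theorem arLabel_succ {h : Fin m → ℤ} (hc : (arClock m).IsCut h) {k : ℕ} (hk : k < m) :
    (extCut h (k + 1) = extCut h k + 1 ∧ arLabel h (k + 1) = extCut h k + k + 2) ∨
    (extCut h (k + 1) = extCut h k - 1 ∧ arLabel h (k + 1) = extCut h k - k - 2) := by
  unfold arLabel
  rw [Nat.add_sub_cancel]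
  rcases extCut_succ hc hk with e | e <;> rw [e]
  · left; refine ⟨rfl, ?_⟩; push_cast; ring
  · right; refine ⟨rfl, ?_⟩; push_cast; ring

/-- The cut is 1-Lipschitz, which keeps lines through different heights apart and their labels
within less than one period; so labels stay distinct modulo `2m+2`. -/
theorem arLabel_ne {h : Fin m → ℤ} (hc : (arClock m).IsCut h) {k l : ℕ} (hkl : k < l)
    (hl : l ≤ m) : arLabel h k ≠ arLabel h l ∧ |arLabel h k - arLabel h l| < 2 * m + 2 := by
  obtain ⟨l, rfl⟩ : ∃ a, l = a + 1 := ⟨l - 1, by omega⟩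
  have h1 := extCut_lipschitz hc (k := k) (l := l) (by omega) (by omega)
  have h2 := arLabel_succ hc (k := l) (by omega)
  rw [abs_lt]
  cases k with
  | zero =>
    rw [arLabel_zero]
    push_cast at *
    omega
  | succ k =>
    have h3 := arLabel_succ hc (k := k) (by omega)
    push_cast at *
    omega

theorem arLabel_sink {h : Fin m → ℤ} (hc : (arClock m).IsCut h) {i : Fin m} (hi : Sink h i) :
    arLabel h i = h i - i ∧ arLabel h (i + 1) = h i + i + 2 := by
  have hi2 := i.2
  constructor
  · by_cases h0 : (i : ℕ) = 0
    · rw [h0, arLabel_zero, ← h0, extCut_coe, h0]; simp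
    · obtain ⟨k, hk⟩ : ∃ k, (i : ℕ) = k + 1 := ⟨(i : ℕ) - 1, by omega⟩
      have h1 := hi ⟨k, by omega⟩ (Or.inr hk.symm)
      rw [← extCut_coe h i, ← extCut_of_lt h (by omega), hk] at h1
      rw [← extCut_coe h i, hk]
      have h2 := arLabel_succ hc (k := k) (by omega)
      push_cast
      omega
  · have h2 := arLabel_succ hc hi2
    rw [extCut_coe] at h2
    by_cases hm : (i : ℕ) + 1 < m
    · have h1 := hi ⟨(i : ℕ) + 1, hm⟩ (Or.inl rfl)
      rw [← extCut_of_lt h hm] at h1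
      omega
    · have h1 := extCut_top h (i := i) (by omega)
      omega

theorem extCut_raise (h : Fin m → ℤ) (i : Fin m) {k : ℕ} (hk : k ≠ i)
    (hk' : k ≠ (i : ℕ) + 1) (hkm : k ≤ m) : extCut ((arClock m).raise h i) k = extCut h k := by
  have hi := i.2
  have key : ∀ k, k < m → k ≠ i → extCut ((arClock m).raise h i) k = extCut h k := by
    intro k hk hki
    rw [extCut_of_lt _ hk, extCut_of_lt _ hk, raise_of_ne _ (fun e => hki (congrArg Fin.val e))]
  rcases hkm.lt_or_eq with hlt | rfl
  · exact key k hlt hk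
  · rw [extCut_last i, extCut_last i, key _ (by omega) (by omega)]

/-- The two lines through the tick cross and keep their labels. The exception is the top letter,
where a strand is reflected at the boundary and its label jumps by `2m+2`; this is why labels are
taken modulo `2m+2`. -/
theorem arLabel_raise {h : Fin m → ℤ} (hc : (arClock m).IsCut h) {i : Fin m} (hi : Sink h i) :
    arLabel ((arClock m).raise h i) i = h i + i + 2 ∧
    (2 * m + 2 : ℤ) ∣ arLabel ((arClock m).raise h i) (i + 1) - (h i - i) ∧
    ∀ k : ℕ, k ≠ i → k ≠ (i : ℕ) + 1 → k ≤ m →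
      arLabel ((arClock m).raise h i) k = arLabel h k := by
  have hi2 := i.2
  have hr := hc.raise hi
  have e0 : extCut ((arClock m).raise h i) i = h i + 2 := by
    rw [extCut_coe, raise_self]; rfl
  refine ⟨?_, ?_, fun k h1 h2 hkm => ?_⟩
  · by_cases h0 : (i : ℕ) = 0
    · rw [h0, arLabel_zero, ← h0, e0, h0]; simp
    · obtain ⟨k, hk⟩ : ∃ k, (i : ℕ) = k + 1 := ⟨(i : ℕ) - 1, by omega⟩
      have h1 := hi ⟨k, by omega⟩ (Or.inr hk.symm)
      have h2 := arLabel_succ hr (k := k) (by omega)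
      have h3 := extCut_succ hc (k := k) (by omega)
      rw [← hk, e0, extCut_raise h i (k := k) (by omega) (by omega) (by omega)] at h2
      rw [← hk, extCut_coe] at h3
      rw [← extCut_of_lt h (by omega)] at h1
      omega
  · have h2 := arLabel_succ hr hi2
    rw [e0] at h2
    by_cases hm : (i : ℕ) + 1 < m
    · have h1 := hi ⟨(i : ℕ) + 1, hm⟩ (Or.inl rfl)
      have h3 := extCut_succ hc hi2
      have h4 : extCut ((arClock m).raise h i) (i + 1) = extCut h (i + 1) := by
        rw [extCut_of_lt _ hm, extCut_of_lt _ hm, raise_of_ne]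
        intro e
        have := congrArg Fin.val e
        simp at this
      rw [h4] at h2
      rw [extCut_coe] at h3
      rw [← extCut_of_lt h hm] at h1
      refine ⟨0, ?_⟩
      omega
    · have h1 := extCut_top ((arClock m).raise h i) (i := i) (by omega)
      rw [← extCut_coe ((arClock m).raise h i) i, e0] at h1
      -- Top letter: after its tick the strand next to the virtual letter rises again, one period
      -- further.
      refine ⟨1, ?_⟩
      omega
  · unfold arLabel
    rw [extCut_raise h i h1 h2 hkm]
    by_cases h0 : k = 0
    · subst h0; simp
    · by_cases h3 : k - 1 = (i : ℕ)
      · omega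
      · by_cases h4 : k - 1 = (i : ℕ) + 1
        · rw [h4]
          congr 3
          have hm : (i : ℕ) + 1 < m := by omega
          rw [extCut_of_lt _ hm, extCut_of_lt _ hm, raise_of_ne]
          intro e
          have := congrArg Fin.val e
          simp at this
        · rw [extCut_raise h i h3 h4 (by omega)]

theorem arLabel_mir {h : Fin m → ℤ} (hm : 0 < m) (hc : (arClock m).IsCut h) {k : ℕ} (hk : k ≤ m) :
    (2 * m + 2 : ℤ) ∣ arLabel (mir (m + 1) h) k - arLabel h (m - k) := by
  have key : ∀ k, k < m → extCut (mir (m + 1) h) k = extCut h (m - 1 - k) + m + 1 := by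
    intro k hk
    rw [extCut_of_lt _ hk, extCut_of_lt _ (by omega), mir]
    have : (⟨k, hk⟩ : Fin m).rev = ⟨m - 1 - k, by omega⟩ := by
      ext; rw [Fin.val_rev]; simp; omega
    rw [this]; ring
  have i₀ : Fin m := ⟨0, hm⟩
  by_cases h0 : k = 0
  · subst h0
    obtain ⟨l, rfl⟩ : ∃ l, m = l + 1 := ⟨m - 1, by omega⟩
    have h1 := arLabel_succ hc (k := l) (by omega)
    have h2 := extCut_last i₀ h
    have h3 := key 0 hm
    rw [arLabel_zero, h3]
    simp only [Nat.sub_zero, Nat.add_sub_cancel] at *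
    refine ⟨0, ?_⟩
    push_cast at *
    omega
  · by_cases h1 : k = m
    · subst h1
      obtain ⟨l, rfl⟩ : ∃ l, k = l + 1 := ⟨k - 1, by omega⟩
      have h1 := arLabel_succ ((arClock_isMirror _).isCut hc) (k := l) (by omega)
      have h2 := extCut_last i₀ (mir ((l + 1 : ℕ) + 1 : ℤ) h)
      have h3 := key l (by omega)
      rw [Nat.sub_self, arLabel_zero]
      simp only [Nat.add_sub_cancel, Nat.sub_self] at *
      refine ⟨1, ?_⟩
      push_cast at *
      omega
    · obtain ⟨l, rfl⟩ : ∃ l, k = l + 1 := ⟨k - 1, by omega⟩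
      obtain ⟨p, hp⟩ : ∃ p, m - (l + 1) = p + 1 := ⟨m - (l + 1) - 1, by omega⟩
      have h1 := arLabel_succ ((arClock_isMirror _).isCut hc) (k := l) (by omega)
      have h2 := arLabel_succ hc (k := p) (by omega)
      have h3 := key l (by omega)
      have h4 := key (l + 1) (by omega)
      have e1 : m - 1 - l = p + 1 := by omega
      have e2 : m - 1 - (l + 1) = p := by omega
      have e3 : (m : ℤ) = l + p + 2 := by omega
      rw [e1] at h3
      rw [e2] at h4
      rw [hp]
      rcases extCut_succ hc (k := p) (by omega) with h5 | h5
      · refine ⟨0, ?_⟩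
        omega
      · refine ⟨1, ?_⟩
        omega

theorem sum_count (w : Word m) : ∑ i, w.count i = w.length := by
  induction w with
  | nil => simp
  | cons j w ih =>
    simp only [List.count_cons, Finset.sum_add_distrib, ih, List.length_cons, beq_iff_eq,
      Finset.sum_ite_eq, Finset.mem_univ, if_true]

theorem intCast_zmod_eq {N : ℕ} {a b : ℤ} (h : (N : ℤ) ∣ a - b) : (a : ZMod N) = b :=
  (ZMod.intCast_eq_intCast_iff_dvd_sub b a N).mpr h |>.symm

/-- The labelling of the strands of the Auslander–Reiten heap of type `A_m`. -/
def arLabelling (m : ℕ) (hm : 0 < m) : Labelling (arClock m) (m + 1) where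
  L := ZMod (2 * m + 2)
  lab h j := (arLabel h j : ℤ)
  inj h hc := by
    have key : ∀ j l : Fin (m + 1), (j : ℕ) < l →
        ((arLabel h j : ℤ) : ZMod (2 * m + 2)) ≠ (arLabel h l : ℤ) := by
      intro j l hjl e
      have hl := l.2
      obtain ⟨h1, h2⟩ := arLabel_ne hc hjl (by omega)
      rw [ZMod.intCast_eq_intCast_iff_dvd_sub] at e
      have := Int.eq_zero_of_abs_lt_dvd e (by rw [abs_sub_comm]; push_cast; exact h2)
      omega
    intro j l e
    by_contra hne
    rcases lt_or_gt_of_ne (fun e => hne (Fin.ext e) : (j : ℕ) ≠ l) with hlt | hlt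
    · exact key j l hlt e
    · exact key l j hlt e.symm
  raise h i hc hi j := by
    obtain ⟨h1, h2, h3⟩ := arLabel_raise hc hi
    obtain ⟨h4, h5⟩ := arLabel_sink hc hi
    by_cases e1 : j = i.castSucc
    · subst e1
      simp [h1, h5]
    · by_cases e2 : j = i.succ
      · subst e2
        rw [simpleRefl_succ]
        apply intCast_zmod_eq
        simp only [Fin.val_succ, Fin.val_castSucc, h4]
        exact_mod_cast h2
      · rw [simpleRefl, Equiv.swap_apply_of_ne_of_ne e1 e2, h3]
        · exact fun e => e1 (Fin.ext e)
        · exact fun e => e2 (Fin.ext e)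
        · have := j.2; omega
  mirror h hc j := by
    have hj := j.2
    apply intCast_zmod_eq
    have e : (j.rev : ℕ) = m - j := by rw [Fin.val_rev]; omega
    rw [e]
    exact_mod_cast arLabel_mir hm hc (k := j) (by omega)
  congr g h i hg hh hi hi' e := by
    obtain ⟨h1, h2⟩ := arLabel_sink hg hi
    obtain ⟨h3, h4⟩ := arLabel_sink hh hi'
    simp [h1, h2, h3, h4, e]
  isMirror := arClock_isMirror m
  lt_mir h hc i := by
    have h1 := arCut_lipschitz hc i i.rev
    have h2 := Fin.val_rev i
    have h3 := i.2
    have h4 : |(i : ℤ) - (i.rev : ℕ)| ≤ m - 1 := abs_le.mpr ⟨by omega, by omega⟩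
    simp only [mir]
    omega
  length h w hc e := by
    have h1 : ∀ i, 2 * (w.count i : ℤ) = h i.rev + (m + 1) - h i := by
      intro i
      have := congrFun e i
      simp only [run, mir, arClock] at this
      omega
    have h2 : ∑ i : Fin m, h i.rev = ∑ i, h i := Equiv.sum_comp Fin.revPerm h
    have h3 : ∑ i : Fin m, 2 * (w.count i : ℤ) = m * (m + 1) := by
      rw [Finset.sum_congr rfl fun i _ => h1 i, Finset.sum_sub_distrib, Finset.sum_add_distrib, h2]
      simp
    rw [← Finset.mul_sum] at h3
    have h4 := sum_count w
    have h5 := two_mul_card_posRoot m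
    have h6 : (∑ i, (w.count i : ℤ)) = w.length := by exact_mod_cast h4
    rw [h6] at h3
    have h7 : 2 * w.length = m * (m + 1) := by exact_mod_cast h3
    omega

end TwistedAR

namespace TwistedAR

open Clock

variable {n : ℕ}

/-! ### The twisted heap of type `A_{2n+1}` -/

/-- The clock of the twisted Auslander–Reiten quivers of type `A_{2n+1}`, with the unit of time
equal to half a unit of coordinates. -/
def twClock (n : ℕ) : Clock (2 * n + 1) where
  step i := if (i : ℕ) = n then 2 else 4
  off i := if (i : ℕ) < n then 2 * i else if (i : ℕ) = n then 1 else 2 * i + 2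
  step_pos i := by split_ifs <;> norm_num
  no_tie i j hij a b := by
    unfold Adj at hij
    split_ifs <;> omega

theorem twClock_step_mid : (twClock n).step (mid n) = 2 := if_pos rfl

theorem twClock_step {i : Fin (2 * n + 1)} (hi : (i : ℕ) ≠ n) : (twClock n).step i = 4 := if_neg hi

theorem twClock_onTime {i : Fin (2 * n + 1)} {t : ℤ} (ht : (twClock n).OnTime i t) :
    ((i : ℕ) < n ∧ (t - 2 * i) % 4 = 0) ∨ ((i : ℕ) = n ∧ t % 2 = 1) ∨
      (n < (i : ℕ) ∧ (t - 2 * i - 2) % 4 = 0) := by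
  obtain ⟨x, hx⟩ := ht
  simp only [twClock] at hx
  split_ifs at hx <;> omega

theorem twClock_onTime_of {i : Fin (2 * n + 1)} {t : ℤ}
    (ht : ((i : ℕ) < n ∧ (t - 2 * i) % 4 = 0) ∨ ((i : ℕ) = n ∧ t % 2 = 1) ∨
      (n < (i : ℕ) ∧ (t - 2 * i - 2) % 4 = 0)) : (twClock n).OnTime i t := by
  rw [OnTime]
  simp only [twClock]
  rcases ht with ⟨h1, h2⟩ | ⟨h1, h2⟩ | ⟨h1, h2⟩
  · rw [if_neg (by omega), if_pos h1]; omega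
  · rw [if_pos h1, if_neg (by omega), if_pos h1]; omega
  · rw [if_neg (by omega), if_neg (by omega), if_neg (by omega)]; omega

/-- The side letters `i` and `i^*` tick at times offset by 2 modulo 4, and the middle letter at all
odd times. Two such mirrors compose to a translation by a multiple of 4. -/
theorem twClock_isMirror {d : ℤ} (hd : d % 4 = 2) : (twClock n).IsMirror d := fun i => by
  have h1 := Fin.val_rev i
  have h2 := i.2
  simp only [twClock]
  constructor
  · split_ifs <;> first | rfl | omega
  · split_ifs <;> omega

theorem twClock_isMirror_window : (twClock n).IsMirror (4 * n + 2) := twClock_isMirror (by omega)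

theorem twClock_isSymm : (twClock n).IsSymm := fun i t ht => by
  have := twClock_onTime ht
  apply twClock_onTime_of
  omega

/-- The letters of type `A_{2n}` as the letters of type `A_{2n+1}` different from the middle one. -/
def emb (n : ℕ) (i : Fin (2 * n)) : Fin (2 * n + 1) :=
  ⟨if (i : ℕ) < n then i else i + 1, by have := i.2; split_ifs <;> omega⟩

theorem emb_val (i : Fin (2 * n)) :
    ((emb n i : ℕ) = i ∧ (i : ℕ) < n) ∨ ((emb n i : ℕ) = i + 1 ∧ n ≤ (i : ℕ)) := by
  unfold emb
  simp only
  split_ifs <;> omega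

theorem emb_ne (i : Fin (2 * n)) : (emb n i : ℕ) ≠ n := by
  have := emb_val i
  omega

theorem emb_ne_mid (i : Fin (2 * n)) : emb n i ≠ mid n := fun e => emb_ne i (congrArg Fin.val e)

theorem emb_injective : Function.Injective (emb n) := fun i j e => by
  have h1 := emb_val i
  have h2 := emb_val j
  have h3 := congrArg Fin.val e
  ext
  omega

theorem emb_rev (i : Fin (2 * n)) : emb n i.rev = (emb n i).rev := by
  have h1 := emb_val i
  have h2 := emb_val i.rev
  have h3 := Fin.val_rev i
  have h4 := Fin.val_rev (emb n i)
  have h5 := i.2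
  ext
  omega

theorem exists_emb {i : Fin (2 * n + 1)} (hi : i ≠ mid n) : ∃ j, i = emb n j := by
  have h1 : (i : ℕ) ≠ n := fun e => hi (Fin.ext e)
  have h2 := i.2
  by_cases h : (i : ℕ) < n
  · exact ⟨⟨i, by omega⟩, Fin.ext (by simp [emb, h])⟩
  · refine ⟨⟨(i : ℕ) - 1, by omega⟩, Fin.ext ?_⟩
    have : ¬ (i : ℕ) - 1 < n := by omega
    simp only [emb, this, if_false]
    omega

theorem projLetter_emb (j : Fin (2 * n)) : projLetter n (emb n j) = some j := by
  rcases emb_val j with ⟨h1, h2⟩ | ⟨h1, h2⟩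
  · simp [projLetter, h1, h2]
  · have : ¬ (j : ℕ) + 1 < n := by omega
    have h3 : n < (j : ℕ) + 1 := by omega
    simp [projLetter, h1, this, h3]

theorem projLetter_mid : projLetter n (mid n) = none := by simp [projLetter, mid]

/-! ### Projection of twisted cuts -/

/-- The cut of type `A_{2n}` under a cut of type `A_{2n+1}`. -/
def arCut (h : Fin (2 * n + 1) → ℤ) : Fin (2 * n) → ℤ := fun i => h (emb n i) / 2

theorem two_mul_arCut {h : Fin (2 * n + 1) → ℤ} (hc : (twClock n).IsCut h) (i : Fin (2 * n)) :
    2 * arCut h i = h (emb n i) := by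
  have h1 := twClock_onTime (hc.onTime (emb n i))
  have h2 := emb_ne i
  unfold arCut
  omega

/-- The relations between the values of a twisted cut around the middle letter. -/
theorem twCut_mid {h : Fin (2 * n + 1) → ℤ} (hc : (twClock n).IsCut h) {i : Fin (2 * n + 1)}
    (hi : Adj (mid n) i) : h i ≤ h (mid n) + 3 ∧ h (mid n) ≤ h i + 1 := by
  have h1 := hc.lt _ _ hi
  have h2 := hc.lt _ _ hi.symm
  have h3 : (i : ℕ) ≠ n := fun e => hi.ne (Fin.ext e.symm)
  rw [twClock_step_mid] at h1
  rw [twClock_step h3] at h2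
  omega

theorem twCut_adj {h : Fin (2 * n + 1) → ℤ} (hc : (twClock n).IsCut h) {i j : Fin (2 * n)}
    (hij : Adj i j) : h (emb n i) ≤ h (emb n j) + 2 ∧
      (Sink h (emb n i) → h (emb n i) < h (emb n j)) := by
  have hi := emb_val i
  have hj := emb_val j
  have ti := twClock_onTime (hc.onTime (emb n i))
  have tj := twClock_onTime (hc.onTime (emb n j))
  have hij' := hij
  unfold Adj at hij
  by_cases hA : Adj (emb n i) (emb n j)
  · have h1 := hc.lt _ _ hA
    rw [twClock_step (emb_ne i)] at h1
    refine ⟨by omega, fun hs => hs _ hA⟩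
  -- Adjacent only after removal of the middle letter: the bounds through the middle give a
  -- difference of at most 4, and it is 2 modulo 4.
  · have hmi : Adj (mid n) (emb n i) := by unfold Adj at *; simp only [mid]; omega
    have hmj : Adj (mid n) (emb n j) := by unfold Adj at *; simp only [mid]; omega
    have h1 := twCut_mid hc hmi
    have h2 := twCut_mid hc hmj
    refine ⟨by omega, fun hs => ?_⟩
    have := hs _ hmi.symm
    omega

theorem arCut_isCut {h : Fin (2 * n + 1) → ℤ} (hc : (twClock n).IsCut h) :
    (arClock (2 * n)).IsCut (arCut h) where
  onTime i := by
    have h1 := two_mul_arCut hc i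
    have h2 := twClock_onTime (hc.onTime (emb n i))
    have h3 := emb_val i
    rw [OnTime]
    simp only [arClock]
    omega
  lt i j hij := by
    have h1 := two_mul_arCut hc i
    have h2 := two_mul_arCut hc j
    have h3 := (twCut_adj hc hij).1
    simp only [arClock]
    omega

theorem arCut_sink {h : Fin (2 * n + 1) → ℤ} (hc : (twClock n).IsCut h) {i : Fin (2 * n)}
    (hi : Sink h (emb n i)) : Sink (arCut h) i := fun j hij => by
  have h1 := two_mul_arCut hc i
  have h2 := two_mul_arCut hc j
  have h3 := (twCut_adj hc hij).2 hi
  omega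

theorem arCut_raise_mid (h : Fin (2 * n + 1) → ℤ) :
    arCut ((twClock n).raise h (mid n)) = arCut h := by
  funext i
  rw [arCut, raise_of_ne _ (emb_ne_mid i), arCut]

theorem arCut_raise (h : Fin (2 * n + 1) → ℤ) (i : Fin (2 * n)) :
    arCut ((twClock n).raise h (emb n i)) = (arClock (2 * n)).raise (arCut h) i := by
  funext j
  by_cases hj : j = i
  · subst hj
    rw [raise_self, arCut, raise_self, twClock_step (emb_ne j), arCut]
    simp only [arClock]
    omega
  · rw [raise_of_ne _ hj, arCut, raise_of_ne _ (fun e => hj (emb_injective e)), arCut]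

theorem arCut_mir (h : Fin (2 * n + 1) → ℤ) :
    arCut (mir (4 * n + 2) h) = mir ((2 * n : ℕ) + 1) (arCut h) := by
  funext i
  simp only [arCut, mir, emb_rev]
  push_cast
  omega

theorem projWord_cons_emb (i : Fin (2 * n)) (w : Word (2 * n + 1)) :
    projWord n (emb n i :: w) = i :: projWord n w := by
  simp [projWord, projLetter_emb]

theorem projWord_cons_mid (w : Word (2 * n + 1)) : projWord n (mid n :: w) = projWord n w := by
  simp [projWord, projLetter_mid]

theorem projWord_append (u v : Word (2 * n + 1)) :
    projWord n (u ++ v) = projWord n u ++ projWord n v := by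
  simp [projWord]

/-- A middle tick leaves the projected cut unchanged, and a side tick projects to a legal tick.
Hence deleting middle letters preserves legality and end points. -/
theorem legal_projWord {h : Fin (2 * n + 1) → ℤ} (hc : (twClock n).IsCut h)
    {w : Word (2 * n + 1)} (hw : (twClock n).Legal h w) :
    (arClock (2 * n)).Legal (arCut h) (projWord n w) ∧
      (arClock (2 * n)).run (arCut h) (projWord n w) = arCut ((twClock n).run h w) := by
  induction w generalizing h with
  | nil => simp [projWord, Legal]
  | cons i w ih =>
    have := ih (hc.raise hw.1) hw.2
    by_cases hi : i = mid n
    · subst hi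
      rw [arCut_raise_mid] at this
      rwa [projWord_cons_mid, run_cons]
    · obtain ⟨j, rfl⟩ := exists_emb hi
      rw [arCut_raise] at this
      rw [projWord_cons_emb, run_cons, run_cons]
      exact ⟨⟨arCut_sink hc hw.1, this.1⟩, this.2⟩

theorem projWord_mem_window {h : Fin (2 * n + 1) → ℤ} (hc : (twClock n).IsCut h)
    {w : Word (2 * n + 1)} (hw : w ∈ (twClock n).window (4 * n + 2) h) :
    projWord n w ∈ (arClock (2 * n)).window ((2 * n : ℕ) + 1) (arCut h) := by
  obtain ⟨h1, h2⟩ := legal_projWord hc hw.1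
  exact ⟨h1, by rw [h2, hw.2, arCut_mir]⟩

/-! ### Strands of the twisted heap -/

/-- The height of the strand which oscillates around the middle letter. -/
def midStrand (h : Fin (2 * n + 1) → ℤ) : ℕ := if (h (mid n) - 2 * n - 1) % 4 = 0 then n else n + 1

/-- The height in type `A_{2n}` of a strand of type `A_{2n+1}` after removal of the oscillating
strand. -/
def collapse (n : ℕ) (j : Fin (2 * n + 1 + 1)) : Fin (2 * n + 1) :=
  ⟨if (j : ℕ) ≤ n then j else j - 1, by have := j.2; split_ifs <;> omega⟩

theorem collapse_val (j : Fin (2 * n + 1 + 1)) :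
    ((collapse n j : ℕ) = j ∧ (j : ℕ) ≤ n) ∨ ((collapse n j : ℕ) + 1 = j ∧ n < (j : ℕ)) := by
  unfold collapse
  simp only
  split_ifs <;> omega

theorem simpleRefl_val {m : ℕ} (i : Fin m) (x : Fin (m + 1)) :
    ((x : ℕ) = i ∧ (simpleRefl i x : ℕ) = i + 1) ∨ ((x : ℕ) = i + 1 ∧ (simpleRefl i x : ℕ) = i) ∨
      ((x : ℕ) ≠ i ∧ (x : ℕ) ≠ i + 1 ∧ (simpleRefl i x : ℕ) = x) := by
  unfold simpleRefl
  rw [Equiv.swap_apply_def]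
  simp only [Fin.ext_iff, Fin.val_castSucc, Fin.val_succ]
  split_ifs <;> simp <;> omega

variable (n) in
/-- The label of the strand at a height at a twisted cut. -/
def twLabel (hn : 0 < 2 * n) (h : Fin (2 * n + 1) → ℤ) (j : Fin (2 * n + 1 + 1)) :
    Option (arLabelling (2 * n) hn).L :=
  if (j : ℕ) = midStrand h then none
  else some ((arLabelling (2 * n) hn).lab (arCut h) (collapse n j))

theorem midStrand_cases (h : Fin (2 * n + 1) → ℤ) :
    ((h (mid n) - 2 * n - 1) % 4 = 0 ∧ midStrand h = n) ∨
      ((h (mid n) - 2 * n - 1) % 4 ≠ 0 ∧ midStrand h = n + 1) := by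
  unfold midStrand
  split_ifs with h1 <;> simp [h1]

theorem twLabel_injective (hn : 0 < 2 * n) {h : Fin (2 * n + 1) → ℤ} (hc : (twClock n).IsCut h) :
    Function.Injective (twLabel n hn h) := by
  intro j l e
  have hm := midStrand_cases h
  have hj := collapse_val j
  have hl := collapse_val l
  unfold twLabel at e
  ext
  split_ifs at e with h1 h2 h2
  · omega
  · have := congrArg Fin.val ((arLabelling (2 * n) hn).inj _ (arCut_isCut hc) (Option.some.inj e))
    omega

/-- The oscillating strand takes no part in side crossings. Next to the middle, a sink `i` forces
the middle tick to follow one unit later, and its residue modulo 4 puts that strand on the far side.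
-/
theorem sink_emb_midStrand {h : Fin (2 * n + 1) → ℤ} (hc : (twClock n).IsCut h) {i : Fin (2 * n)}
    (hi : Sink h (emb n i)) :
    midStrand h ≠ emb n i ∧ midStrand h ≠ (emb n i : ℕ) + 1 := by
  have hm := midStrand_cases h
  have he := emb_val i
  have tm := twClock_onTime (hc.onTime (mid n))
  have ti := twClock_onTime (hc.onTime (emb n i))
  have hv : ((mid n : Fin (2 * n + 1)) : ℕ) = n := rfl
  by_cases hA : Adj (mid n) (emb n i)
  · have h1 := twCut_mid hc hA
    have h2 := hi _ hA.symm
    unfold Adj at hA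
    omega
  · unfold Adj at hA
    omega

theorem twLabel_raise (hn : 0 < 2 * n) {h : Fin (2 * n + 1) → ℤ} (hc : (twClock n).IsCut h)
    {i : Fin (2 * n + 1)} (hi : Sink h i) (j : Fin (2 * n + 1 + 1)) :
    twLabel n hn ((twClock n).raise h i) j = twLabel n hn h (simpleRefl i j) := by
  have hs := simpleRefl_val i j
  have hj := collapse_val j
  have hj' := collapse_val (simpleRefl i j)
  have hm := midStrand_cases h
  have hm' := midStrand_cases ((twClock n).raise h i)
  unfold twLabel
  by_cases hmi : i = mid n
  · subst hmi
    have tm := twClock_onTime (hc.onTime (mid n))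
    have hv : ((mid n : Fin (2 * n + 1)) : ℕ) = n := rfl
    -- A middle tick shifts the residue by 2, which moves the oscillating strand across while the
    -- projected strands stay put.
    rw [raise_self, twClock_step_mid] at hm'
    by_cases h1 : (j : ℕ) = midStrand ((twClock n).raise h (mid n))
    · rw [if_pos h1, if_pos (by omega)]
    · rw [if_neg h1, if_neg (by omega), arCut_raise_mid]
      congr 2
      ext
      omega
  · obtain ⟨k, rfl⟩ := exists_emb hmi
    have h2 := sink_emb_midStrand hc hi
    have hk := emb_val k
    rw [raise_of_ne _ (Ne.symm hmi)] at hm'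
    by_cases h1 : (j : ℕ) = midStrand ((twClock n).raise h (emb n k))
    · rw [if_pos h1, if_pos (by omega)]
    · rw [if_neg h1, if_neg (by omega), arCut_raise,
        (arLabelling (2 * n) hn).raise _ _ (arCut_isCut hc) (arCut_sink hc hi)]
      congr 2
      have hs' := simpleRefl_val k (collapse n j)
      ext
      omega

theorem twLabel_mirror (hn : 0 < 2 * n) {h : Fin (2 * n + 1) → ℤ} (hc : (twClock n).IsCut h)
    (j : Fin (2 * n + 1 + 1)) :
    twLabel n hn (mir (4 * n + 2) h) j = twLabel n hn h j.rev := by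
  have hj := collapse_val j
  have hj' := collapse_val j.rev
  have hm := midStrand_cases h
  have hm' := midStrand_cases (mir (4 * n + 2) h)
  have hr := Fin.val_rev j
  have hlt := j.2
  have tm := twClock_onTime (hc.onTime (mid n))
  have hv : ((mid n : Fin (2 * n + 1)) : ℕ) = n := rfl
  have hmr : (mid n).rev = mid n := by ext; rw [Fin.val_rev]; simp [mid]; omega
  have hg : mir (4 * n + 2) h (mid n) = h (mid n) + (4 * n + 2) := by rw [mir, hmr]
  -- The length `4n+2` of the window is 2 modulo 4, so the oscillating strand changes sides, in
  -- accordance with `Fin.rev` exchanging the heights `n` and `n+1`.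
  rw [hg] at hm'
  unfold twLabel
  by_cases h1 : (j : ℕ) = midStrand (mir (4 * n + 2) h)
  · rw [if_pos h1, if_pos (by omega)]
  · rw [if_neg h1, if_neg (by omega), arCut_mir,
      (arLabelling (2 * n) hn).mirror _ (arCut_isCut hc)]
    congr 2
    have := Fin.val_rev (collapse n j)
    ext
    omega

/-- When the middle is a sink, its two neighbours come 1 and 3 units later, in an order fixed by the
residue of the tick. This determines the slope at height `n`, and hence the strand that meets the
oscillating one. -/
theorem arLabel_mid {h : Fin (2 * n + 1) → ℤ} (hn : 1 ≤ n) (hc : (twClock n).IsCut h)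
    (hi : Sink h (mid n)) :
    2 * arLabel (arCut h) n = if (h (mid n) - 2 * n - 1) % 4 = 0 then h (mid n) + 2 * n + 3
      else h (mid n) + 1 - 2 * n := by
  obtain ⟨k, rfl⟩ : ∃ k, n = k + 1 := ⟨n - 1, by omega⟩
  have hk : k < 2 * (k + 1) := by omega
  have hk1 : k + 1 < 2 * (k + 1) := by omega
  have h1 := arLabel_succ (arCut_isCut hc) hk
  have ha := two_mul_arCut hc ⟨k, hk⟩
  have hb := two_mul_arCut hc ⟨k + 1, hk1⟩
  have ea := emb_val (n := k + 1) ⟨k, hk⟩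
  have eb := emb_val (n := k + 1) ⟨k + 1, hk1⟩
  have ta := twClock_onTime (hc.onTime (emb (k + 1) ⟨k, hk⟩))
  have tb := twClock_onTime (hc.onTime (emb (k + 1) ⟨k + 1, hk1⟩))
  have tm := twClock_onTime (hc.onTime (mid (k + 1)))
  have hv : ((mid (k + 1) : Fin (2 * (k + 1) + 1)) : ℕ) = k + 1 := rfl
  simp only at ea eb
  have ma : Adj (mid (k + 1)) (emb (k + 1) ⟨k, hk⟩) := by unfold Adj; omega
  have mb : Adj (mid (k + 1)) (emb (k + 1) ⟨k + 1, hk1⟩) := by unfold Adj; omega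
  have sa := hi _ ma
  have sb := hi _ mb
  have ca := twCut_mid hc ma
  have cb := twCut_mid hc mb
  rw [extCut_of_lt _ hk, extCut_of_lt _ hk1] at h1
  split_ifs <;> omega

theorem twLabel_congr (hn : 1 ≤ n) (hn' : 0 < 2 * n) {g h : Fin (2 * n + 1) → ℤ}
    (hg : (twClock n).IsCut g) (hh : (twClock n).IsCut h) {i : Fin (2 * n + 1)} (hi : Sink g i)
    (hi' : Sink h i) (e : g i = h i) :
    twLabel n hn' g i.castSucc = twLabel n hn' h i.castSucc ∧
      twLabel n hn' g i.succ = twLabel n hn' h i.succ := by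
  by_cases hmi : i = mid n
  · subst hmi
    have hm : midStrand g = midStrand h := by unfold midStrand; rw [e]
    have hl : arLabel (arCut g) n = arLabel (arCut h) n := by
      have h1 := arLabel_mid hn hg hi
      have h2 := arLabel_mid hn hh hi'
      rw [e] at h1
      omega
    have hc1 : (collapse n (mid n).castSucc : ℕ) = n := by
      have := collapse_val (mid n).castSucc
      simp only [mid, Fin.val_castSucc] at *
      omega
    have hc2 : (collapse n (mid n).succ : ℕ) = n := by
      have := collapse_val (mid n).succ
      simp only [mid, Fin.val_succ] at *
      omega
    unfold twLabel
    simp only [hm, arLabelling, hc1, hc2, hl, and_self]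
  · obtain ⟨k, rfl⟩ := exists_emb hmi
    have h1 := sink_emb_midStrand hg hi
    have h2 := sink_emb_midStrand hh hi'
    have hk := emb_val k
    have hc1 : collapse n (emb n k).castSucc = k.castSucc := by
      have := collapse_val (emb n k).castSucc
      ext
      simp only [Fin.val_castSucc] at *
      omega
    have hc2 : collapse n (emb n k).succ = k.succ := by
      have := collapse_val (emb n k).succ
      ext
      simp only [Fin.val_succ] at *
      omega
    have h3 := (arLabelling (2 * n) hn').congr _ _ k (arCut_isCut hg) (arCut_isCut hh)
      (arCut_sink hg hi) (arCut_sink hh hi') (by rw [arCut, arCut, e])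
    unfold twLabel
    simp only [Fin.val_castSucc, Fin.val_succ]
    rw [if_neg (Ne.symm h1.1), if_neg (Ne.symm h2.1), if_neg (Ne.symm h1.2), if_neg (Ne.symm h2.2),
      hc1, hc2, h3.1, h3.2]
    exact ⟨rfl, rfl⟩

theorem twCut_lipschitz {h : Fin (2 * n + 1) → ℤ} (hc : (twClock n).IsCut h) (i j : Fin (2 * n)) :
    h (emb n i) - h (emb n j) ≤ 2 * |(i : ℤ) - j| := by
  have h1 := two_mul_arCut hc i
  have h2 := two_mul_arCut hc j
  have h3 := arCut_lipschitz (arCut_isCut hc) i j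
  omega

theorem mid_rev : (mid n).rev = mid n := by
  ext
  rw [Fin.val_rev]
  simp [mid]
  omega

/-- The labelling of the strands of the twisted heap of type `A_{2n+1}`. -/
def twLabelling (n : ℕ) (hn : 1 ≤ n) : Labelling (twClock n) (4 * n + 2) where
  L := Option (arLabelling (2 * n) (by omega)).L
  lab := twLabel n (by omega)
  inj h hc := twLabel_injective _ hc
  raise h i hc hi j := twLabel_raise _ hc hi j
  mirror h hc j := twLabel_mirror _ hc j
  congr g h i hg hh hi hi' e := twLabel_congr hn _ hg hh hi hi' e
  isMirror := twClock_isMirror_window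
  lt_mir h hc i := by
    by_cases hmi : i = mid n
    · subst hmi
      simp only [mir, mid_rev]
      omega
    · obtain ⟨k, rfl⟩ := exists_emb hmi
      have h1 := twCut_lipschitz hc k k.rev
      have h2 := Fin.val_rev k
      have h3 := k.2
      have h4 : |(k : ℤ) - (k.rev : ℕ)| ≤ 2 * n - 1 := abs_le.mpr ⟨by omega, by omega⟩
      rw [emb_rev] at h1
      simp only [mir]
      omega
  length h w hc e := by
    have h1 : ∀ i, 4 * (w.count i : ℤ) = h i.rev - h i + (4 * n + 2) +
        if i = mid n then (4 * n + 2 : ℤ) else 0 := by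
      intro i
      have := congrFun e i
      simp only [run, mir] at this
      by_cases hi : i = mid n
      · subst hi
        rw [twClock_step_mid, mid_rev] at this
        rw [if_pos rfl, mid_rev]
        omega
      · rw [twClock_step (fun h => hi (Fin.ext h))] at this
        rw [if_neg hi]
        omega
    have h2 : ∑ i : Fin (2 * n + 1), h i.rev = ∑ i, h i := Equiv.sum_comp Fin.revPerm h
    have h3 : ∑ i : Fin (2 * n + 1), 4 * (w.count i : ℤ) = (2 * n + 2) * (4 * n + 2) := by
      rw [Finset.sum_congr rfl fun i _ => h1 i, Finset.sum_add_distrib, Finset.sum_add_distrib,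
        Finset.sum_sub_distrib, h2]
      simp
      ring
    rw [← Finset.mul_sum] at h3
    have h4 := sum_count w
    have h5 := two_mul_card_posRoot (2 * n + 1)
    have h6 : (∑ i, (w.count i : ℤ)) = w.length := by exact_mod_cast h4
    rw [h6] at h3
    have h7 : 4 * w.length = (2 * n + 2) * (4 * n + 2) := by exact_mod_cast h3
    have h8 : 4 * w.length = 4 * Fintype.card (PosRoot (2 * n + 1)) := by
      rw [h7]
      calc (2 * n + 2) * (4 * n + 2) = 2 * ((2 * n + 1) * (2 * n + 1 + 1)) := by ring
        _ = _ := by rw [← h5]; ring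
    omega

end TwistedAR

namespace TwistedAR

open Clock

variable {n : ℕ}

/-! ### Twisted adapted classes are windows -/

/-- The cut at which the window of `baseWord` starts. -/
def baseCut (n : ℕ) (i : Fin (2 * n + 1)) : ℤ :=
  if (i : ℕ) < n then 2 * i else if (i : ℕ) = n then 2 * n - 1 else 2 * (2 * n - i) + 2

theorem baseCut_cases (i : Fin (2 * n + 1)) : ((i : ℕ) < n ∧ baseCut n i = 2 * i) ∨
    ((i : ℕ) = n ∧ baseCut n i = 2 * n - 1) ∨
    (n < (i : ℕ) ∧ baseCut n i = 2 * (2 * n - i) + 2) := by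
  unfold baseCut
  split_ifs <;> omega

theorem twClock_step_cases (i : Fin (2 * n + 1)) : ((i : ℕ) = n ∧ (twClock n).step i = 2) ∨
    ((i : ℕ) ≠ n ∧ (twClock n).step i = 4) := by
  simp only [twClock]
  split_ifs <;> simp_all

theorem baseCut_isCut : (twClock n).IsCut (baseCut n) where
  onTime i := by
    have h1 := baseCut_cases i
    apply twClock_onTime_of
    omega
  lt i j hij := by
    have h1 := baseCut_cases i
    have h2 := baseCut_cases j
    have h3 := twClock_step_cases i
    unfold Adj at hij
    omega

theorem baseBlock_take (k : ℕ) (hk : k ≤ n + 1) :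
    (twClock n).Legal (baseCut n)
      (((List.finRange (n + 1)).map fun i => i.castLE (by omega)).take k) ∧
    ∀ i, (twClock n).run (baseCut n)
      (((List.finRange (n + 1)).map fun i => i.castLE (by omega)).take k) i =
      baseCut n i + if (i : ℕ) < k then (twClock n).step i else 0 := by
  induction k with
  | zero => simp [Legal]
  | succ k ih =>
    obtain ⟨h1, h2⟩ := ih (by omega)
    have hget : ((List.finRange (n + 1)).map fun i => i.castLE (by omega : n + 1 ≤ 2 * n + 1))[k]? =
        some (⟨k, by omega⟩ : Fin (2 * n + 1)) := by
      simp [show k < n + 1 by omega]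
    rw [take_succ_eq hget, legal_concat, run_concat]
    refine ⟨⟨h1, fun j hj => ?_⟩, fun i => ?_⟩
    · rw [h2, h2]
      have h3 := baseCut_cases (n := n) ⟨k, by omega⟩
      have h4 := baseCut_cases j
      have h5 := twClock_step_cases j
      unfold Adj at hj
      simp only [lt_self_iff_false, if_false] at *
      split_ifs <;> omega
    · by_cases hi : i = ⟨k, by omega⟩
      · subst hi
        rw [raise_self, h2]
        simp
      · rw [raise_of_ne _ hi, h2]
        have : (i : ℕ) ≠ k := fun e => hi (Fin.ext e)
        congr 1
        split_ifs <;> first | rfl | omega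

/-- One factor `1 2 ⋯ n+1` moves the base cut to its mirror image with shift 2, so the alternating
factors of `baseWord` iterate a single symmetry of the clock. -/
theorem baseBlock_legal :
    (twClock n).Legal (baseCut n) ((List.finRange (n + 1)).map fun i => i.castLE (by omega)) ∧
    (twClock n).run (baseCut n) ((List.finRange (n + 1)).map fun i => i.castLE (by omega)) =
      mir 2 (baseCut n) := by
  have h := baseBlock_take (n := n) (n + 1) le_rfl
  rw [List.take_of_length_le (by simp)] at h
  refine ⟨h.1, funext fun i => ?_⟩
  rw [h.2]
  have h1 := baseCut_cases i
  have h2 := baseCut_cases i.rev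
  have h3 := Fin.val_rev i
  have h4 := twClock_step_cases i
  have h5 := i.2
  simp only [mir]
  split_ifs <;> omega

theorem legal_mir_iterate {m : ℕ} {K : Clock m} {d : ℤ} (hd : K.IsMirror d) (k : ℕ)
    (h : Fin m → ℤ) (w : Word m) :
    (K.Legal ((mir d)^[k] h) (w.map Fin.rev^[k]) ↔ K.Legal h w) ∧
      K.run ((mir d)^[k] h) (w.map Fin.rev^[k]) = (mir d)^[k] (K.run h w) := by
  induction k with
  | zero => simp
  | succ k ih =>
    have e : w.map Fin.rev^[k + 1] = (w.map Fin.rev^[k]).map Fin.rev := by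
      rw [List.map_map, Function.iterate_succ']
    rw [e, Function.iterate_succ_apply', Function.iterate_succ_apply', legal_mir hd, run_mir hd,
      ih.2]
    exact ⟨ih.1, rfl⟩

theorem mir_iterate_even {m : ℕ} (h : Fin m → ℤ) (k : ℕ) :
    (mir 2)^[2 * k] h = fun i => h i + 4 * k := by
  induction k with
  | zero => simp
  | succ k ih =>
    rw [show 2 * (k + 1) = 2 * k + 1 + 1 by ring, Function.iterate_succ_apply',
      Function.iterate_succ_apply', ih]
    funext i
    simp [mir]
    ring

theorem baseWord_mem_window : baseWord n ∈ (twClock n).window (4 * n + 2) (baseCut n) := by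
  have hd : (twClock n).IsMirror 2 := twClock_isMirror rfl
  have key : ∀ k, (twClock n).Legal (baseCut n) ((List.range k).flatMap fun k =>
      (List.finRange (n + 1)).map fun i => Fin.rev^[k] (i.castLE (by omega))) ∧
      (twClock n).run (baseCut n) ((List.range k).flatMap fun k =>
        (List.finRange (n + 1)).map fun i => Fin.rev^[k] (i.castLE (by omega))) =
      (mir 2)^[k] (baseCut n) := by
    intro k
    induction k with
    | zero => simp [Legal]
    | succ k ih =>
      have h1 := legal_mir_iterate hd k (baseCut n)
        ((List.finRange (n + 1)).map fun i => i.castLE (by omega))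
      rw [List.map_map, baseBlock_legal.2] at h1
      rw [List.range_succ, List.flatMap_append, legal_append, run_append, ih.2,
        List.flatMap_singleton]
      exact ⟨⟨ih.1, h1.1.mpr baseBlock_legal.1⟩, by
        rw [Function.iterate_succ_apply]; exact h1.2⟩
  refine ⟨(key (2 * n + 1)).1, (key (2 * n + 1)).2.trans ?_⟩
  -- The `2n+1` mirrors amount to a translation by `4n` followed by one mirror with shift 2.
  rw [Function.iterate_succ_apply', mir_iterate_even]
  funext i
  simp [mir]
  ring

/-- Every twisted adapted class is the window of a cut. -/
theorem exists_window_of_mem_twistedCluster (hn : 1 ≤ n) {C : Set (Word (2 * n + 1))}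
    (hC : C ∈ twistedCluster n) :
    ∃ h, (twClock n).IsCut h ∧ C = (twClock n).window (4 * n + 2) h := by
  induction hC with
  | refl => exact ⟨_, baseCut_isCut, commClass_eq_window baseWord_mem_window⟩
  | tail _ hstep ih =>
    obtain ⟨h, hc, rfl⟩ := ih
    obtain ⟨i, rfl | rfl⟩ := hstep
    · rcases (twLabelling n hn).reflRight_window i with e | ⟨hi, e⟩
      exacts [⟨h, hc, e⟩, ⟨_, hc.raise hi, e⟩]
    · rcases (twLabelling n hn).reflLeft_window hc i with e | ⟨g, hg, e⟩
      exacts [⟨h, hc, e⟩, ⟨g, hg, e⟩]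

/-! ### Pairs of ticks with the same folded distance -/

/-- The generalized distance only depends on folded coordinates up to translation and reversal. -/
theorem samePair_of_folded (hn : 1 ≤ n) {h h' : Fin (2 * n + 1) → ℤ} (hc : (twClock n).IsCut h)
    (hc' : (twClock n).IsCut h') {x y x' y' : Fin (2 * n + 1) × ℤ}
    {α β α' β' : PosRoot (2 * n + 1)} (hα : InWin (twClock n) (4 * n + 2) h x α)
    (hβ : InWin (twClock n) (4 * n + 2) h y β) (hα' : InWin (twClock n) (4 * n + 2) h' x' α')
    (hβ' : InWin (twClock n) (4 * n + 2) h' y' β') (ex : orbit n x.1 = orbit n x'.1)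
    (ey : orbit n y.1 = orbit n y'.1) (ht : |x.2 - y.2| = |x'.2 - y'.2|) :
    Labelling.SamePair ((twClock n).window (4 * n + 2) h) α β ((twClock n).window (4 * n + 2) h') α' β' := by
  have ℒ := twLabelling n hn
  -- it is enough to treat equal differences of times
  suffices key : ∀ {h : Fin (2 * n + 1) → ℤ} {x y : Fin (2 * n + 1) × ℤ}
      {α β : PosRoot (2 * n + 1)}, (twClock n).IsCut h → InWin (twClock n) (4 * n + 2) h x α →
      InWin (twClock n) (4 * n + 2) h y β → orbit n x.1 = orbit n x'.1 → orbit n y.1 = orbit n y'.1 →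
      x.2 - y.2 = x'.2 - y'.2 →
      Labelling.SamePair ((twClock n).window (4 * n + 2) h) α β ((twClock n).window (4 * n + 2) h') α' β' by
    -- Opposite differences are exchanged by reversing time, which preserves letters.
    rcases abs_eq_abs.mp ht with ht | ht
    · exact key hc hα hβ ex ey ht
    · exact (ℒ.samePair_revCut twClock_isSymm hc α β).trans
        (key (revCut_isCut twClock_isSymm twClock_isMirror_window hc) (ℒ.inWin_revCut hc hα)
          (ℒ.inWin_revCut hc hβ) ex ey (by simp only; omega))
  clear ht ex ey hα hβ hc
  intro h x y α β hc hα hβ ex ey ht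
  obtain ⟨i, a⟩ := x
  obtain ⟨j, b⟩ := y
  obtain ⟨i', a'⟩ := x'
  obtain ⟨j', b'⟩ := y'
  have tx := twClock_onTime (Labelling.inSpan hc hα).1
  have ty := twClock_onTime (Labelling.inSpan hc hβ).1
  have tx' := twClock_onTime (Labelling.inSpan hc' hα').1
  have ty' := twClock_onTime (Labelling.inSpan hc' hβ').1
  simp only [orbit, Fin.ext_iff] at *
  have r1 := Fin.val_rev i
  have r2 := Fin.val_rev i'
  have r3 := Fin.val_rev j
  have r4 := Fin.val_rev j'
  have l1 := i.2
  have l2 := i'.2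
  have l3 := j.2
  have l4 := j'.2
  -- The residue of the shift tells whether letters are matched directly or through `i ↦ i^*`. One
  -- mirror covers the second case; two mirrors give the pure translation needed in the first.
  by_cases hpar : (a' - a) % 4 = 2
  · have hd : (twClock n).IsMirror (a' - a) := twClock_isMirror hpar
    have hx := Labelling.inWin_mir hd hα
    have hy := Labelling.inWin_mir hd hβ
    have e1 : i.rev = i' := Fin.ext (by omega)
    have e2 : j.rev = j' := Fin.ext (by omega)
    simp only at hx hy
    rw [e1, show a + (a' - a) = a' by ring] at hx
    rw [e2, show b + (a' - a) = b' by omega] at hy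
    exact (ℒ.samePair_mir hd hc α β).trans (ℒ.samePair (hd.isCut hc) hc' hx hy hα' hβ')
  · have hd : (twClock n).IsMirror (a' - a + 2) := twClock_isMirror (by omega)
    have hd' : (twClock n).IsMirror (-2) := twClock_isMirror rfl
    have hx := Labelling.inWin_mir hd' (Labelling.inWin_mir hd hα)
    have hy := Labelling.inWin_mir hd' (Labelling.inWin_mir hd hβ)
    have e1 : i = i' := Fin.ext (by omega)
    have e2 : j = j' := Fin.ext (by omega)
    simp only [Fin.rev_rev] at hx hy
    rw [e1, show a + (a' - a + 2) + -2 = a' by ring] at hx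
    rw [e2, show b + (a' - a + 2) + -2 = b' by omega] at hy
    exact ((ℒ.samePair_mir hd hc α β).trans (ℒ.samePair_mir hd' (hd.isCut hc) _ _)).trans
      (ℒ.samePair (hd'.isCut (hd.isCut hc)) hc' hx hy hα' hβ')

end TwistedAR

namespace TwistedAR

open Clock

variable {n : ℕ}

/-! ### Realising folded distances in every window -/

theorem twCut_sub_lt {h : Fin (2 * n + 1) → ℤ} (hc : (twClock n).IsCut h)
    {i j : Fin (2 * n + 1)} (hi : i ≠ mid n) (hj : j ≠ mid n) : h i - h j ≤ 4 * n - 2 := by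
  obtain ⟨i, rfl⟩ := exists_emb hi
  obtain ⟨j, rfl⟩ := exists_emb hj
  have h1 := twCut_lipschitz hc i j
  have h2 := i.2
  have h3 := j.2
  have h4 : |(i : ℤ) - j| ≤ 2 * n - 1 := abs_le.mpr ⟨by omega, by omega⟩
  omega

/-- The neighbour of the middle on the side of `j` is at most `n-1` letters away. This contributes
`2n-2`, and the step to the middle at most 3 in one direction and 1 in the other. -/
theorem twCut_sub_mid (hn : 1 ≤ n) {h : Fin (2 * n + 1) → ℤ} (hc : (twClock n).IsCut h)
    {j : Fin (2 * n + 1)} (hj : j ≠ mid n) :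
    h j - h (mid n) ≤ 2 * n + 1 ∧ h (mid n) - h j ≤ 2 * n - 1 := by
  obtain ⟨j, rfl⟩ := exists_emb hj
  have hj2 := j.2
  have key : ∀ i : Fin (2 * n), Adj (mid n) (emb n i) → |(i : ℤ) - j| ≤ n - 1 →
      h (emb n j) - h (mid n) ≤ 2 * n + 1 ∧ h (mid n) - h (emb n j) ≤ 2 * n - 1 := by
    intro i hA hij
    have h1 := twCut_lipschitz hc i j
    have h2 := twCut_lipschitz hc j i
    rw [abs_sub_comm] at h2
    have h3 := twCut_mid hc hA
    omega
  by_cases hlt : (j : ℕ) < n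
  · refine key ⟨n - 1, by omega⟩ ?_ (abs_le.mpr ?_)
    · have := emb_val (n := n) ⟨n - 1, by omega⟩
      simp only [Adj, mid] at *
      omega
    · constructor <;> push_cast [hn] <;> omega
  · refine key ⟨n, by omega⟩ ?_ (abs_le.mpr ?_)
    · have := emb_val (n := n) ⟨n, by omega⟩
      simp only [Adj, mid] at *
      omega
    · constructor <;> push_cast <;> omega

theorem orbit_rev (i : Fin (2 * n + 1)) : orbit n i.rev = orbit n i := by
  ext
  simp only [orbit, Fin.rev_rev]
  exact min_comm _ _

theorem rev_ne_mid {i : Fin (2 * n + 1)} (hi : i ≠ mid n) : i.rev ≠ mid n := fun e =>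
  hi (by rw [← Fin.rev_rev i, e, mid_rev])

theorem onTime_of_ne_mid {i : Fin (2 * n + 1)} (hi : i ≠ mid n) {t : ℤ} :
    (twClock n).OnTime i t ↔ ((i : ℕ) < n ∧ (t - 2 * i) % 4 = 0) ∨
      (n < (i : ℕ) ∧ (t - 2 * i - 2) % 4 = 0) := by
  have h1 : (i : ℕ) ≠ n := fun e => hi (Fin.ext e)
  constructor
  · intro h; have := twClock_onTime h; omega
  · intro h; apply twClock_onTime_of; omega

/-- A tick of the middle letter and a tick of another orbit at a given odd distance. -/
theorem exists_inSpan_mid (hn : 1 ≤ n) {h : Fin (2 * n + 1) → ℤ} (hc : (twClock n).IsCut h)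
    {j : Fin (2 * n + 1)} (hj : j ≠ mid n) {t : ℤ} (ht0 : 0 ≤ t) (ht : t < 4 * n + 2)
    (hodd : t % 2 = 1) :
    ∃ j' a b, orbit n j' = orbit n j ∧ InSpan (twClock n) (4 * n + 2) h (mid n, a) ∧
      InSpan (twClock n) (4 * n + 2) h (j', b) ∧ |a - b| = t := by
  have hm : h (mid n) % 2 = 1 := by
    have := twClock_onTime (hc.onTime (mid n))
    simp only [mid] at *
    omega
  have choose : ∀ T : ℤ, T % 2 = 0 → ∃ j' : Fin (2 * n + 1), orbit n j' = orbit n j ∧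
      j' ≠ mid n ∧ (twClock n).OnTime j' T := by
    intro T hT
    by_cases hon : (twClock n).OnTime j T
    · exact ⟨j, rfl, hj, hon⟩
    · refine ⟨j.rev, orbit_rev j, rev_ne_mid hj, ?_⟩
      rw [onTime_of_ne_mid hj] at hon
      rw [onTime_of_ne_mid (rev_ne_mid hj)]
      have h1 := Fin.val_rev j
      have h2 := j.2
      have h3 : (j : ℕ) ≠ n := fun e => hj (Fin.ext e)
      omega
  have onMid : ∀ T : ℤ, T % 2 = 1 → (twClock n).OnTime (mid n) T := fun T hT =>
    twClock_onTime_of (Or.inr (Or.inl ⟨rfl, hT⟩))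
  by_cases hsmall : t ≤ 2 * n + 1
  -- By time `h (mid n) + 2n+1` every side letter has entered the window, and `j` or `j^*` ticks
  -- exactly then. The middle tick is placed `t` earlier.
  · obtain ⟨j', h1, h2, h3⟩ := choose (h (mid n) + 2 * n + 1) (by omega)
    have h4 := twCut_sub_mid hn hc h2
    have h5 := twCut_sub_mid hn hc (rev_ne_mid h2)
    refine ⟨j', h (mid n) + 2 * n + 1 - t, h (mid n) + 2 * n + 1, h1,
      ⟨onMid _ (by omega), ?_, ?_⟩, ⟨h3, ?_, ?_⟩, ?_⟩
    · simp only; omega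
    · simp only [mir, mid_rev]; omega
    · simp only; omega
    · simp only [mir]; omega
    · rw [abs_of_nonpos (by omega)]; omega
  · obtain ⟨j', h1, h2, h3⟩ := choose (h (mid n) + t) (by omega)
    have h4 := twCut_sub_mid hn hc h2
    have h5 := twCut_sub_mid hn hc (rev_ne_mid h2)
    by_cases hup : h (mid n) + t < h j'.rev + (4 * n + 2)
    · refine ⟨j', h (mid n), h (mid n) + t, h1, ⟨hc.onTime _, ?_, ?_⟩, ⟨h3, ?_, ?_⟩, ?_⟩
      · simp only; omega
      · simp only [mir, mid_rev]; omega
      · simp only; omega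
      · simp only [mir]; omega
      · rw [abs_of_nonpos (by omega)]; omega
    -- Otherwise the window of `j'` ends too early. The pair is then taken in reversed order, from
    -- the last middle tick of the window, with the mirrored letter.
    · refine ⟨j'.rev, h (mid n) + 4 * n, h (mid n) + 4 * n - t, by rw [orbit_rev, h1],
        ⟨onMid _ (by omega), ?_, ?_⟩, ⟨?_, ?_, ?_⟩, ?_⟩
      · simp only; omega
      · simp only [mir, mid_rev]; omega
      · rw [onTime_of_ne_mid h2] at h3
        rw [onTime_of_ne_mid (rev_ne_mid h2)]
        have h6 := Fin.val_rev j'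
        have h7 := j'.2
        omega
      · simp only; omega
      · simp only [mir, Fin.rev_rev]; omega
      · rw [abs_of_nonneg (by omega)]; omega

/-- Every window contains pairs of ticks in given orbits at any small distance. -/
theorem exists_inSpan_pair (hn : 1 ≤ n) {h : Fin (2 * n + 1) → ℤ} (hc : (twClock n).IsCut h)
    {x y : Fin (2 * n + 1) × ℤ} (hx : (twClock n).OnTime x.1 x.2)
    (hy : (twClock n).OnTime y.1 y.2) (ht : |x.2 - y.2| < 4 * n + 2) :
    ∃ x' y', InSpan (twClock n) (4 * n + 2) h x' ∧ InSpan (twClock n) (4 * n + 2) h y' ∧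
      orbit n x.1 = orbit n x'.1 ∧ orbit n y.1 = orbit n y'.1 ∧
      |x.2 - y.2| = |x'.2 - y'.2| := by
  wlog hle : x.2 ≤ y.2 generalizing x y
  · obtain ⟨y', x', h1, h2, h3, h4, h5⟩ := this hy hx (by rwa [abs_sub_comm]) (by omega)
    exact ⟨x', y', h2, h1, h4, h3, by rw [abs_sub_comm, h5, abs_sub_comm]⟩
  obtain ⟨i, a⟩ := x
  obtain ⟨j, b⟩ := y
  simp only at *
  have tx := twClock_onTime hx
  have ty := twClock_onTime hy
  have hm : h (mid n) % 2 = 1 := by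
    have := twClock_onTime (hc.onTime (mid n))
    simp only [mid] at *
    omega
  rw [abs_of_nonpos (by omega)] at ht ⊢
  by_cases hi : i = mid n
  · subst hi
    have ha : a % 2 = 1 := by simp only [mid] at tx; omega
    by_cases hj : j = mid n
    · subst hj
      have hb : b % 2 = 1 := by simp only [mid] at ty; omega
      refine ⟨(mid n, h (mid n)), (mid n, h (mid n) + (b - a)), ⟨hc.onTime _, ?_, ?_⟩,
        ⟨?_, ?_, ?_⟩, rfl, rfl, ?_⟩
      · exact le_rfl
      · simp only [mir, mid_rev]; omega
      · exact twClock_onTime_of (Or.inr (Or.inl ⟨rfl, by simp only; omega⟩))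
      · simp only; omega
      · simp only [mir, mid_rev]; omega
      · simp only; rw [abs_of_nonpos (by omega)]; ring
    · have hb := (onTime_of_ne_mid hj).mp hy
      obtain ⟨j', a', b', h1, h2, h3, h4⟩ := exists_inSpan_mid hn hc hj (t := b - a) (by omega)
        (by omega) (by omega)
      exact ⟨_, _, h2, h3, rfl, h1.symm, by simp only; omega⟩
  · have ha := (onTime_of_ne_mid hi).mp hx
    by_cases hj : j = mid n
    · subst hj
      have hb : b % 2 = 1 := by simp only [mid] at ty; omega
      obtain ⟨i', b', a', h1, h2, h3, h4⟩ := exists_inSpan_mid hn hc hi (t := b - a) (by omega)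
        (by omega) (by omega)
      exact ⟨_, _, h3, h2, h1.symm, rfl, by simp only; rw [abs_sub_comm]; omega⟩
    · have hi' := rev_ne_mid hi
      have hj' := rev_ne_mid hj
      have ti := (onTime_of_ne_mid hi).mp (hc.onTime i)
      have tj := (onTime_of_ne_mid hj).mp (hc.onTime j)
      have ti' := (onTime_of_ne_mid hi').mp (hc.onTime i.rev)
      have tj' := (onTime_of_ne_mid hj').mp (hc.onTime j.rev)
      have hb := (onTime_of_ne_mid hj).mp hy
      have h1 := twCut_sub_lt hc hi hi'
      have h2 := twCut_sub_lt hc hi' hi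
      have h3 := twCut_sub_lt hc hj hj'
      have h4 := twCut_sub_lt hc hj' hj
      have h5 := twCut_sub_lt hc hj hi'
      have h6 := twCut_sub_lt hc hi' hj
      have r1 := Fin.val_rev i
      have r2 := Fin.val_rev j
      have l1 := i.2
      have l2 := j.2
      -- Translate the pair until one tick meets the start of the window and the other is not before
      -- it; `hA` makes the later one fit before the end. If it fails, the time-reversed pair on the
      -- mirrored letters fits instead.
      by_cases hA : h i ≤ h j.rev
      · obtain ⟨s, hs1, hs2, hs3⟩ : ∃ s, (s = h i - a ∨ s = h j - b) ∧ h i - a ≤ s ∧ h j - b ≤ s :=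
          ⟨max (h i - a) (h j - b), max_choice _ _, le_max_left _ _, le_max_right _ _⟩
        refine ⟨(i, a + s), (j, b + s), ⟨?_, ?_, ?_⟩, ⟨?_, ?_, ?_⟩, rfl, rfl, ?_⟩
        · rw [onTime_of_ne_mid hi]; omega
        · simp only; omega
        · simp only [mir]; omega
        · rw [onTime_of_ne_mid hj]; omega
        · simp only; omega
        · simp only [mir]; omega
        · simp only; rw [abs_of_nonpos (by omega)]; ring
      · obtain ⟨s, hs1, hs2, hs3⟩ : ∃ s, (s = h i.rev + a ∨ s = h j.rev + b) ∧
            h i.rev + a ≤ s ∧ h j.rev + b ≤ s :=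
          ⟨max (h i.rev + a) (h j.rev + b), max_choice _ _, le_max_left _ _, le_max_right _ _⟩
        refine ⟨(i.rev, -a + s), (j.rev, -b + s), ⟨?_, ?_, ?_⟩, ⟨?_, ?_, ?_⟩, (orbit_rev i).symm,
          (orbit_rev j).symm, ?_⟩
        · rw [onTime_of_ne_mid hi']; omega
        · simp only; omega
        · simp only [mir, Fin.rev_rev]; omega
        · rw [onTime_of_ne_mid hj']; omega
        · simp only; omega
        · simp only [mir, Fin.rev_rev]; omega
        · simp only; rw [abs_of_nonneg (by omega)]; ring

end TwistedAR

namespace TwistedAR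

open Clock

variable {m : ℕ} {g : Fin m → ℤ}

/-! ### Dynkin quivers and their coordinates from cuts -/

theorem DynkinQuiver.eq_of_arrow {Q Q' : DynkinQuiver m} (h : ∀ i j, Q.arrow i j ↔ Q'.arrow i j) :
    Q = Q' := by
  cases Q
  cases Q'
  congr
  funext i j
  exact propext (h i j)

/-- The Dynkin quiver of a cut: arrows point to earlier ticks. -/
def cutQuiver (hc : (arClock m).IsCut g) : DynkinQuiver m where
  arrow i j := Adj i j ∧ g j < g i
  adj_of_arrow _ _ h := h.1
  oriented i j hij := by
    rcases lt_or_gt_of_ne ((hc.onTime i).ne hij (hc.onTime j)) with h | h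
    · exact Or.inr ⟨⟨Or.symm hij, h⟩, fun h' => lt_asymm h h'.2⟩
    · exact Or.inl ⟨⟨hij, h⟩, fun h' => lt_asymm h h'.2⟩

theorem isSink_cutQuiver (hc : (arClock m).IsCut g) (i : Fin m) :
    (cutQuiver hc).IsSink i ↔ Sink g i := by
  constructor
  · intro h j hij
    refine lt_of_le_of_ne (not_lt.mp fun h' => h j ⟨hij, h'⟩) ((hc.onTime i).ne hij (hc.onTime j))
  · rintro h j ⟨hij, h'⟩
    exact lt_asymm h' (h j hij)

/-- After its tick a sink exceeds all its neighbours by 1, so exactly the arrows at `i` turn around.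
-/
theorem reverseAt_cutQuiver (hc : (arClock m).IsCut g) {i : Fin m} (hi : Sink g i) :
    (cutQuiver hc).reverseAt i = cutQuiver (hc.raise hi) := by
  apply DynkinQuiver.eq_of_arrow
  intro a b
  have hs : (arClock m).step i = 2 := rfl
  simp only [DynkinQuiver.reverseAt, cutQuiver]
  by_cases ha : a = i
  · subst ha
    rw [if_pos (Or.inl rfl), raise_self, hs]
    constructor
    · rintro ⟨h1, h2⟩
      refine ⟨h1.symm, ?_⟩
      rw [raise_of_ne _ h1.ne]
      have := arClock_cut_adj hc h1
      omega
    · rintro ⟨h1, h2⟩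
      exact ⟨h1.symm, hi b h1⟩
  · by_cases hb : b = i
    · subst hb
      rw [if_pos (Or.inr rfl), raise_self, hs, raise_of_ne _ ha]
      constructor
      · rintro ⟨h1, h2⟩
        have := hi a h1
        omega
      · rintro ⟨h1, h2⟩
        have := arClock_cut_adj hc h1
        omega
    · rw [if_neg (by tauto), raise_of_ne _ ha, raise_of_ne _ hb]

theorem isAdapted_cutQuiver (hc : (arClock m).IsCut g) (w : Word m) :
    IsAdapted (cutQuiver hc) w ↔ (arClock m).Legal g w := by
  induction w generalizing g with
  | nil => exact Iff.rfl
  | cons i w ih =>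
    rw [IsAdapted, Legal, isSink_cutQuiver]
    refine and_congr_right fun hi => ?_
    rw [reverseAt_cutQuiver hc hi, ih]

/-- The first of `a` and `b` to occur in the word is a sink at that moment, both for the quiver and
for the cut, which orients the edge the same way in both. -/
theorem arrow_iff_of_isAdapted {Q : DynkinQuiver m} {w : Word m} (hw : (arClock m).Legal g w)
    (hQ : IsAdapted Q w) {a b : Fin m} (hab : Adj a b) (ha : a ∈ w) :
    Q.arrow a b ↔ g b < g a := by
  induction w generalizing g Q with
  | nil => simp at ha
  | cons i w ih =>
    by_cases hai : a = i
    · subst hai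
      exact iff_of_false (hQ.1 b) (lt_asymm (hw.1 b hab))
    · by_cases hbi : b = i
      · subst hbi
        refine iff_of_true ?_ (hw.1 a hab.symm)
        rcases Q.oriented a b hab with h | h
        · exact h.1
        · exact absurd h.1 (hQ.1 a)
      · have := ih hw.2 hQ.2 (List.mem_of_ne_of_mem hai ha)
        rw [raise_of_ne _ hai, raise_of_ne _ hbi] at this
        rw [← this]
        simp [DynkinQuiver.reverseAt, hai, hbi]

/-- A quiver to which a long enough legal word is adapted is the quiver of the cut. -/
theorem eq_cutQuiver (hc : (arClock m).IsCut g) {Q : DynkinQuiver m} {w : Word m}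
    (hw : (arClock m).Legal g w) (hQ : IsAdapted Q w) (hall : ∀ i, i ∈ w) : Q = cutQuiver hc := by
  apply DynkinQuiver.eq_of_arrow
  intro a b
  constructor
  · intro h
    have hab : Adj a b := Q.adj_of_arrow a b h
    exact ⟨hab, (arrow_iff_of_isAdapted hw hQ hab (hall a)).mp h⟩
  · rintro ⟨hab, h⟩
    exact (arrow_iff_of_isAdapted hw hQ hab (hall a)).mpr h

theorem isCoxeterWord_cutQuiver (hc : (arClock m).IsCut g) (w : Word m) :
    IsCoxeterWord (cutQuiver hc) w ↔
      (arClock m).Legal g w ∧ (arClock m).run g w = fun i => g i + 2 := by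
  rw [IsCoxeterWord, isAdapted_cutQuiver]
  have key : (w.Nodup ∧ ∀ i, i ∈ w) ↔ (arClock m).run g w = fun i => g i + 2 := by
    rw [List.nodup_iff_count_eq_one, funext_iff]
    have e : ∀ i, (arClock m).run g w i = g i + 2 ↔ w.count i = 1 := by
      intro i
      simp only [run, arClock]
      omega
    simp only [e]
    constructor
    · exact fun h i => h.1 i (h.2 i)
    · exact fun h => ⟨fun i _ => h i, fun i => List.count_pos_iff.mp (by rw [h i]; exact one_pos)⟩
  rw [← key]
  tauto

theorem isCut_add_two (hc : (arClock m).IsCut g) : (arClock m).IsCut fun i => g i + 2 where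
  onTime i := (hc.onTime i).add_step
  lt i j hij := by have := hc.lt i j hij; omega

theorem exists_coxeterWord (hc : (arClock m).IsCut g) : ∃ w, IsCoxeterWord (cutQuiver hc) w := by
  simp only [isCoxeterWord_cutQuiver]
  exact exists_legal hc (isCut_add_two hc) fun i => by omega

/-! ### Coxeter words and coordinates of type `A_m` -/

variable {w : Word m}

theorem coxeterWord_extend (hm : 0 < m) (hc : (arClock m).IsCut g)
    (hw : IsCoxeterWord (cutQuiver hc) w) : ∃ v, w ++ v ∈ (arClock m).window (m + 1) g := by
  rw [isCoxeterWord_cutQuiver] at hw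
  have ℒ := arLabelling m hm
  have hmir := ℒ.isCut_mir hc
  obtain ⟨v, hv, hr⟩ := exists_legal (isCut_add_two hc) hmir fun i => by
    have := (hc.onTime i).le_sub_step (hmir.onTime i) (ℒ.lt_mir g hc i)
    have : (arClock m).step i = 2 := rfl
    omega
  refine ⟨v, (legal_append _ _ _).mpr ⟨hw.1, ?_⟩, ?_⟩
  · rwa [hw.2]
  · rw [run_append, hw.2, hr]

theorem inWin_of_coxeterWord (hm : 0 < m) (hc : (arClock m).IsCut g)
    (hw : IsCoxeterWord (cutQuiver hc) w) {k : ℕ} {i : Fin m} {β : PosRoot m}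
    (hk : Word.RootAt w k i β) : InWin (arClock m) (m + 1) g (i, g i) β := by
  obtain ⟨v, hv⟩ := coxeterWord_extend hm hc hw
  refine ⟨w ++ v, hv, k, RootAt.append hk, ?_⟩
  rw [List.take_append_of_le_length (RootAt.lt_length hk).le]
  have h1 := congrFun ((isCoxeterWord_cutQuiver hc w).mp hw).2 i
  have h2 : w = w.take k ++ i :: w.drop (k + 1) := split_at hk.1
  rw [h2, run_append, run_cons] at h1
  have h3 := le_run (K := arClock m) ((arClock m).raise ((arClock m).run g (w.take k)) i)
    (w.drop (k + 1)) i
  have h4 := le_run (K := arClock m) g (w.take k) i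
  rw [raise_self] at h3
  have : (arClock m).step i = 2 := rfl
  simp only at h1 ⊢
  omega

theorem rootAt_coxeterWord (hm : 0 < m) (hc : (arClock m).IsCut g)
    (hw : IsCoxeterWord (cutQuiver hc) w) {i : Fin m} {β : PosRoot m}
    (hβ : InWin (arClock m) (m + 1) g (i, g i) β) : ∃ k, Word.RootAt w k i β := by
  obtain ⟨k, hk⟩ := List.mem_iff_getElem?.mp (hw.2.1 i)
  obtain ⟨v, hv⟩ := coxeterWord_extend hm hc hw
  have ℒ := arLabelling m hm
  have hlt := (List.getElem?_eq_some_iff.mp hk).1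
  obtain ⟨γ, hγ⟩ := IsFull.rootAt (ℒ.isFull hc hv) (k := k) (i := i)
    (by rw [List.getElem?_append_left hlt]; exact hk)
  have hγ' : Word.RootAt w k i γ :=
    ⟨hk, by rw [hγ.2, List.take_append_of_le_length hlt.le]⟩
  obtain rfl := ℒ.inWin_root_unique hc hβ (inWin_of_coxeterWord hm hc hw hγ')
  exact ⟨k, hγ'⟩

/-- The strands crossing at `(i, t)` are the two lines of slope `±1` through that tick; their labels
identify the root. -/
theorem inWin_label (hm : 0 < m) (hc : (arClock m).IsCut g) {i : Fin m} {t : ℤ} {β : PosRoot m}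
    (hβ : InWin (arClock m) (m + 1) g (i, t) β) :
    (arLabelling m hm).lab g β.1.1 = ((t - i : ℤ) : ZMod (2 * m + 2)) ∧
      (arLabelling m hm).lab g β.1.2 = ((t + i + 2 : ℤ) : ZMod (2 * m + 2)) := by
  obtain ⟨w, hw, k, hk, e⟩ := hβ
  simp only at hk e
  subst e
  have h1 := arLabel_sink (hc.run (hw.1.take k)) (hw.1.sink hk.1)
  have h2 := (arLabelling m hm).lab_run hc (hw.1.take k)
  rw [hk.2]
  simp only at h1 ⊢
  rw [← h2, ← h2]
  simp only [arLabelling, Fin.val_castSucc, Fin.val_succ, h1, and_self]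

/-- A Coxeter word translates the cut by 2, and the label of a strand at a given height increases by
the same amount. -/
theorem lab_coxeterWord (hm : 0 < m) (hc : (arClock m).IsCut g)
    (hw : IsCoxeterWord (cutQuiver hc) w) (j : Fin (m + 1)) :
    (arLabelling m hm).lab g (Word.toPerm w j) =
      ((arLabel g j + 2 : ℤ) : ZMod (2 * m + 2)) := by
  rw [isCoxeterWord_cutQuiver] at hw
  rw [← (arLabelling m hm).lab_run hc hw.1, hw.2]
  have h1 : ∀ k, extCut (fun i => g i + 2) k = extCut g k + 2 := by
    intro k
    simp only [extCut]
    split_ifs <;> omega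
  simp only [arLabelling, arLabel, h1]
  congr 1
  ring

/-- The Coxeter element moves the root of a tick to the root of the next tick. -/
theorem coxeterWord_next (hm : 0 < m) (hc : (arClock m).IsCut g)
    (hw : IsCoxeterWord (cutQuiver hc) w) {i : Fin m} {t : ℤ} {β γ : PosRoot m}
    (hβ : InWin (arClock m) (m + 1) g (i, t) β)
    (hγ : InWin (arClock m) (m + 1) g (i, t + 2) γ) :
    γ.1 = (Word.toPerm w β.1.1, Word.toPerm w β.1.2) := by
  obtain ⟨h1, h2⟩ := inWin_label hm hc hβ
  obtain ⟨h3, h4⟩ := inWin_label hm hc hγ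
  have e : ∀ (j : Fin (m + 1)) (x : ℤ), (arLabelling m hm).lab g j = (x : ZMod (2 * m + 2)) →
      (arLabelling m hm).lab g (Word.toPerm w j) = ((x + 2 : ℤ) : ZMod (2 * m + 2)) := by
    intro j x h
    rw [lab_coxeterWord hm hc hw]
    have h' : ((arLabel g j : ℤ) : ZMod (2 * m + 2)) = x := h
    push_cast
    rw [h']
  apply Prod.ext
  · apply (arLabelling m hm).inj g hc
    rw [h3, e _ _ h1]
    congr 1
    ring
  · apply (arLabelling m hm).inj g hc
    rw [h4, e _ _ h2]
    congr 1
    ring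

/-- Converse of `coxeterWord_next`: once `φ_Q(β)` is a positive root, its labels modulo `2m+2`
determine its tick in the window. -/
theorem coxeterWord_tick (hm : 0 < m) (hc : (arClock m).IsCut g)
    (hw : IsCoxeterWord (cutQuiver hc) w) {i : Fin m} {t : ℤ} {β γ : PosRoot m}
    (hβ : InWin (arClock m) (m + 1) g (i, t) β)
    (hγ : γ.1 = (Word.toPerm w β.1.1, Word.toPerm w β.1.2)) :
    InWin (arClock m) (m + 1) g (i, t + 2) γ := by
  obtain ⟨⟨j, s⟩, hx⟩ := (arLabelling m hm).exists_tick hc γ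
  obtain ⟨h1, h2⟩ := inWin_label hm hc hβ
  obtain ⟨h3, h4⟩ := inWin_label hm hc hx
  have e : ∀ (j : Fin (m + 1)) (x : ℤ), (arLabelling m hm).lab g j = (x : ZMod (2 * m + 2)) →
      (arLabelling m hm).lab g (Word.toPerm w j) = ((x + 2 : ℤ) : ZMod (2 * m + 2)) := by
    intro j x h
    rw [lab_coxeterWord hm hc hw]
    have h' : ((arLabel g j : ℤ) : ZMod (2 * m + 2)) = x := h
    push_cast
    rw [h']
  rw [hγ, e _ _ h1] at h3
  rw [hγ, e _ _ h2] at h4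
  have d3 := (ZMod.intCast_eq_intCast_iff_dvd_sub _ _ _).mp h3
  have d4 := (ZMod.intCast_eq_intCast_iff_dvd_sub _ _ _).mp h4
  have hi := i.2
  have hj := j.2
  -- The difference of the two labels is `2i+2`, smaller than the modulus, so it determines the
  -- letter; the times are separated next, by the size of the window.
  have d5 := Int.eq_zero_of_abs_lt_dvd (dvd_sub d4 d3) (by push_cast; rw [abs_lt]; omega)
  obtain rfl : j = i := Fin.ext (by omega)
  obtain ⟨s1, s2, s3⟩ := Labelling.inSpan hc hβ
  obtain ⟨t1, t2, t3⟩ := Labelling.inSpan hc hx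
  have l1 := arCut_lipschitz hc j.rev j
  have l2 := Fin.val_rev j
  have l3 : |((j.rev : ℕ) : ℤ) - j| ≤ m - 1 := abs_le.mpr ⟨by omega, by omega⟩
  simp only [mir] at s1 s2 s3 t1 t2 t3
  have d6 := Int.eq_zero_of_abs_lt_dvd d3 (by push_cast; rw [abs_lt]; omega)
  obtain rfl : s = t + 2 := by omega
  exact hx

theorem exists_arCoordinate (hm : 0 < m) (hc : (arClock m).IsCut g) :
    ∃ ξ ω, IsHeight (cutQuiver hc) ξ ∧ IsARCoordinate (cutQuiver hc) ξ ω ∧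
      ∀ x γ, InWin (arClock m) (m + 1) g x γ → ω γ = (x.1, -x.2) := by
  have ℒ := arLabelling m hm
  choose τ hτ using ℒ.exists_tick hc
  have key : ∀ x γ, InWin (arClock m) (m + 1) g x γ → ((τ γ).1, -(τ γ).2) = (x.1, -x.2) :=
    fun x γ hx => by rw [ℒ.inWin_tick_unique hc (hτ γ) hx]
  refine ⟨fun i => -g i, fun γ => ((τ γ).1, -(τ γ).2), ?_, ?_, key⟩
  · rintro i j ⟨hij, hlt⟩
    have := arClock_cut_adj hc hij
    simp only
    omega
  · intro w hw
    refine ⟨fun k i β hk => key _ _ (inWin_of_coxeterWord hm hc hw hk), fun β γ hγ => ?_⟩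
    have e := key _ _ (coxeterWord_tick hm hc hw (hτ β) hγ)
    simp only at e ⊢
    rw [e]
    simp only [Prod.mk.injEq, true_and]
    ring

theorem isHeight_cutQuiver (hm : 0 < m) (hc : (arClock m).IsCut g) {ξ : Fin m → ℤ}
    (hξ : IsHeight (cutQuiver hc) ξ) : ∃ c, ∀ i, ξ i = c - g i := by
  have hadj : ∀ i j, Adj i j → ξ i + g i = ξ j + g j := by
    intro i j hij
    rcases arClock_cut_adj hc hij with e | e
    · have := hξ j i ⟨hij.symm, by omega⟩
      omega
    · have := hξ i j ⟨hij, by omega⟩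
      omega
  have key : ∀ k (hk : k < m), ξ ⟨k, hk⟩ + g ⟨k, hk⟩ = ξ ⟨0, hm⟩ + g ⟨0, hm⟩ := by
    intro k
    induction k with
    | zero => exact fun _ => rfl
    | succ k ih =>
      intro hk
      rw [← ih (by omega)]
      exact hadj _ _ (Or.inr rfl)
  exact ⟨ξ ⟨0, hm⟩ + g ⟨0, hm⟩, fun i => by have := key i i.2; simp only [Fin.eta] at this; omega⟩

/-- Coordinates of the Auslander–Reiten quiver are determined up to a translation. -/
theorem arCoordinate_rigid (hm : 0 < m) (hc : (arClock m).IsCut g) {ξ : Fin m → ℤ}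
    {ω : PosRoot m → Fin m × ℤ} (hξ : IsHeight (cutQuiver hc) ξ)
    (hω : IsARCoordinate (cutQuiver hc) ξ ω) :
    ∃ c, ∀ x γ, InWin (arClock m) (m + 1) g x γ → ω γ = (x.1, c - x.2) := by
  have ℒ := arLabelling m hm
  obtain ⟨c, hξc⟩ := isHeight_cutQuiver hm hc hξ
  obtain ⟨w, hw⟩ := exists_coxeterWord hc
  refine ⟨c, ?_⟩
  rintro ⟨i, t⟩ γ hγ
  obtain ⟨s1, s2, s3⟩ := Labelling.inSpan hc hγ
  -- Induct on the number of ticks of `i` since the cut: the first is fixed by the height function,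
  -- each further one by the Coxeter element.
  obtain ⟨a, ha⟩ := (hc.onTime i).exists_count s1 s2
  have hs : (arClock m).step i = 2 := rfl
  simp only [hs] at ha s2 s3
  induction a generalizing t γ with
  | zero =>
    obtain rfl : t = g i := by push_cast at ha; omega
    obtain ⟨k, hk⟩ := rootAt_coxeterWord hm hc hw hγ
    rw [(hω w hw).1 k i γ hk, hξc]
  | succ a ih =>
    have hspan : InSpan (arClock m) (m + 1) g (i, t - 2) :=
      ⟨s1.sub_step, by simp only; push_cast at ha; omega, by simp only; omega⟩
    obtain ⟨β, hβ⟩ := ℒ.exists_inWin hc hspan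
    have e := ih (t - 2) β hβ hspan.1 hspan.2.1 hspan.2.2 (by push_cast at ha; omega)
    have hγ' : InWin (arClock m) (m + 1) g (i, t - 2 + 2) γ := by
      rw [sub_add_cancel]; exact hγ
    rw [(hω w hw).2 β γ (coxeterWord_next hm hc hw hβ hγ'), e]
    simp only [Prod.mk.injEq, true_and]
    ring

end TwistedAR

namespace TwistedAR

open Clock

/-! ### Positions in legal words -/

section Positions

variable {m : ℕ} {K : Clock m} (h : Fin m → ℤ) {w : Word m}

theorem run_take_le {p q : ℕ} (hpq : p ≤ q) (i : Fin m) :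
    K.run h (w.take p) i ≤ K.run h (w.take q) i := by
  obtain ⟨d, rfl⟩ := Nat.exists_eq_add_of_le hpq
  rw [List.take_add, run_append]
  exact le_run _ _ _

theorem run_take_succ {k : ℕ} {i : Fin m} (hk : w[k]? = some i) :
    K.run h (w.take (k + 1)) i = K.run h (w.take k) i + K.step i := by
  rw [take_succ_eq hk, run_concat, raise_self]

theorem run_take_lt {p q : ℕ} {i : Fin m} (hp : w[p]? = some i) (hpq : p < q) :
    K.run h (w.take p) i + K.step i ≤ K.run h (w.take q) i := by
  rw [← run_take_succ h hp]
  exact run_take_le h hpq i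

theorem run_take_eq {p q : ℕ} (hpq : p ≤ q) {i : Fin m}
    (hno : ∀ r, p ≤ r → r < q → w[r]? ≠ some i) :
    K.run h (w.take q) i = K.run h (w.take p) i := by
  induction q, hpq using Nat.le_induction with
  | base => rfl
  | succ q hpq ih =>
    rw [← ih fun r h1 h2 => hno r h1 (by omega)]
    rcases hl : w[q]? with _ | l
    · have := List.getElem?_eq_none_iff.mp hl
      rw [List.take_of_length_le this, List.take_of_length_le (by omega)]
    · rw [take_succ_eq hl, run_concat, raise_of_ne]
      rintro rfl
      exact hno q hpq (by omega) hl

end Positions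

variable {n : ℕ} {h : Fin (2 * n + 1) → ℤ} {w : Word (2 * n + 1)}

/-! ### Projection to type `A_{2n}` -/

theorem exists_projWord_rootAt (hn : 1 ≤ n) (hc : (twClock n).IsCut h)
    (hw : w ∈ (twClock n).window (4 * n + 2) h) {k : ℕ} {j : Fin (2 * n)}
    (hk : w[k]? = some (emb n j)) :
    ∃ γ, Word.RootAt (projWord n w) (projWord n (w.take k)).length j γ ∧
      InWin (arClock (2 * n)) ((2 * n : ℕ) + 1) (arCut h)
        (j, arCut ((twClock n).run h (w.take k)) j) γ := by
  have e : projWord n w = projWord n (w.take k) ++ j :: projWord n (w.drop (k + 1)) := by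
    conv_lhs => rw [split_at hk, projWord_append, projWord_cons_emb]
  have hA := projWord_mem_window hc hw
  have ℒ := arLabelling (2 * n) (by omega)
  obtain ⟨γ, hγ⟩ := IsFull.rootAt (ℒ.isFull (arCut_isCut hc) hA)
    (k := (projWord n (w.take k)).length) (i := j) (by rw [e]; simp)
  refine ⟨γ, hγ, _, hA, _, hγ, ?_⟩
  have e' : (projWord n w).take (projWord n (w.take k)).length = projWord n (w.take k) := by
    rw [e, List.take_left]
  rw [e', (legal_projWord hc (hw.1.take k)).2]

theorem projWord_tick (hn : 1 ≤ n) (hc : (twClock n).IsCut h)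
    (hw : w ∈ (twClock n).window (4 * n + 2) h) {k : ℕ} {i : Fin (2 * n + 1)} {j : Fin (2 * n)}
    {γ : PosRoot (2 * n)} (hi : i ≠ mid n) (hk : w[k]? = some i)
    (hγ : Word.RootAt (projWord n w) (projWord n (w.take k)).length j γ) :
    ∃ s, InWin (arClock (2 * n)) ((2 * n : ℕ) + 1) (arCut h) (j, s) γ ∧
      2 * s = (twClock n).run h (w.take k) i := by
  obtain ⟨j', rfl⟩ := exists_emb hi
  obtain ⟨γ', h1, h2⟩ := exists_projWord_rootAt hn hc hw hk
  obtain ⟨rfl, rfl⟩ := RootAt.root_unique hγ h1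
  exact ⟨_, h2, two_mul_arCut (hc.run (hw.1.take k)) j⟩

/-! ### Arrows at the middle letter -/

theorem adj_mid_ne {b : Fin (2 * n + 1)} (hb : Adj (mid n) b) : (b : ℕ) ≠ n := fun e =>
  hb.ne (Fin.ext e.symm)

/-- No middle letter occurs between the two positions, so `t` is still the next middle tick when `b`
ticks. Being a sink then, `b` ticks before `t`, but by at most 1. -/
theorem arrow_of_mid (hn : 1 ≤ n) (hc : (twClock n).IsCut h) {t : ℤ} {β γ : PosRoot (2 * n + 1)}
    (hβ : InWin (twClock n) (4 * n + 2) h (mid n, t) β)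
    (ha : Arrow ((twClock n).window (4 * n + 2) h) β γ) :
    ∃ b, b ≠ mid n ∧ InWin (twClock n) (4 * n + 2) h (b, t - 1) γ := by
  have ℒ := twLabelling n hn
  obtain ⟨w, hw, k, j, a, b, hk, hj, hab, -, hleast⟩ := ha
  have e := ℒ.rootAt_tick hc hw hk hβ
  simp only [Prod.mk.injEq] at e
  obtain ⟨rfl, ht⟩ := e
  have hab' : Adj (mid n) b := hab
  refine ⟨b, hab'.ne.symm, w, hw, j, hj, ?_⟩
  have h1 : (twClock n).run h (w.take k) (mid n) = (twClock n).run h (w.take j) (mid n) :=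
    run_take_eq h hleast.1.1.le fun r hr hrk hmem => by
      rcases hr.lt_or_eq with hr | rfl
      · have := hleast.2 ⟨hr, hmem⟩
        omega
      · exact hab'.ne (Option.some.inj (hmem.symm.trans hj.1))
  have h2 := hw.1.sink hj.1 _ hab'.symm
  have h3 := twCut_mid (hc.run (hw.1.take j)) hab'
  simp only
  omega

/-- The neighbour ticks after the middle tick `t` and before the next one at `t + 2`, which leaves
only `t + 1`. -/
theorem arrow_to_mid (hn : 1 ≤ n) (hc : (twClock n).IsCut h) {t : ℤ} {β γ : PosRoot (2 * n + 1)}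
    (hβ : InWin (twClock n) (4 * n + 2) h (mid n, t) β)
    (ha : Arrow ((twClock n).window (4 * n + 2) h) γ β) :
    ∃ a, a ≠ mid n ∧ InWin (twClock n) (4 * n + 2) h (a, t + 1) γ := by
  have ℒ := twLabelling n hn
  obtain ⟨w, hw, k, j, a, b, hk, hj, hab, hgreatest, hleast⟩ := ha
  have e := ℒ.rootAt_tick hc hw hj hβ
  simp only [Prod.mk.injEq] at e
  obtain ⟨rfl, ht⟩ := e
  have hab' : Adj (mid n) a := Adj.symm hab
  refine ⟨a, hab'.ne.symm, w, hw, k, hk, ?_⟩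
  have hjk : j < k := hleast.1.1
  have h1 : (twClock n).run h (w.take k) a = (twClock n).run h (w.take j) a :=
    run_take_eq h hjk.le fun r hr hrk hmem => by
      rcases hr.lt_or_eq with hr | rfl
      · have := hleast.2 ⟨hr, hmem⟩
        omega
      · exact hab'.ne (Option.some.inj (hj.1.symm.trans hmem))
  have h2 : (twClock n).run h (w.take k) (mid n) = (twClock n).run h (w.take (j + 1)) (mid n) :=
    run_take_eq h hjk fun r hr hrk hmem => by
      have := hgreatest.2 ⟨hrk, hmem⟩
      omega
  rw [run_take_succ h hj.1, twClock_step_mid] at h2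
  have h3 := hw.1.sink hj.1 _ hab'
  have h4 := hw.1.sink hk.1 _ hab'.symm
  simp only
  omega

theorem arrow_of_mid_tick (hn : 1 ≤ n) (hc : (twClock n).IsCut h) {t : ℤ} {b : Fin (2 * n + 1)}
    {β γ : PosRoot (2 * n + 1)} (hb : Adj (mid n) b)
    (hβ : InWin (twClock n) (4 * n + 2) h (mid n, t) β)
    (hγ : InWin (twClock n) (4 * n + 2) h (b, t - 1) γ) :
    Arrow ((twClock n).window (4 * n + 2) h) β γ := by
  have ℒ := twLabelling n hn
  obtain ⟨w, hw⟩ := ℒ.window_nonempty hc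
  obtain ⟨k, hk, ek⟩ := ℒ.inWin_rootAt hc hβ hw
  obtain ⟨j, hj, ej⟩ := ℒ.inWin_rootAt hc hγ hw
  simp only at hk ek hj ej
  have hsb := twClock_step (adj_mid_ne hb)
  have h1 := hw.1.sink hk.1 _ hb
  have h2 := hw.1.sink hj.1 _ hb.symm
  have h3 := (twCut_mid (hc.run (hw.1.take k)) hb).1
  have hjk : j < k := by
    by_contra hcon
    have := run_take_le (K := twClock n) (w := w) h (not_lt.mp hcon) b
    omega
  refine ⟨w, hw, k, j, _, _, hk, hj, hb, ⟨⟨hjk, hj.1⟩, ?_⟩, ⟨⟨hjk, hk.1⟩, ?_⟩⟩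
  · rintro j' ⟨h4, h5⟩
    by_contra hcon
    have h6 := run_take_lt (K := twClock n) h hj.1 (not_le.mp hcon)
    have h7 := run_take_lt (K := twClock n) h h5 h4
    omega
  · rintro k' ⟨h4, h5⟩
    by_contra hcon
    have h6 := run_take_lt (K := twClock n) h h5 (not_le.mp hcon)
    have h7 := run_take_le (K := twClock n) (w := w) h h4.le (mid n)
    rw [twClock_step_mid] at h6
    omega

theorem arrow_to_mid_tick (hn : 1 ≤ n) (hc : (twClock n).IsCut h) {t : ℤ} {b : Fin (2 * n + 1)}
    {β γ : PosRoot (2 * n + 1)} (hb : Adj (mid n) b)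
    (hβ : InWin (twClock n) (4 * n + 2) h (mid n, t) β)
    (hγ : InWin (twClock n) (4 * n + 2) h (b, t + 1) γ) :
    Arrow ((twClock n).window (4 * n + 2) h) γ β := by
  have ℒ := twLabelling n hn
  obtain ⟨w, hw⟩ := ℒ.window_nonempty hc
  obtain ⟨j, hj, ej⟩ := ℒ.inWin_rootAt hc hβ hw
  obtain ⟨k, hk, ek⟩ := ℒ.inWin_rootAt hc hγ hw
  simp only at hk ek hj ej
  have hsb := twClock_step (adj_mid_ne hb)
  have h1 := hw.1.sink hk.1 _ hb.symm
  have h2 := hw.1.sink hj.1 _ hb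
  have h3 := (twCut_mid (hc.run (hw.1.take k)) hb).2
  have hjk : j < k := by
    by_contra hcon
    have := run_take_le (K := twClock n) (w := w) h (not_lt.mp hcon) (mid n)
    omega
  refine ⟨w, hw, k, j, _, _, hk, hj, hb.symm, ⟨⟨hjk, hj.1⟩, ?_⟩, ⟨⟨hjk, hk.1⟩, ?_⟩⟩
  · rintro j' ⟨h4, h5⟩
    by_contra hcon
    have h6 := run_take_lt (K := twClock n) h hj.1 (not_le.mp hcon)
    have h7 := run_take_lt (K := twClock n) h h5 h4
    rw [twClock_step_mid] at h6 h7
    omega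
  · rintro k' ⟨h4, h5⟩
    by_contra hcon
    have h6 := run_take_lt (K := twClock n) h h5 (not_le.mp hcon)
    have h7 := run_take_le (K := twClock n) (w := w) h h4.le b
    omega

/-- Every middle vertex has a neighbour. -/
theorem exists_arrow_mid (hn : 1 ≤ n) (hc : (twClock n).IsCut h) {t : ℤ}
    {β : PosRoot (2 * n + 1)} (hβ : InWin (twClock n) (4 * n + 2) h (mid n, t) β) :
    (∃ γ, Arrow ((twClock n).window (4 * n + 2) h) β γ) ∨
      ∃ γ, Arrow ((twClock n).window (4 * n + 2) h) γ β := by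
  have ℒ := twLabelling n hn
  obtain ⟨s1, s2, s3⟩ := Labelling.inSpan hc hβ
  simp only [mir, mid_rev] at s1 s2 s3
  have hv : ((mid n : Fin (2 * n + 1)) : ℕ) = n := rfl
  have ht : t % 2 = 1 := by have := twClock_onTime s1; omega
  -- The neighbours of the middle alternate: one of them ticks at `t - 1` and the opposite one at `t
  -- + 1`. If the former tick precedes the window, the latter lies inside it.
  obtain ⟨b, hb, hon⟩ : ∃ b, Adj (mid n) b ∧ (twClock n).OnTime b (t - 1) := by
    by_cases hon : (t - 2 * n + 1) % 4 = 0
    · refine ⟨⟨n - 1, by omega⟩, ?_, twClock_onTime_of ?_⟩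
      · unfold Adj; simp only [mid]; omega
      · simp only; omega
    · refine ⟨⟨n + 1, by omega⟩, ?_, twClock_onTime_of ?_⟩
      · exact Or.inl rfl
      · simp only; omega
  have hb' : Adj (mid n) b.rev := by have := hb.rev; rwa [mid_rev] at this
  have hne : b ≠ mid n := hb.ne.symm
  have hne' : b.rev ≠ mid n := hb'.ne.symm
  have t1 := (onTime_of_ne_mid hne).mp hon
  have t2 := (onTime_of_ne_mid hne).mp (hc.onTime b)
  have t3 := (onTime_of_ne_mid hne').mp (hc.onTime b.rev)
  have c1 := twCut_mid hc hb
  have c2 := twCut_mid hc hb'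
  have r := Fin.val_rev b
  have l := b.2
  by_cases hin : h b ≤ t - 1
  · have hspan : InSpan (twClock n) (4 * n + 2) h (b, t - 1) :=
      ⟨hon, hin, by simp only [mir]; omega⟩
    obtain ⟨γ, hγ⟩ := ℒ.exists_inWin hc hspan
    exact Or.inl ⟨γ, arrow_of_mid_tick hn hc hb hβ hγ⟩
  · have hspan : InSpan (twClock n) (4 * n + 2) h (b.rev, t + 1) := by
      refine ⟨(onTime_of_ne_mid hne').mpr ?_, ?_, ?_⟩
      · omega
      · simp only; omega
      · simp only [mir, Fin.rev_rev]; omega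
    obtain ⟨γ, hγ⟩ := ℒ.exists_inWin hc hspan
    exact Or.inr ⟨γ, arrow_to_mid_tick hn hc hb' hβ hγ⟩

/-! ### Existence and rigidity of twisted coordinates -/

theorem exists_twistedCoordinate (hn : 1 ≤ n) (hc : (twClock n).IsCut h) :
    ∃ Ω, IsTwistedCoordinate ((twClock n).window (4 * n + 2) h) Ω := by
  have ℒ := twLabelling n hn
  have 𝒜 := arLabelling (2 * n) (by omega)
  have hA := arCut_isCut hc
  choose τ hτ using ℒ.exists_tick hc
  obtain ⟨ξ, ω, hξ, hω, hcoord⟩ := exists_arCoordinate (by omega) hA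
  have hmid : ∀ β, HasResidue ((twClock n).window (4 * n + 2) h) β (mid n) →
      ∃ t, τ β = (mid n, t) ∧ InWin (twClock n) (4 * n + 2) h (mid n, t) β := by
    rintro β ⟨w, hw, k, hk⟩
    have e := ℒ.rootAt_tick hc hw hk (hτ β)
    exact ⟨_, e, e ▸ hτ β⟩
  refine ⟨fun β => ((τ β).1, -(τ β).2), cutQuiver hA, ξ, ω, ?_, hξ, hω, ?_, ?_, ?_, ?_⟩
  · intro w hw
    have hpw := projWord_mem_window hc hw
    exact ⟨IsFull.isReducedLongest (𝒜.isFull hA hpw), (isAdapted_cutQuiver hA _).mpr hpw.1⟩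
  · intro w hw k i j β γ hi hk hγ
    obtain ⟨s, h1, h2⟩ := projWord_tick hn hc hw hi hk.1 hγ
    have e := ℒ.rootAt_tick hc hw hk (hτ β)
    rw [hcoord _ _ h1]
    simp only [e, Prod.mk.injEq, true_and]
    omega
  · intro β γ hβ _ ha
    obtain ⟨t, e, ht⟩ := hmid β hβ
    obtain ⟨a, -, h1⟩ := arrow_to_mid hn hc ht ha
    simp only [e, ℒ.inWin_tick_unique hc (hτ γ) h1, Prod.mk.injEq, true_and]
    omega
  · intro β γ hβ _ ha
    obtain ⟨t, e, ht⟩ := hmid β hβ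
    obtain ⟨b, -, h1⟩ := arrow_of_mid hn hc ht ha
    simp only [e, ℒ.inWin_tick_unique hc (hτ γ) h1, Prod.mk.injEq, true_and]
    omega
  · intro β γ δ hβ ha ha'
    obtain ⟨t, e, ht⟩ := hmid β hβ
    obtain ⟨a, -, h1⟩ := arrow_to_mid hn hc ht ha
    obtain ⟨b, -, h2⟩ := arrow_of_mid hn hc ht ha'
    simp only [e, ℒ.inWin_tick_unique hc (hτ γ) h1, ℒ.inWin_tick_unique hc (hτ δ) h2,
      Prod.mk.injEq, true_and]
    omega

/-- Twisted coordinates are determined up to a translation. -/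
theorem twistedCoordinate_rigid (hn : 1 ≤ n) (hc : (twClock n).IsCut h)
    {Ω : PosRoot (2 * n + 1) → Fin (2 * n + 1) × ℤ}
    (hΩ : IsTwistedCoordinate ((twClock n).window (4 * n + 2) h) Ω) :
    ∃ c, ∀ x β, InWin (twClock n) (4 * n + 2) h x β → Ω β = (x.1, c - x.2) := by
  have ℒ := twLabelling n hn
  have 𝒜 := arLabelling (2 * n) (by omega)
  have hA := arCut_isCut hc
  obtain ⟨Q, ξ, ω, hQ, hξ, hω, hside, hsink, hsource, hboth⟩ := hΩ
  obtain ⟨w, hw⟩ := ℒ.window_nonempty hc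
  -- The quiver in the definition is not a choice: a projected word is adapted to it and contains
  -- every letter, which fixes all orientations.
  obtain rfl : Q = cutQuiver hA := by
    have hpw := projWord_mem_window hc hw
    refine eq_cutQuiver hA hpw.1 (hQ w hw).2 fun i => ?_
    by_contra hi
    have h1 := congrFun hpw.2 i
    rw [run_of_notMem _ hi] at h1
    have := 𝒜.lt_mir _ hA i
    omega
  obtain ⟨c, hcoord⟩ := arCoordinate_rigid (by omega) hA hξ hω
  have side : ∀ i t β, i ≠ mid n → InWin (twClock n) (4 * n + 2) h (i, t) β →
      Ω β = (i, 2 * c - t) := by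
    intro i t β hi hβ
    obtain ⟨k, hk, ek⟩ := ℒ.inWin_rootAt hc hβ hw
    obtain ⟨j, rfl⟩ := exists_emb hi
    obtain ⟨γ, hγ, hγ'⟩ := exists_projWord_rootAt hn hc hw hk.1
    have e := two_mul_arCut (hc.run (hw.1.take k)) j
    rw [hside w hw k _ j β γ hi hk hγ, hcoord _ _ hγ']
    simp only [Prod.mk.injEq, true_and] at ek ⊢
    omega
  refine ⟨2 * c, ?_⟩
  rintro ⟨i, t⟩ β hβ
  by_cases hi : i = mid n
  · subst hi
    have hres : HasResidue ((twClock n).window (4 * n + 2) h) β (mid n) := by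
      obtain ⟨w, hw, k, hk, -⟩ := hβ
      exact ⟨w, hw, k, hk⟩
    by_cases hin : ∃ γ, Arrow ((twClock n).window (4 * n + 2) h) γ β
    · obtain ⟨γ, hγ⟩ := hin
      obtain ⟨a, ha, hγ'⟩ := arrow_to_mid hn hc hβ hγ
      have e : Ω β = (mid n, (Ω γ).2 + 1) := by
        by_cases hout : ∃ δ, Arrow ((twClock n).window (4 * n + 2) h) β δ
        · obtain ⟨δ, hδ⟩ := hout
          exact (hboth β γ δ hres hγ hδ).2
        · exact hsink β γ hres (fun δ hδ => hout ⟨δ, hδ⟩) hγ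
      rw [e, side _ _ _ ha hγ']
      simp only [Prod.mk.injEq, true_and]
      ring
    · obtain ⟨δ, hδ⟩ := (exists_arrow_mid hn hc hβ).resolve_right hin
      obtain ⟨b, hb, hδ'⟩ := arrow_of_mid hn hc hβ hδ
      rw [hsource β δ hres (fun γ hγ => hin ⟨γ, hγ⟩) hδ, side _ _ _ hb hδ']
      simp only [Prod.mk.injEq, true_and]
      ring
  · exact side i t β hi hβ

/-! ### Folded distances -/

/-- By rigidity the unknown additive constant cancels in differences, so the choice of coordinates
disappears from the set of pairs. -/
theorem mem_pairsAt_iff (hn : 1 ≤ n) (hc : (twClock n).IsCut h)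
    {Ω : PosRoot (2 * n + 1) → Fin (2 * n + 1) × ℤ}
    (hΩ : IsTwistedCoordinate ((twClock n).window (4 * n + 2) h) Ω) (k l : Fin (n + 1)) (t : ℕ)
    (p : PosRoot (2 * n + 1) × PosRoot (2 * n + 1)) :
    p ∈ pairsAt ((twClock n).window (4 * n + 2) h) Ω k l t ↔
      (Prec ((twClock n).window (4 * n + 2) h) p.1 p.2 ∨
        Prec ((twClock n).window (4 * n + 2) h) p.2 p.1) ∧
      ∃ x y, InWin (twClock n) (4 * n + 2) h x p.1 ∧ InWin (twClock n) (4 * n + 2) h y p.2 ∧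
        |x.2 - y.2| = t ∧
        ((orbit n x.1 = k ∧ orbit n y.1 = l) ∨ (orbit n x.1 = l ∧ orbit n y.1 = k)) := by
  have ℒ := twLabelling n hn
  obtain ⟨c, hcoord⟩ := twistedCoordinate_rigid hn hc hΩ
  refine and_congr_right fun _ => ?_
  constructor
  · rintro ⟨a, b, hab, ht⟩
    obtain ⟨x, hx⟩ := ℒ.exists_tick hc p.1
    obtain ⟨y, hy⟩ := ℒ.exists_tick hc p.2
    refine ⟨x, y, hx, hy, ?_⟩
    rw [folded, folded, hcoord x _ hx, hcoord y _ hy, Set.pair_eq_pair_iff] at hab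
    simp only [Prod.mk.injEq] at hab
    rcases hab with ⟨⟨h1, h2⟩, h3, h4⟩ | ⟨⟨h1, h2⟩, h3, h4⟩
    · refine ⟨?_, Or.inl ⟨h1, h3⟩⟩
      rw [← ht, abs_sub_comm]
      congr 1
      omega
    · refine ⟨?_, Or.inr ⟨h1, h3⟩⟩
      rw [← ht]
      congr 1
      omega
  · rintro ⟨x, y, hx, hy, ht, h | h⟩
    · refine ⟨c - x.2, c - y.2, ?_, ?_⟩
      · rw [folded, folded, hcoord x _ hx, hcoord y _ hy, h.1, h.2]
      · rw [← ht, abs_sub_comm]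
        congr 1
        omega
    · refine ⟨c - y.2, c - x.2, ?_, ?_⟩
      · rw [folded, folded, hcoord x _ hx, hcoord y _ hy, h.1, h.2, Set.pair_comm]
      · rw [← ht]
        congr 1
        omega

theorem gdist_eq_of_mem_pairsAt (hn : 1 ≤ n) {h' : Fin (2 * n + 1) → ℤ}
    (hc : (twClock n).IsCut h) (hc' : (twClock n).IsCut h')
    {Ω Ω' : PosRoot (2 * n + 1) → Fin (2 * n + 1) × ℤ}
    (hΩ : IsTwistedCoordinate ((twClock n).window (4 * n + 2) h) Ω)
    (hΩ' : IsTwistedCoordinate ((twClock n).window (4 * n + 2) h') Ω') {k l : Fin (n + 1)} {t : ℕ}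
    {p p' : PosRoot (2 * n + 1) × PosRoot (2 * n + 1)}
    (hp : p ∈ pairsAt ((twClock n).window (4 * n + 2) h) Ω k l t)
    (hp' : p' ∈ pairsAt ((twClock n).window (4 * n + 2) h') Ω' k l t) :
    gdist ((twClock n).window (4 * n + 2) h) (pairSeq p.1 p.2) =
      gdist ((twClock n).window (4 * n + 2) h') (pairSeq p'.1 p'.2) := by
  obtain ⟨-, x, y, hx, hy, ht, ho⟩ := (mem_pairsAt_iff hn hc hΩ k l t p).mp hp
  obtain ⟨-, x', y', hx', hy', ht', ho'⟩ :=
    (mem_pairsAt_iff hn hc' hΩ' k l t p').mp hp'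
  -- Folded coordinates are only given as an unordered pair; if the orbits do not match in order,
  -- the second pair is swapped.
  by_cases hsame : orbit n x.1 = orbit n x'.1 ∧ orbit n y.1 = orbit n y'.1
  · exact (samePair_of_folded hn hc hc' hx hy hx' hy' hsame.1 hsame.2 (ht.trans ht'.symm)).1
  · rw [pairSeq_comm p'.1]
    refine (samePair_of_folded hn hc hc' hx hy hy' hx' ?_ ?_
      (ht.trans (ht'.symm.trans (abs_sub_comm _ _)))).1
    · rcases ho with ⟨h1, h2⟩ | ⟨h1, h2⟩ <;> rcases ho' with ⟨h3, h4⟩ | ⟨h3, h4⟩ <;> simp_all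
    · rcases ho with ⟨h1, h2⟩ | ⟨h1, h2⟩ <;> rcases ho' with ⟨h3, h4⟩ | ⟨h3, h4⟩ <;> simp_all

theorem gdist_eq_zero_of_mem_pairsAt (hn : 1 ≤ n) (hc : (twClock n).IsCut h)
    {Ω : PosRoot (2 * n + 1) → Fin (2 * n + 1) × ℤ}
    (hΩ : IsTwistedCoordinate ((twClock n).window (4 * n + 2) h) Ω) {k l : Fin (n + 1)} {t : ℕ}
    (ht : 4 * n + 2 ≤ t) {p : PosRoot (2 * n + 1) × PosRoot (2 * n + 1)}
    (hp : p ∈ pairsAt ((twClock n).window (4 * n + 2) h) Ω k l t) :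
    gdist ((twClock n).window (4 * n + 2) h) (pairSeq p.1 p.2) = 0 := by
  have ℒ := twLabelling n hn
  obtain ⟨-, x, y, hx, hy, hxy, -⟩ := (mem_pairsAt_iff hn hc hΩ k l t p).mp hp
  rcases abs_choice (x.2 - y.2) with e | e
  · rw [pairSeq_comm]
    exact ℒ.gdist_eq_zero_of_far hc hy hx (by omega)
  · exact ℒ.gdist_eq_zero_of_far hc hx hy (by omega)

/-- The realised ticks have the same folded data, so `samePair_of_folded` transfers comparability as
well as distance. -/
theorem exists_mem_pairsAt (hn : 1 ≤ n) {h' : Fin (2 * n + 1) → ℤ}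
    (hc : (twClock n).IsCut h) (hc' : (twClock n).IsCut h')
    {Ω Ω' : PosRoot (2 * n + 1) → Fin (2 * n + 1) × ℤ}
    (hΩ : IsTwistedCoordinate ((twClock n).window (4 * n + 2) h) Ω)
    (hΩ' : IsTwistedCoordinate ((twClock n).window (4 * n + 2) h') Ω') {k l : Fin (n + 1)} {t : ℕ}
    (ht : t < 4 * n + 2) {p : PosRoot (2 * n + 1) × PosRoot (2 * n + 1)}
    (hp : p ∈ pairsAt ((twClock n).window (4 * n + 2) h) Ω k l t) :
    ∃ p', p' ∈ pairsAt ((twClock n).window (4 * n + 2) h') Ω' k l t := by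
  have ℒ := twLabelling n hn
  obtain ⟨hprec, x, y, hx, hy, hxy, ho⟩ := (mem_pairsAt_iff hn hc hΩ k l t p).mp hp
  obtain ⟨x', y', sx, sy, ex, ey, e⟩ := exists_inSpan_pair hn hc' (Labelling.inSpan hc hx).1
    (Labelling.inSpan hc hy).1 (by omega)
  obtain ⟨α, hα⟩ := ℒ.exists_inWin hc' sx
  obtain ⟨β, hβ⟩ := ℒ.exists_inWin hc' sy
  refine ⟨(α, β), (mem_pairsAt_iff hn hc' hΩ' k l t _).mpr
    ⟨(samePair_of_folded hn hc hc' hx hy hα hβ ex ey e).2.mp hprec, x', y', hα, hβ,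
      e.symm.trans hxy, ?_⟩⟩
  rwa [← ex, ← ey]

theorem commonDist_eq (hn : 1 ≤ n) {h' : Fin (2 * n + 1) → ℤ}
    (hc : (twClock n).IsCut h) (hc' : (twClock n).IsCut h')
    {Ω Ω' : PosRoot (2 * n + 1) → Fin (2 * n + 1) × ℤ}
    (hΩ : IsTwistedCoordinate ((twClock n).window (4 * n + 2) h) Ω)
    (hΩ' : IsTwistedCoordinate ((twClock n).window (4 * n + 2) h') Ω') (k l : Fin (n + 1))
    (t : ℕ) : commonDist ((twClock n).window (4 * n + 2) h) Ω k l t =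
      commonDist ((twClock n).window (4 * n + 2) h') Ω' k l t := by
  rcases lt_or_ge t (4 * n + 2) with ht | ht
  · refine congrArg sSup (Set.Subset.antisymm ?_ ?_)
    · rintro _ ⟨p, hp, rfl⟩
      obtain ⟨p', hp'⟩ := exists_mem_pairsAt hn hc hc' hΩ hΩ' ht hp
      exact ⟨p', hp', gdist_eq_of_mem_pairsAt hn hc' hc hΩ' hΩ hp' hp⟩
    · rintro _ ⟨p, hp, rfl⟩
      obtain ⟨p', hp'⟩ := exists_mem_pairsAt hn hc' hc hΩ' hΩ ht hp
      exact ⟨p', hp', gdist_eq_of_mem_pairsAt hn hc hc' hΩ hΩ' hp' hp⟩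
  -- At these distances pairs need not exist in both windows, but they contribute only zeros, and
  -- the supremum of the empty set is 0.
  · have key : ∀ {h : Fin (2 * n + 1) → ℤ} {Ω : PosRoot (2 * n + 1) → Fin (2 * n + 1) × ℤ},
        (twClock n).IsCut h → IsTwistedCoordinate ((twClock n).window (4 * n + 2) h) Ω →
        commonDist ((twClock n).window (4 * n + 2) h) Ω k l t = 0 := by
      intro h Ω hc hΩ
      refine Nat.le_zero.mp (csSup_le' ?_)
      rintro _ ⟨p, hp, rfl⟩
      exact (gdist_eq_zero_of_mem_pairsAt hn hc hΩ ht hp).le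
    rw [key hc hΩ, key hc' hΩ']

end TwistedAR
-- Invariance over the cluster point
theorem mainTheorem9 (n : ℕ) (hn : 1 ≤ n)
    (𝕜 : Type*) [Field 𝕜] [Algebra (RatFunc ℂ) 𝕜] [IsAlgClosure (RatFunc ℂ) 𝕜]
    (qs : 𝕜) (hqs : qs ^ 2 = algebraMap (RatFunc ℂ) 𝕜 RatFunc.X) :
    (∀ C ∈ TwistedAR.twistedCluster n, ∃ Ω, TwistedAR.IsTwistedCoordinate C Ω) ∧
    (∀ C ∈ TwistedAR.twistedCluster n, ∀ Ω, TwistedAR.IsTwistedCoordinate C Ω →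
      ∀ (k l : Fin (n + 1)) (t : ℕ),
        ∀ p ∈ TwistedAR.pairsAt C Ω k l t, ∀ p' ∈ TwistedAR.pairsAt C Ω k l t,
          TwistedAR.gdist C (TwistedAR.pairSeq p.1 p.2) =
            TwistedAR.gdist C (TwistedAR.pairSeq p'.1 p'.2)) ∧
    (∀ C ∈ TwistedAR.twistedCluster n, ∀ C' ∈ TwistedAR.twistedCluster n,
      ∀ Ω, TwistedAR.IsTwistedCoordinate C Ω → ∀ Ω', TwistedAR.IsTwistedCoordinate C' Ω' →
        ∀ k l : Fin (n + 1),
          TwistedAR.foldedDistPoly qs C Ω k l = TwistedAR.foldedDistPoly qs C' Ω' k l) := by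
  refine ⟨fun C hC => ?_, fun C hC Ω hΩ k l t p hp p' hp' => ?_,
    fun C hC C' hC' Ω hΩ Ω' hΩ' k l => ?_⟩
  · obtain ⟨h, hc, rfl⟩ := TwistedAR.exists_window_of_mem_twistedCluster hn hC
    exact TwistedAR.exists_twistedCoordinate hn hc
  · obtain ⟨h, hc, rfl⟩ := TwistedAR.exists_window_of_mem_twistedCluster hn hC
    exact TwistedAR.gdist_eq_of_mem_pairsAt hn hc hc hΩ hΩ hp hp'
  · obtain ⟨h, hc, rfl⟩ := TwistedAR.exists_window_of_mem_twistedCluster hn hC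
    obtain ⟨h', hc', rfl⟩ := TwistedAR.exists_window_of_mem_twistedCluster hn hC'
    simp only [TwistedAR.foldedDistPoly, TwistedAR.commonDist_eq hn hc hc' hΩ hΩ' k l]
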